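/- Let $d\ge 2$ and $p>0$, with $p<\frac{4}{d-2}$ if $d\ge 3$. For $r\ge 0$ put $$V_d(r)=\frac{(d-1)(d-3)}{4}\,\frac{r^2-\sinh^2 r}{r^2\sinh^2 r},\qquad K(r)=\frac1{p+2}\Big(\frac{r}{\sinh r}\Big)^{\frac{(d-1)p}{2}},\qquad F(x,u)=K(|x|)\,|u|^{p+2}$$ (extended continuously to $r=0$). Let $\Lambda>-\big(\frac{d-1}{2}\big)^2$, $\mu_d=\Lambda+\big(\frac{d-1}{2}\big)^2>0$ and $\lambda>0$. For real-valued or complex-valued $u\in H^1(\mathbb R^d)$ put $$\mathcal E_1(u)=\int_{\mathbb R^d}\Big[\tfrac12|\nabla u|^2+\tfrac12 V_d(|x|)|u|^2-F(x,u)\Big]dx,\qquad \mathcal E_2(u)=\int_{\mathbb R^d}\Big[\tfrac12|\nabla u|^2+\tfrac12\big(\mu_d+V_d(|x|)\big)|u|^2\Big]dx,$$ and consider the constrained minimization problems $$I_\lambda=\inf\{\mathcal E_1(u): u\in H^1(\mathbb R^d),\ \|u\|_{L^2}^2=\lambda\},\qquad J_\lambda=\inf\Big\{\mathcal E_2(u):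 u\in H^1(\mathbb R^d),\ \int_{\mathbb R^d} F(x,u)\,dx=\lambda\Big\}.$$ Lemma (soliton regularity and exponential decay). If $u$ is a spherically symmetric minimizer of $I_\lambda$ or of $J_\lambda$, then, after modification on a null set, $u\in C^2(\mathbb R^d)$, and there are constants $C,\delta>0$ such that $$|D^\alpha u(x)|\le C e^{-\delta|x|}\qquad\text{for all }x\in\mathbb R^d\text{ and all }|\alpha|\le 2 .$$ -/

import Mathlib

open MeasureTheory
open scoped ContDiff

noncomputable section

namespace HypSoliton

/-- Euclidean space `ℝ^d`. -/
abbrev Space (d : ℕ) : Type := EuclideanSpace ℝ (Fin d)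

/-- `G` is the weak gradient of `u` on `ℝ^d`: for every real test function `φ` and every `i`,
`∫ (∂ᵢ φ) u = - ∫ φ Gᵢ`. -/
def IsWeakGradient {𝕜 : Type*} [RCLike 𝕜] {d : ℕ}
    (u : Space d → 𝕜) (G : Fin d → Space d → 𝕜) : Prop :=
  ∀ φ : Space d → ℝ, ContDiff ℝ ∞ φ → HasCompactSupport φ → ∀ i : Fin d,
    ∫ x, (fderiv ℝ φ x (EuclideanSpace.single i (1 : ℝ))) • u x = - ∫ x, φ x • G i x

/-- `u ∈ H¹(ℝ^d)` with weak gradient `G` (which is unique up to null sets): `u` and the components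
of `G` are square integrable, and `G` is the weak gradient of `u`. -/
structure MemH1WithGradient {𝕜 : Type*} [RCLike 𝕜] {d : ℕ}
    (u : Space d → 𝕜) (G : Fin d → Space d → 𝕜) : Prop where
  memLp : MemLp u 2 volume
  memLp_gradient : ∀ i, MemLp (G i) 2 volume
  isWeakGradient : IsWeakGradient u G

/-- `V_d(r) = ((d-1)(d-3)/4) (r² - sinh² r) / (r² sinh² r)`, extended continuously to `r = 0`. -/
def potential (d : ℕ) (r : ℝ) : ℝ :=
  ((d : ℝ) - 1) * ((d : ℝ) - 3) / 4 *
    (if r = 0 then -(1 / 3) else (r ^ 2 - Real.sinh r ^ 2) / (r ^ 2 * Real.sinh r ^ 2))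

/-- `K(r) = (1/(p+2)) (r / sinh r)^((d-1)p/2)`, extended continuously to `r = 0`. -/
def weight (d : ℕ) (p : ℝ) (r : ℝ) : ℝ :=
  1 / (p + 2) * (if r = 0 then 1 else r / Real.sinh r) ^ (((d : ℝ) - 1) * p / 2)

/-- `∫ F(x,u) dx`, where `F(x,u) = K(|x|) |u|^(p+2)`. -/
def nonlinearTerm {𝕜 : Type*} [RCLike 𝕜] (d : ℕ) (p : ℝ) (u : Space d → 𝕜) : ℝ :=
  ∫ x, weight d p ‖x‖ * ‖u x‖ ^ (p + 2)

/-- `∫ (½ |∇u|² + ½ c(|x|) |u|²) dx`, where `G = ∇u`. -/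
def quadraticTerm {𝕜 : Type*} [RCLike 𝕜] (d : ℕ) (c : ℝ → ℝ)
    (u : Space d → 𝕜) (G : Fin d → Space d → 𝕜) : ℝ :=
  ∫ x, (1 / 2 * ∑ i, ‖G i x‖ ^ 2 + 1 / 2 * c ‖x‖ * ‖u x‖ ^ 2)

/-- `𝓔₁(u) = ∫ (½ |∇u|² + ½ V_d |u|² - F(x,u)) dx`, where `G = ∇u`. -/
def energy₁ {𝕜 : Type*} [RCLike 𝕜] (d : ℕ) (p : ℝ)
    (u : Space d → 𝕜) (G : Fin d → Space d → 𝕜) : ℝ :=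
  quadraticTerm d (potential d) u G - nonlinearTerm d p u

/-- `𝓔₂(u) = ∫ (½ |∇u|² + ½ (μ + V_d) |u|²) dx`, where `G = ∇u` and `μ = Λ + ((d-1)/2)²`. -/
def energy₂ {𝕜 : Type*} [RCLike 𝕜] (d : ℕ) (Λ : ℝ)
    (u : Space d → 𝕜) (G : Fin d → Space d → 𝕜) : ℝ :=
  quadraticTerm d (fun r => Λ + (((d : ℝ) - 1) / 2) ^ 2 + potential d r) u G

/-- `u` is a minimizer for `I_lam = inf {𝓔₁(v) : v ∈ H¹(ℝ^d), ‖v‖²_{L²} = lam}`. -/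
def IsMinimizerI {𝕜 : Type*} [RCLike 𝕜] (d : ℕ) (p lam : ℝ) (u : Space d → 𝕜) : Prop :=
  ∃ G : Fin d → Space d → 𝕜, MemH1WithGradient u G ∧ (∫ x, ‖u x‖ ^ 2) = lam ∧
    ∀ (v : Space d → 𝕜) (H : Fin d → Space d → 𝕜), MemH1WithGradient v H →
      (∫ x, ‖v x‖ ^ 2) = lam → energy₁ d p u G ≤ energy₁ d p v H

/-- `u` is a minimizer for `J_lam = inf {𝓔₂(v) : v ∈ H¹(ℝ^d), ∫ F(x,v) dx = lam}`, where `𝓔₂` is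
formed with the soliton parameter `Λ`. -/
def IsMinimizerJ {𝕜 : Type*} [RCLike 𝕜] (d : ℕ) (p Λ lam : ℝ) (u : Space d → 𝕜) : Prop :=
  ∃ G : Fin d → Space d → 𝕜, MemH1WithGradient u G ∧ nonlinearTerm d p u = lam ∧
    ∀ (v : Space d → 𝕜) (H : Fin d → Space d → 𝕜), MemH1WithGradient v H →
      nonlinearTerm d p v = lam → energy₂ d Λ u G ≤ energy₂ d Λ v H

/-- `u` (as a function defined up to null sets) depends on `|x|` only. -/
def IsSphericallySymmetric {𝕜 : Type*} [RCLike 𝕜] {d : ℕ} (u : Space d → 𝕜) : Prop :=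
  ∃ f : ℝ → 𝕜, ∀ᵐ x ∂(volume : Measure (Space d)), u x = f ‖x‖

end HypSoliton

end

/-! A minimizer solves −Δu + (w + V)u = a K |u|^p u weakly, with a real and w > 0. The equation
comes from a one-variable argument: u + tv is rescaled back to the constraint, homogeneity makes the
energy an explicit function of t, and its derivative at 0 vanishes. For J the frequency w is μ_d.
For I it is (pN − 2𝓔₁(u))/λ with N = ∫F(x,u) > 0, and it is positive because spread-out bumps show
I_λ ≤ 0 (`exists_energy₁_le`).

Symmetry then reduces everything to one dimension; neither Sobolev embedding nor elliptic regularity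
enters. Testing the weak gradient with radial fields shows that u(x) = f(|x|) with f locally
absolutely continuous on (0, ∞), and the equation becomes (r^(d−1) f')' = r^(d−1) g with g = (w +
V)f − aK|f|^p f (`profileRHS`). Hence f is C² away from the origin.

Near the origin, finite energy gives f = O(r^(−β)) for every positive β above (d−2)/2.
Subcriticality allows pβ < 2, so the factor |f|^p is less singular than r^(−2). The flux r^(d−1) f'
is small along a sequence of radii tending to 0, since otherwise f' would not be square integrable.
Integrating the equation twice from there improves the exponent by a fixed amount, and finitely many
rounds bound f (`profile_bounded_near_zero`). Then f'/r tends to g(0)/d and r(f'/r)' tends to 0,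
which is what makes f(|x|) of class C² at the origin (`contDiff_two_radial`).

At infinity f and V tend to 0, so the factor w + V − aK|f|^p is eventually at least w/2 and y = |f|²
satisfies y'' + ((d−1)/r) y' ≥ w y. Comparison with exp(−√w r) by a maximum principle
(`le_exp_of_deriv2_ge`) gives the decay of f; g inherits it from the equation, f' from a difference
over unit intervals, and the derivatives of u up to order two from these three. -/

open scoped ContDiff

noncomputable section

namespace HypSoliton

open Set Filter Topology

/-! ### Weak derivatives on the half-line -/

section

/-- Smooth functions on the line with compact support in `(0, ∞)`. -/
structure IsHalfLineTest (ψ : ℝ → ℝ) : Prop where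
  contDiff : ContDiff ℝ ∞ ψ
  hasCompactSupport : HasCompactSupport ψ
  tsupport_subset : tsupport ψ ⊆ Ioi 0

/-- The clauses a < 1 < b keep the interval nondegenerate, also when ψ vanishes identically. -/
theorem IsHalfLineTest.exists_bounds {ψ : ℝ → ℝ} (hψ : IsHalfLineTest ψ) :
    ∃ a b : ℝ, 0 < a ∧ a < 1 ∧ 1 < b ∧ ∀ x, x ∉ Ioo a b → ψ x = 0 := by
  obtain ⟨b, hb⟩ := hψ.hasCompactSupport.isCompact.bddAbove
  rcases (tsupport ψ).eq_empty_or_nonempty with h | h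
  · refine ⟨1 / 2, 2, by norm_num, by norm_num, by norm_num, fun x _ => ?_⟩
    exact image_eq_zero_of_notMem_tsupport (by simp [h])
  · obtain ⟨a, ha, hle⟩ := hψ.hasCompactSupport.isCompact.exists_isLeast h
    have ha0 : 0 < a := hψ.tsupport_subset ha
    refine ⟨min (a / 2) (1 / 2), max (b + 1) 2, by positivity, ?_, ?_, fun x hx => ?_⟩
    · exact (min_le_right _ _).trans_lt (by norm_num)
    · exact lt_of_lt_of_le (by norm_num) (le_max_right _ _)
    · refine image_eq_zero_of_notMem_tsupport fun hx' => hx ⟨?_, ?_⟩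
      · exact (min_le_left _ _).trans_lt (by linarith [hle hx'])
      · exact lt_of_lt_of_le (by linarith [hb hx']) (le_max_left _ _)

theorem isHalfLineTest_of_bounds {ψ : ℝ → ℝ} (hψ : ContDiff ℝ ∞ ψ) {a b : ℝ} (ha : 0 < a)
    (h : ∀ x, x ∉ Ioo a b → ψ x = 0) : IsHalfLineTest ψ := by
  have hts : tsupport ψ ⊆ Icc a b := by
    refine closure_minimal (fun x hx => ?_) isClosed_Icc
    by_contra h'
    exact hx (h x fun h'' => h' (Ioo_subset_Icc_self h''))
  exact ⟨hψ, isCompact_Icc.of_isClosed_subset (isClosed_tsupport _) hts,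
    hts.trans fun x hx => ha.trans_le hx.1⟩

variable {E : Type*} [NormedAddCommGroup E]

theorem integrableOn_of_locallyIntegrableOn_Ioi {h : ℝ → E} (hh : LocallyIntegrableOn h (Ioi 0))
    {a b : ℝ} (ha : 0 < a) : IntegrableOn h (Icc a b) :=
  hh.integrableOn_compact_subset (fun _ hx => ha.trans_le hx.1) isCompact_Icc

theorem intervalIntegrable_of_locallyIntegrableOn_Ioi {h : ℝ → E}
    (hh : LocallyIntegrableOn h (Ioi 0)) {a b : ℝ} (ha : 0 < a) (hb : 0 < b) :
    IntervalIntegrable h volume a b := by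
  rw [intervalIntegrable_iff']
  exact hh.integrableOn_compact_subset (fun x hx => (lt_min ha hb).trans_le hx.1) isCompact_uIcc

variable [NormedSpace ℝ E]

/-- Since h is only integrable, its primitive need not be differentiable everywhere, and the
integration by parts is Fubini on the triangle a < y ≤ x ≤ b. The boundary term at b dies with ψ,
the one at a with the primitive. -/
theorem integral_deriv_smul_primitive [CompleteSpace E] {a b : ℝ} {ψ : ℝ → ℝ}
    (hψ : ContDiff ℝ 1 ψ) (hb : ψ b = 0) {h : ℝ → E} (hh : IntegrableOn h (Ioc a b)) :
    ∫ x in Ioc a b, deriv ψ x • ∫ y in a..x, h y = - ∫ x in Ioc a b, ψ x • h x := by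
  have hd : Continuous (deriv ψ) := hψ.continuous_deriv le_rfl
  have hdi : IntegrableOn (deriv ψ) (Ioc a b) :=
    (hd.integrableOn_Icc (a := a) (b := b)).mono_set Ioc_subset_Icc_self
  let k : ℝ → ℝ → E := fun x y => {q : ℝ × ℝ | q.2 ≤ q.1}.indicator
    (fun q => deriv ψ q.1 • h q.2) (x, y)
  have hk : Integrable (Function.uncurry k)
      ((volume.restrict (Ioc a b)).prod (volume.restrict (Ioc a b))) := by
    refine (Integrable.smul_prod hdi hh).indicator ?_
    exact measurableSet_le measurable_snd measurable_fst
  have hsw := integral_integral_swap hk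
  have h1 : ∫ x in Ioc a b, ∫ y in Ioc a b, k x y
      = ∫ x in Ioc a b, deriv ψ x • ∫ y in a..x, h y := by
    refine setIntegral_congr_fun measurableSet_Ioc fun x hx => ?_
    have : (fun y => k x y) = (Iic x).indicator (fun y => deriv ψ x • h y) := by
      ext y; simp [k, indicator]
    simp only [this]
    rw [integral_indicator measurableSet_Iic, Measure.restrict_restrict measurableSet_Iic,
      integral_smul, intervalIntegral.integral_of_le hx.1.le]
    congr 3
    rw [show Iic x ∩ Ioc a b = Ioc a x by ext y; simp; grind]
  have h2 : ∫ y in Ioc a b, ∫ x in Ioc a b, k x y = ∫ y in Ioc a b, (- ψ y) • h y := by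
    refine setIntegral_congr_fun measurableSet_Ioc fun y hy => ?_
    have : (fun x => k x y) = (Ici y).indicator (fun x => deriv ψ x • h y) := by
      ext x; simp [k, indicator]
    simp only [this]
    rw [integral_indicator measurableSet_Ici, Measure.restrict_restrict measurableSet_Ici,
      integral_smul_const]
    congr 1
    rw [show Ici y ∩ Ioc a b = Icc y b by ext y; simp; grind, integral_Icc_eq_integral_Ioc,
      ← intervalIntegral.integral_of_le hy.2, intervalIntegral.integral_deriv_eq_sub, hb, zero_sub]
    · exact fun x _ => (hψ.differentiable one_ne_zero) x
    · exact hd.intervalIntegrable _ _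
  rw [← h1, hsw, h2]
  simp [integral_neg]

theorem setIntegral_Ioi_eq_Ioc {a b : ℝ} (ha : 0 < a) {F : ℝ → E}
    (hF : ∀ x, x ∉ Ioo a b → F x = 0) : ∫ x in Ioi 0, F x = ∫ x in Ioc a b, F x := by
  refine setIntegral_eq_of_subset_of_forall_sdiff_eq_zero measurableSet_Ioi
    (fun x hx => ha.trans hx.1) fun x hx => hF x fun h => hx.2 (Ioo_subset_Ioc_self h)

theorem deriv_eq_zero_of_notMem_Ioo {ψ : ℝ → ℝ} (hψ : ContDiff ℝ ∞ ψ) {a b : ℝ}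
    (h : ∀ x, x ∉ Ioo a b → ψ x = 0) (x : ℝ) (hx : x ∉ Ioo a b) : deriv ψ x = 0 := by
  have hd : Continuous (deriv ψ) := hψ.continuous_deriv (by simp)
  have key : ∀ y, (y < a ∨ b < y) → deriv ψ y = 0 := by
    intro y hy
    have : ψ =ᶠ[𝓝 y] fun _ => 0 := by
      rcases hy with hy | hy
      · filter_upwards [Iio_mem_nhds hy] with z hz using h z fun h' => lt_asymm h'.1 hz
      · filter_upwards [Ioi_mem_nhds hy] with z hz using h z fun h' => lt_asymm h'.2 hz
    rw [this.deriv_eq]; simp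
  have hcl : IsClosed {y | deriv ψ y = 0} := isClosed_eq hd continuous_const
  rcases le_or_gt x a with hxa | hxa
  · have : Iic a ⊆ {y | deriv ψ y = 0} := by
      rw [← closure_Iio]; exact closure_minimal (fun y hy => key y (Or.inl hy)) hcl
    exact this hxa
  · have hxb : b ≤ x := by by_contra h'; exact hx ⟨hxa, not_le.1 h'⟩
    have : Ici b ⊆ {y | deriv ψ y = 0} := by
      rw [← closure_Ioi]; exact closure_minimal (fun y hy => key y (Or.inr hy)) hcl
    exact this hxb

theorem continuousOn_primitive_Ioi {h : ℝ → E} (hh : LocallyIntegrableOn h (Ioi 0)) :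
    ContinuousOn (fun r => ∫ t in (1 : ℝ)..r, h t) (Ioi 0) := by
  intro r hr
  have hr' : (0 : ℝ) < r := hr
  have hsub : IntegrableOn h (uIcc (min 1 r / 2) (max 1 r + 1)) := by
    refine hh.integrableOn_compact_subset (fun x hx => ?_) isCompact_uIcc
    have h0 : 0 < min 1 r := lt_min one_pos hr'
    have : min 1 r ≤ max 1 r := min_le_max
    rw [uIcc_of_le (by linarith)] at hx
    exact lt_of_lt_of_le (by positivity) hx.1
  have h0 : 0 < min 1 r := lt_min one_pos hr'
  have h1 : min 1 r ≤ 1 := min_le_left _ _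
  have h2 : min 1 r ≤ r := min_le_right _ _
  have h3 : 1 ≤ max 1 r := le_max_left _ _
  have h4 : r ≤ max 1 r := le_max_right _ _
  have := intervalIntegral.continuousOn_primitive_interval' (a := 1)
    ((intervalIntegrable_iff').2 hsub) (by rw [uIcc_of_le (by linarith)]; constructor <;> linarith)
  refine (this.continuousAt ?_).continuousWithinAt
  rw [uIcc_of_le (by linarith)]
  exact Icc_mem_nhds (by linarith) (by linarith)

theorem LocallyIntegrableOn.smul_test_integrableOn {f : ℝ → E}
    (hf : LocallyIntegrableOn f (Ioi 0)) {φ : ℝ → ℝ} (hφ : Continuous φ) {a b : ℝ} (ha : 0 < a) :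
    IntegrableOn (fun x => φ x • f x) (Ioc a b) :=
  ((integrableOn_of_locallyIntegrableOn_Ioi hf ha).continuousOn_smul hφ.continuousOn
    isCompact_Icc).mono_set Ioc_subset_Icc_self

theorem setIntegral_Ioi_deriv_smul_primitive [CompleteSpace E] {h : ℝ → E}
    (hh : LocallyIntegrableOn h (Ioi 0)) {ψ : ℝ → ℝ} (hψ : IsHalfLineTest ψ) :
    ∫ x in Ioi 0, deriv ψ x • ∫ t in (1 : ℝ)..x, h t = - ∫ x in Ioi 0, ψ x • h x := by
  obtain ⟨a, b, ha, ha1, hb, hab⟩ := hψ.exists_bounds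
  have hb' : ψ b = 0 := hab b (by simp)
  have ha' : ψ a = 0 := hab a (by simp)
  have hψ1 : ContDiff ℝ 1 ψ := hψ.contDiff.of_le (by simp)
  have hdψ := deriv_eq_zero_of_notMem_Ioo hψ.contDiff hab
  have hd : Continuous (deriv ψ) := hψ1.continuous_deriv le_rfl
  rw [setIntegral_Ioi_eq_Ioc ha (fun x hx => by rw [hdψ x hx, zero_smul]),
    setIntegral_Ioi_eq_Ioc ha (fun x hx => by rw [hab x hx, zero_smul]),
    ← integral_deriv_smul_primitive hψ1 hb'
      ((integrableOn_of_locallyIntegrableOn_Ioi hh ha).mono_set Ioc_subset_Icc_self)]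
  -- Moving the base point from 1 to a adds a constant vector, whose pairing with ψ' is zero because
  -- ψ vanishes at both ends.
  have hx : ∀ x ∈ Ioc a b, deriv ψ x • ∫ t in (1 : ℝ)..x, h t
      = deriv ψ x • (∫ t in a..x, h t) + deriv ψ x • ∫ t in (1 : ℝ)..a, h t := by
    intro x hx
    have hx0 : 0 < x := ha.trans hx.1
    rw [← smul_add, add_comm, intervalIntegral.integral_add_adjacent_intervals
      (intervalIntegrable_of_locallyIntegrableOn_Ioi hh one_pos ha)
      (intervalIntegrable_of_locallyIntegrableOn_Ioi hh ha hx0)]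
  have hcont : ContinuousOn (fun x => ∫ t in a..x, h t) (Icc a b) := by
    have := intervalIntegral.continuousOn_primitive_interval (a := a) (b := b) (f := h)
      (μ := volume) (by
        rw [uIcc_of_le (by linarith)]; exact integrableOn_of_locallyIntegrableOn_Ioi hh ha)
    rwa [uIcc_of_le (by linarith)] at this
  rw [setIntegral_congr_fun measurableSet_Ioc hx, integral_add, integral_smul_const,
    ← intervalIntegral.integral_of_le (by linarith), ← intervalIntegral.integral_of_le (by linarith),
    intervalIntegral.integral_deriv_eq_sub (fun x _ => (hψ1.differentiable one_ne_zero) x)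
      (hd.intervalIntegrable _ _), ha', hb']
  · simp
  · exact ((hd.continuousOn.smul hcont).integrableOn_Icc).mono_set Ioc_subset_Icc_self
  · exact ((hd.continuousOn.smul continuousOn_const).integrableOn_Icc
      (a := a) (b := b)).mono_set Ioc_subset_Icc_self

theorem exists_halfLineTest_integral_one :
    ∃ ρ : ℝ → ℝ, IsHalfLineTest ρ ∧ ∫ x in Ioi 0, ρ x = 1 := by
  let B : ContDiffBump (1 : ℝ) := ⟨1 / 4, 1 / 2, by norm_num, by norm_num⟩
  have hB0 : ∀ x, x ∉ Ioo (1 / 2 : ℝ) (3 / 2) → B.normed volume x = 0 := by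
    intro x hx
    by_contra h'
    have : x ∈ Function.support (B.normed volume) := h'
    rw [B.support_normed_eq, Real.ball_eq_Ioo] at this
    apply hx
    constructor <;> [have := this.1; have := this.2] <;> simp [B] at this <;> linarith
  refine ⟨B.normed volume, isHalfLineTest_of_bounds B.contDiff_normed (by norm_num) hB0, ?_⟩
  rw [setIntegral_eq_integral_of_forall_compl_eq_zero, B.integral_normed]
  exact fun x hx => hB0 x fun h => hx (lt_trans (by norm_num) h.1)

/-- A smooth function compactly supported in `(0, ∞)` with vanishing integral is the derivative of
such a function. -/
theorem IsHalfLineTest.exists_deriv_eq {φ : ℝ → ℝ} (hφ : IsHalfLineTest φ)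
    (h0 : ∫ x in Ioi 0, φ x = 0) : ∃ ψ, IsHalfLineTest ψ ∧ deriv ψ = φ := by
  obtain ⟨a, b, ha, ha1, hb, hab⟩ := hφ.exists_bounds
  have hc : Continuous φ := hφ.contDiff.continuous
  have hderiv : ∀ x, HasDerivAt (fun x => ∫ t in a..x, φ t) (φ x) x := fun x =>
    intervalIntegral.integral_hasDerivAt_right (hc.intervalIntegrable _ _)
      (hc.stronglyMeasurableAtFilter _ _) hc.continuousAt
  have hd : deriv (fun x => ∫ t in a..x, φ t) = φ := funext fun x => (hderiv x).deriv
  refine ⟨fun x => ∫ t in a..x, φ t, isHalfLineTest_of_bounds (a := a) (b := b) ?_ ha ?_, hd⟩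
  · rw [contDiff_infty_iff_deriv]
    exact ⟨fun x => (hderiv x).differentiableAt, by rw [hd]; exact hφ.contDiff⟩
  · intro x hx
    rcases le_or_gt x a with hxa | hxa
    · show ∫ t in a..x, φ t = 0
      rw [intervalIntegral.integral_congr (g := fun _ => 0), intervalIntegral.integral_zero]
      intro t ht
      rw [uIcc_of_ge hxa] at ht
      exact hab t fun h' => not_lt.2 ht.2 h'.1
    -- To the right of b the primitive equals the whole integral, which is zero by assumption.
    · have hxb : b ≤ x := by by_contra h'; exact hx ⟨hxa, not_le.1 h'⟩
      show ∫ t in a..x, φ t = 0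
      rw [intervalIntegral.integral_of_le hxa.le, ← setIntegral_Ioi_eq_Ioc ha, h0]
      exact fun y hy => hab y fun h' => hy ⟨h'.1, h'.2.trans_le hxb⟩

/-- The fundamental lemma of the calculus of variations: a locally integrable function on
`(0, ∞)` with locally integrable weak derivative `h` is a primitive of `h`. -/
theorem ae_eq_const_add_primitive [CompleteSpace E] {f h : ℝ → E}
    (hf : LocallyIntegrableOn f (Ioi 0)) (hh : LocallyIntegrableOn h (Ioi 0))
    (hfh : ∀ ψ, IsHalfLineTest ψ →
      ∫ x in Ioi 0, deriv ψ x • f x = - ∫ x in Ioi 0, ψ x • h x) :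
    ∃ c : E, ∀ᵐ r ∂volume.restrict (Ioi (0 : ℝ)), f r = c + ∫ t in (1 : ℝ)..r, h t := by
  obtain ⟨ρ, hρ, hρ1⟩ := exists_halfLineTest_integral_one
  set F : ℝ → E := fun r => ∫ t in (1 : ℝ)..r, h t with hFdef
  have hF : LocallyIntegrableOn F (Ioi 0) :=
    (continuousOn_primitive_Ioi hh).locallyIntegrableOn measurableSet_Ioi
  have hfF : LocallyIntegrableOn (fun x => f x - F x) (Ioi 0) := hf.sub hF
  have hint : ∀ (g : ℝ → E), LocallyIntegrableOn g (Ioi 0) → ∀ φ, IsHalfLineTest φ →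
      IntegrableOn (fun x => φ x • g x) (Ioi 0) := by
    intro g hg φ hφ
    obtain ⟨a, b, ha, -, -, hab⟩ := hφ.exists_bounds
    refine (LocallyIntegrableOn.smul_test_integrableOn hg hφ.contDiff.continuous
      (b := b) ha).of_forall_sdiff_eq_zero measurableSet_Ioi fun x hx => ?_
    rw [hab x fun h => hx.2 (Ioo_subset_Ioc_self h), zero_smul]
  have hzero : ∀ φ, IsHalfLineTest φ → ∫ x in Ioi 0, φ x = 0 →
      ∫ x in Ioi 0, φ x • (f x - F x) = 0 := by
    intro φ hφ h0
    obtain ⟨ψ, hψ, rfl⟩ := hφ.exists_deriv_eq h0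
    simp only [smul_sub]
    rw [integral_sub (hint f hf _ hφ) (hint F hF _ hφ), hfh ψ hψ,
      setIntegral_Ioi_deriv_smul_primitive hh hψ, sub_self]
  -- By `hzero`, f − F pairs to zero with every test function of mean zero. An arbitrary φ differs
  -- from (∫φ)ρ by such a function, so f − F acts as the constant obtained by pairing it with ρ.
  set c : E := ∫ x in Ioi 0, ρ x • (f x - F x) with hc
  refine ⟨c, ?_⟩
  have hconst : LocallyIntegrableOn (fun _ : ℝ => c) (Ioi 0) :=
    (locallyIntegrable_const c).locallyIntegrableOn _
  have key := isOpen_Ioi.ae_eq_zero_of_integral_contDiff_smul_eq_zero (U := Ioi (0 : ℝ))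
    (hfF.sub hconst) (fun φ h1 h2 h3 => ?_)
  · rw [ae_restrict_iff' measurableSet_Ioi]
    filter_upwards [key] with x hx hx0
    have := hx hx0
    simp only [Pi.sub_apply] at this
    rw [sub_eq_zero, sub_eq_iff_eq_add] at this
    exact this
  · have hφ : IsHalfLineTest φ := ⟨h1, h2, h3⟩
    set s : ℝ := ∫ x in Ioi 0, φ x with hs
    have hφr : IsHalfLineTest (fun x => φ x - s * ρ x) := by
      obtain ⟨a, b, ha, -, -, hab⟩ := hφ.exists_bounds
      obtain ⟨a', b', ha', -, -, hab'⟩ := hρ.exists_bounds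
      refine isHalfLineTest_of_bounds (h1.sub (contDiff_const.mul hρ.contDiff))
        (a := min a a') (b := max b b') (lt_min ha ha') fun x hx => ?_
      rw [hab x fun h => hx ⟨(min_le_left _ _).trans_lt h.1, h.2.trans_le (le_max_left _ _)⟩,
        hab' x fun h => hx ⟨(min_le_right _ _).trans_lt h.1, h.2.trans_le (le_max_right _ _)⟩]
      simp
    have hiφ : IntegrableOn φ (Ioi 0) := (h1.continuous.integrable_of_hasCompactSupport h2).integrableOn
    have hiρ : IntegrableOn ρ (Ioi 0) :=
      (hρ.contDiff.continuous.integrable_of_hasCompactSupport hρ.hasCompactSupport).integrableOn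
    have h4 := hzero _ hφr (by
      rw [integral_sub hiφ (hiρ.const_mul s), integral_const_mul, hρ1, ← hs]; ring)
    simp only [sub_smul, mul_smul] at h4
    have hsub := integral_sub (hint _ hfF _ hφ) ((hint _ hfF _ hρ).smul s)
    simp only [Pi.smul_apply] at hsub
    rw [hsub, integral_smul, ← hc] at h4
    have h5 : ∀ k : ℝ → E, ∫ x, φ x • k x = ∫ x in Ioi 0, φ x • k x := fun k => by
      symm
      refine setIntegral_eq_integral_of_forall_compl_eq_zero fun x hx => ?_
      rw [image_eq_zero_of_notMem_tsupport fun h => hx (h3 h), zero_smul]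
    rw [h5]
    simp only [Pi.sub_apply, smul_sub]
    simp only [← smul_sub (φ _) (f _) (F _)]
    rw [integral_sub (hint _ hfF _ hφ) (hiφ.smul_const c), integral_smul_const]
    exact h4

end

/-! ### Polar coordinates and radial parts -/

section

variable {𝕜 : Type*} [RCLike 𝕜] {d : ℕ}

theorem integrable_comp_norm_iff [NeZero d] {F : Type*} [NormedAddCommGroup F] [NormedSpace ℝ F]
    {f : ℝ → F} : Integrable (fun x : Space d => f ‖x‖) ↔
      IntegrableOn (fun r : ℝ => r ^ (d - 1) • f r) (Ioi 0) := by
  have h := integrable_fun_norm_addHaar (volume : Measure (Space d)) (f := f)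
  rwa [finrank_euclideanSpace_fin] at h

/-- The surface area of the unit sphere in `ℝ^d`. -/
def sphereArea (d : ℕ) : ℝ := d * (volume : Measure (Space d)).real (Metric.ball 0 1)

theorem sphereArea_pos [NeZero d] : 0 < sphereArea d := by
  have h1 : (0 : ℝ) < d := Nat.cast_pos.2 (NeZero.pos d)
  refine mul_pos h1 (ENNReal.toReal_pos ?_ ?_)
  · exact (Metric.measure_ball_pos _ _ one_pos).ne'
  · exact measure_ball_lt_top.ne

theorem integral_comp_norm [NeZero d] {F : Type*} [NormedAddCommGroup F] [NormedSpace ℝ F]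
    (f : ℝ → F) : ∫ x : Space d, f ‖x‖ =
      sphereArea d • ∫ r in Ioi (0 : ℝ), r ^ (d - 1) • f r := by
  have h := integral_fun_norm_addHaar (volume : Measure (Space d)) f
  rw [finrank_euclideanSpace_fin] at h
  rw [h, sphereArea, mul_smul, Nat.cast_smul_eq_nsmul]

/-- The set of bad radii may fail to be measurable. Its measurable hull is still null in (0, ∞), and
the integral of the indicator of that hull vanishes in polar coordinates. -/
theorem ae_comp_norm [NeZero d] {P : ℝ → Prop} (h : ∀ᵐ r ∂volume.restrict (Ioi (0 : ℝ)), P r) :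
    ∀ᵐ x : Space d, P ‖x‖ := by
  set N := toMeasurable (volume.restrict (Ioi (0 : ℝ))) {r | ¬ P r} with hN
  have hN0 : ∀ᵐ r ∂volume.restrict (Ioi (0 : ℝ)), r ∉ N := by
    rw [ae_iff, show {r | ¬ r ∉ N} = N by ext; simp, hN, measure_toMeasurable]
    exact ae_iff.1 h
  have hmeas : MeasurableSet N := measurableSet_toMeasurable _ _
  have hz : (fun r : ℝ => r ^ (d - 1) • N.indicator (1 : ℝ → ℝ) r)
      =ᵐ[volume.restrict (Ioi 0)] 0 := by
    filter_upwards [hN0] with r hr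
    simp [hr]
  have hi : Integrable (fun x : Space d => N.indicator (1 : ℝ → ℝ) ‖x‖) := by
    rw [integrable_comp_norm_iff]
    exact (integrable_zero _ _ _).congr hz.symm
  have h0 : ∫ x : Space d, N.indicator (1 : ℝ → ℝ) ‖x‖ = 0 := by
    rw [integral_comp_norm, integral_congr_ae hz]
    simp
  rw [integral_eq_zero_iff_of_nonneg (fun x => indicator_nonneg (by simp) _) hi] at h0
  filter_upwards [h0] with x hx
  by_contra hP
  have : ‖x‖ ∈ N := subset_toMeasurable _ _ hP
  simp [this] at hx

/-- A radial function has a strongly measurable profile. -/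
theorem exists_stronglyMeasurable_profile [NeZero d] {u : Space d → 𝕜}
    (hu : AEStronglyMeasurable u volume) (hsym : IsSphericallySymmetric u) :
    ∃ f : ℝ → 𝕜, StronglyMeasurable f ∧ u =ᵐ[volume] fun x => f ‖x‖ := by
  obtain ⟨f₀, hf₀⟩ := hsym
  obtain ⟨u₀, hu₀, huu₀⟩ := hu
  have h1 : ∀ᵐ x : Space d, u₀ x = f₀ ‖x‖ := by
    filter_upwards [hf₀, huu₀] with x h1 h2 using by rw [← h2, h1]
  set φ := homeomorphUnitSphereProd (Space d)
  have hmp := (volume : Measure (Space d)).measurePreserving_homeomorphUnitSphereProd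
  have hsub : MeasurableSet ({0}ᶜ : Set (Space d)) := (measurableSet_singleton _).compl
  have hemb : MeasurableEmbedding (Subtype.val : ({0}ᶜ : Set (Space d)) → Space d) :=
    MeasurableEmbedding.subtype_coe hsub
  have h2 : ∀ᵐ y ∂((volume : Measure (Space d)).comap (Subtype.val : ({0}ᶜ : Set (Space d)) → _)),
      u₀ y.1 = f₀ ‖y.1‖ := by
    have := (ae_restrict_of_ae (s := ({0}ᶜ : Set (Space d))) h1)
    rw [← Subtype.range_coe (s := ({0}ᶜ : Set (Space d))), ← hemb.map_comap] at this
    exact (hemb.ae_map_iff).1 this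
  have h3 : ∀ᵐ q ∂((volume : Measure (Space d)).toSphere.prod
      (Measure.volumeIoiPow (Module.finrank ℝ (Space d) - 1))),
      u₀ (φ.symm q).1 = f₀ q.2.1 := by
    rw [← hmp.map_eq, (φ.measurableEmbedding).ae_map_iff]
    filter_upwards [h2] with y hy
    rw [φ.symm_apply_apply, hy]
    simp [φ]
  have h4 := Measure.ae_ae_of_ae_prod h3
  have : (ae (volume : Measure (Space d)).toSphere).NeBot :=
    ae_neBot.2 (Measure.toSphere_ne_zero _)
  -- The function f₀ given by the symmetry is arbitrary and possibly not measurable. Fubini on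
  -- sphere × (0, ∞) yields a direction w along which the strongly measurable representative u₀
  -- agrees with f₀ at almost every radius, so r ↦ u₀(r w) can replace f₀.
  obtain ⟨w, hw⟩ := h4.exists
  refine ⟨fun r => u₀ (r • w.1), hu₀.comp_measurable (by fun_prop), ?_⟩
  have h5 : ∀ᵐ q ∂((volume : Measure (Space d)).toSphere.prod
      (Measure.volumeIoiPow (Module.finrank ℝ (Space d) - 1))),
      u₀ (q.2.1 • w.1) = f₀ q.2.1 := by
    have hw' : ∀ᵐ r ∂(Measure.volumeIoiPow (Module.finrank ℝ (Space d) - 1)),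
      u₀ (r.1 • w.1) = f₀ r.1 := by
      filter_upwards [hw] with r hr
      simpa [φ] using hr
    exact Measure.quasiMeasurePreserving_snd.ae hw'
  rw [← hmp.map_eq, (φ.measurableEmbedding).ae_map_iff] at h5
  have h6 : ∀ᵐ x ∂((volume : Measure (Space d)).restrict ({0}ᶜ : Set (Space d))),
      u₀ (‖x‖ • w.1) = f₀ ‖x‖ := by
    rw [← Subtype.range_coe (s := ({0}ᶜ : Set (Space d))), ← hemb.map_comap, hemb.ae_map_iff]
    filter_upwards [h5] with y hy
    simpa [φ] using hy
  rw [restrict_compl_singleton] at h6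
  filter_upwards [h6, hf₀] with x h7 h8
  rw [h8, h7]

/-- Riesz representation of the radial part of a square integrable function. -/
theorem exists_radial_part {g : Space d → 𝕜} (hg : MemLp g 2 volume) :
    ∃ h : ℝ → 𝕜, StronglyMeasurable h ∧ MemLp (fun x : Space d => h ‖x‖) 2 volume ∧
      ∀ ψ : ℝ → ℝ, Measurable ψ → MemLp (fun x : Space d => ψ ‖x‖) 2 volume →
        ∫ x : Space d, ψ ‖x‖ • g x = ∫ x : Space d, ψ ‖x‖ • h ‖x‖ := by
  set ν : Measure ℝ := (volume : Measure (Space d)).map (fun x => ‖x‖)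
  have hmp : MeasurePreserving (fun x : Space d => ‖x‖) volume ν :=
    measurable_norm.measurePreserving _
  -- Composition with the norm embeds L² of the pushforward measure ν isometrically. Its adjoint
  -- projects onto radial functions, so the adjoint applied to g is the profile sought.
  let T : Lp 𝕜 2 ν →ₗᵢ[𝕜] Lp 𝕜 2 (volume : Measure (Space d)) :=
    Lp.compMeasurePreservingₗᵢ 𝕜 _ hmp
  let k : Lp 𝕜 2 ν := T.toContinuousLinearMap.adjoint (hg.toLp g)
  refine ⟨k, Lp.stronglyMeasurable k, (Lp.memLp k).comp_measurePreserving hmp, fun ψ hψ hψ2 => ?_⟩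
  have hψν : MemLp (fun r => ((ψ r : ℝ) : 𝕜)) 2 ν := by
    have h1 : AEStronglyMeasurable (fun r => ((ψ r : ℝ) : 𝕜)) ν :=
      (RCLike.measurable_ofReal.comp hψ).aestronglyMeasurable
    rw [memLp_map_measure_iff h1 hmp.measurable.aemeasurable]
    exact hψ2.ofReal
  have hadj := T.toContinuousLinearMap.adjoint_inner_right (hψν.toLp _) (hg.toLp g)
  change inner 𝕜 (hψν.toLp _) k = _ at hadj
  rw [L2.inner_def, L2.inner_def] at hadj
  have e1 : ∫ r, inner 𝕜 ((hψν.toLp _ : Lp 𝕜 2 ν) r) (k r) ∂ν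
      = ∫ x : Space d, ψ ‖x‖ • k ‖x‖ := by
    have : ∫ r, inner 𝕜 ((hψν.toLp _ : Lp 𝕜 2 ν) r) (k r) ∂ν = ∫ r, ψ r • k r ∂ν := by
      refine integral_congr_ae ?_
      filter_upwards [hψν.coeFn_toLp] with r hr
      rw [hr, RCLike.inner_apply, RCLike.conj_ofReal, RCLike.real_smul_eq_coe_mul, mul_comm]
    rw [this, integral_map hmp.measurable.aemeasurable]
    exact (hψ.stronglyMeasurable.smul (Lp.stronglyMeasurable k)).aestronglyMeasurable
  have e2 : ∫ x : Space d, inner 𝕜 ((T.toContinuousLinearMap (hψν.toLp _) : Lp 𝕜 2 volume) x)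
      ((hg.toLp g : Lp 𝕜 2 volume) x) = ∫ x : Space d, ψ ‖x‖ • g x := by
    refine integral_congr_ae ?_
    have hT : ((T.toContinuousLinearMap (hψν.toLp _) : Lp 𝕜 2 (volume : Measure (Space d))) :
        Space d → 𝕜) =ᵐ[volume] (hψν.toLp _ : Lp 𝕜 2 ν) ∘ fun x => ‖x‖ :=
      Lp.coeFn_compMeasurePreserving _ hmp
    have hc := hmp.quasiMeasurePreserving.ae hψν.coeFn_toLp
    filter_upwards [hT, hc, hg.coeFn_toLp] with x h1 h2 h3
    rw [h1, h3, Function.comp_apply, h2, RCLike.inner_apply, RCLike.conj_ofReal,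
      RCLike.real_smul_eq_coe_mul, mul_comm]
  rw [← e1, ← e2, hadj]

end

/-! ### Radial test fields and the profile of a radial H¹ function -/

section

theorem hasFDerivAt_norm_of_ne_zero {F : Type*} [NormedAddCommGroup F] [InnerProductSpace ℝ F]
    {x : F} (hx : x ≠ 0) : HasFDerivAt (fun y : F => ‖y‖) (‖x‖⁻¹ • innerSL ℝ x) x := by
  have h := (hasStrictFDerivAt_norm_sq x).hasFDerivAt.sqrt (by simpa using hx)
  simp only [Real.sqrt_sq (norm_nonneg _)] at h
  convert h using 1
  ext y
  have : ‖x‖ ≠ 0 := norm_ne_zero_iff.2 hx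
  simp
  field_simp

theorem IsHalfLineTest.eventuallyEq_zero {ψ : ℝ → ℝ} (hψ : IsHalfLineTest ψ) {x : ℝ}
    (hx : x ≤ 0) : ψ =ᶠ[𝓝 x] 0 :=
  notMem_tsupport_iff_eventuallyEq.1 fun h => not_lt.2 hx (hψ.tsupport_subset h)

theorem IsHalfLineTest.deriv {ψ : ℝ → ℝ} (hψ : IsHalfLineTest ψ) : IsHalfLineTest (deriv ψ) := by
  obtain ⟨a, b, ha, -, -, hab⟩ := hψ.exists_bounds
  exact isHalfLineTest_of_bounds (contDiff_infty_iff_deriv.1 hψ.contDiff).2 ha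
    (deriv_eq_zero_of_notMem_Ioo hψ.contDiff hab)

/-- The support of ψ stays away from 0, so negative powers of r are allowed as multipliers. -/
theorem IsHalfLineTest.mul_contDiffOn {ψ k : ℝ → ℝ} (hψ : IsHalfLineTest ψ)
    (hk : ContDiffOn ℝ ∞ k (Ioi 0)) : IsHalfLineTest (fun r => ψ r * k r) := by
  obtain ⟨a, b, ha, -, -, hab⟩ := hψ.exists_bounds
  refine isHalfLineTest_of_bounds (contDiff_iff_contDiffAt.2 fun x => ?_) ha
    fun x hx => by rw [hab x hx, zero_mul]
  rcases le_or_gt x 0 with hx | hx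
  · have : (fun r => ψ r * k r) =ᶠ[𝓝 x] fun _ => 0 := by
      filter_upwards [hψ.eventuallyEq_zero hx] with y hy
      simp [hy]
    exact contDiffAt_const.congr_of_eventuallyEq this
  · exact hψ.contDiff.contDiffAt.mul (hk.contDiffAt (Ioi_mem_nhds hx))

variable {d : ℕ}

theorem IsHalfLineTest.comp_norm_eventuallyEq_zero {χ : ℝ → ℝ} (hχ : IsHalfLineTest χ) :
    (fun x : Space d => χ ‖x‖) =ᶠ[𝓝 0] fun _ => 0 := by
  have h : Tendsto (fun x : Space d => ‖x‖) (𝓝 0) (𝓝 0) := by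
    simpa using (continuous_norm (E := Space d)).tendsto 0
  exact h.eventually (hχ.eventuallyEq_zero le_rfl)

theorem IsHalfLineTest.contDiff_comp_norm {χ : ℝ → ℝ} (hχ : IsHalfLineTest χ) :
    ContDiff ℝ ∞ (fun x : Space d => χ ‖x‖) := by
  refine contDiff_iff_contDiffAt.2 fun x => ?_
  rcases eq_or_ne x 0 with rfl | hx
  · exact contDiffAt_const.congr_of_eventuallyEq hχ.comp_norm_eventuallyEq_zero
  · exact hχ.contDiff.contDiffAt.comp x (contDiffAt_norm ℝ hx)

theorem IsHalfLineTest.hasCompactSupport_comp_norm {χ : ℝ → ℝ} (hχ : IsHalfLineTest χ) :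
    HasCompactSupport (fun x : Space d => χ ‖x‖) := by
  obtain ⟨a, b, ha, -, -, hab⟩ := hχ.exists_bounds
  refine HasCompactSupport.intro (isCompact_closedBall (0 : Space d) b) fun x hx => ?_
  refine hab _ fun h => hx ?_
  simpa using h.2.le

theorem IsHalfLineTest.hasFDerivAt_comp_norm {χ : ℝ → ℝ} (hχ : IsHalfLineTest χ) (x : Space d) :
    HasFDerivAt (fun x : Space d => χ ‖x‖) ((_root_.deriv χ ‖x‖ / ‖x‖) • innerSL ℝ x) x := by
  rcases eq_or_ne x 0 with rfl | hx
  -- At the origin the quotient by ‖x‖ has its default value 0, which is the right one since χ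
  -- vanishes near 0.
  · simpa using (hasFDerivAt_const (0 : ℝ) (0 : Space d)).congr_of_eventuallyEq
      hχ.comp_norm_eventuallyEq_zero
  · have h1 : HasDerivAt χ (_root_.deriv χ ‖x‖) ‖x‖ :=
      ((hχ.contDiff.differentiable (by simp)) _).hasDerivAt
    have := h1.comp_hasFDerivAt x (hasFDerivAt_norm_of_ne_zero hx)
    rwa [smul_smul, ← div_eq_mul_inv] at this

theorem IsHalfLineTest.fderiv_comp_norm_single {χ : ℝ → ℝ} (hχ : IsHalfLineTest χ) (x : Space d)
    (i : Fin d) : fderiv ℝ (fun x : Space d => χ ‖x‖) x (EuclideanSpace.single i 1)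
      = _root_.deriv χ ‖x‖ * (x i / ‖x‖) := by
  rw [(hχ.hasFDerivAt_comp_norm x).fderiv]
  simp [EuclideanSpace.inner_single_right]
  ring

variable {𝕜 : Type*} [RCLike 𝕜]

theorem integrable_smul_of_memLp_two {g : Space d → 𝕜} (hg : MemLp g 2 volume) {φ : Space d → ℝ}
    (hφ : Continuous φ) (hc : HasCompactSupport φ) : Integrable (fun x => φ x • g x) :=
  (hg.locallyIntegrable one_le_two).integrable_smul_left_of_hasCompactSupport hφ hc

/-- These supply the admissible variations. A free vector z in 𝕜 treats the real and the complex
case together. -/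
theorem memH1WithGradient_smul_const {φ : Space d → ℝ} (hφ : ContDiff ℝ ∞ φ)
    (hc : HasCompactSupport φ) (z : 𝕜) :
    MemH1WithGradient (fun x => φ x • z)
      (fun i x => fderiv ℝ φ x (EuclideanSpace.single i 1) • z) := by
  have hd : ∀ {η : Space d → ℝ}, ContDiff ℝ ∞ η → ∀ v, Continuous fun x => fderiv ℝ η x v :=
    fun hη v => (hη.continuous_fderiv (by simp)).clm_apply continuous_const
  refine ⟨?_, fun i => ?_, ?_⟩
  · exact (hφ.continuous.smul continuous_const).memLp_of_hasCompactSupport hc.smul_right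
  · exact ((hd hφ _).smul continuous_const).memLp_of_hasCompactSupport
      (hc.fderiv_apply (𝕜 := ℝ) _).smul_right
  · intro η hη hηc i
    simp only [smul_smul, integral_smul_const]
    rw [← neg_smul]
    congr 1
    have := integral_mul_fderiv_eq_neg_fderiv_mul_of_integrable (μ := (volume : Measure (Space d)))
      (f := η) (g := φ) (v := EuclideanSpace.single i (1 : ℝ)) ?_ ?_ ?_ ?_ ?_
    · linarith
    · exact ((hd hη _).mul hφ.continuous).integrable_of_hasCompactSupport hc.mul_left
    · exact (hη.continuous.mul (hd hφ _)).integrable_of_hasCompactSupport hηc.mul_right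
    · exact (hη.continuous.mul hφ.continuous).integrable_of_hasCompactSupport hηc.mul_right
    · exact fun x _ => hη.differentiable (by simp) x
    · exact fun x _ => hφ.differentiable (by simp) x

/-- The radial component `∑ (xᵢ / |x|) Gᵢ` of a vector field. -/
def radialComponent (G : Fin d → Space d → 𝕜) (x : Space d) : 𝕜 :=
  ∑ i, (x i / ‖x‖) • G i x

theorem measurable_coord_div_norm (i : Fin d) : Measurable fun x : Space d => x i / ‖x‖ := by
  have : Measurable fun x : Space d => x i := by fun_prop
  exact this.div measurable_norm

theorem abs_coord_div_norm_le (x : Space d) (i : Fin d) : |x i / ‖x‖| ≤ 1 := by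
  rw [abs_div, abs_norm]
  exact div_le_one_of_le₀ (by simpa using PiLp.norm_apply_le x i) (norm_nonneg _)

theorem memLp_radialComponent {G : Fin d → Space d → 𝕜} (hG : ∀ i, MemLp (G i) 2 volume) :
    MemLp (radialComponent G) 2 volume := by
  refine memLp_finsetSum _ fun i _ => (hG i).of_le ?_ (ae_of_all _ fun x => ?_)
  · exact (measurable_coord_div_norm i).aestronglyMeasurable.smul (hG i).aestronglyMeasurable
  · rw [norm_smul, Real.norm_eq_abs]
    exact mul_le_of_le_one_left (norm_nonneg _) (abs_coord_div_norm_le x i)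

theorem sum_coord_mul_coord (x : Space d) : ∑ i, x i * x i = ‖x‖ * ‖x‖ := by
  rw [← sq, EuclideanSpace.norm_sq_eq]
  simp [sq]

/-- The weak gradient tested with the radial vector field `χ(|x|) x`. -/
theorem integral_radial_field {u : Space d → 𝕜} {G : Fin d → Space d → 𝕜}
    (hu : MemH1WithGradient u G) {χ : ℝ → ℝ} (hχ : IsHalfLineTest χ) :
    ∫ x, (deriv χ ‖x‖ * ‖x‖ + d * χ ‖x‖) • u x
      = - ∫ x, (χ ‖x‖ * ‖x‖) • radialComponent G x := by
  let Φ : Fin d → Space d → ℝ := fun i x => χ ‖x‖ * x i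
  have hcoord : ∀ i, ContDiff ℝ ∞ fun x : Space d => x i := fun i => by fun_prop
  have hΦ : ∀ i, ContDiff ℝ ∞ (Φ i) := fun i => hχ.contDiff_comp_norm.mul (hcoord i)
  have hΦc : ∀ i, HasCompactSupport (Φ i) := fun i => hχ.hasCompactSupport_comp_norm.mul_right
  have hΦd : ∀ i x, fderiv ℝ (Φ i) x (EuclideanSpace.single i 1)
      = deriv χ ‖x‖ * (x i / ‖x‖) * x i + χ ‖x‖ := by
    intro i x
    have h1 : HasFDerivAt (fun x : Space d => x i)
        (EuclideanSpace.proj i : Space d →L[ℝ] ℝ) x :=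
      (EuclideanSpace.proj i : Space d →L[ℝ] ℝ).hasFDerivAt
    have h2 := (hχ.hasFDerivAt_comp_norm x).mul h1
    have h3 : fderiv ℝ (Φ i) x = _ := h2.fderiv
    rw [h3]
    simp [EuclideanSpace.inner_single_right]
    ring
  have hint1 : ∀ i, Integrable fun x =>
      (fderiv ℝ (Φ i) x (EuclideanSpace.single i 1)) • u x := fun i =>
    integrable_smul_of_memLp_two hu.memLp
      (((hΦ i).continuous_fderiv (by simp)).clm_apply continuous_const)
      ((hΦc i).fderiv_apply (𝕜 := ℝ) _)
  have hint2 : ∀ i, Integrable fun x => Φ i x • G i x := fun i =>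
    integrable_smul_of_memLp_two (hu.memLp_gradient i) (hΦ i).continuous (hΦc i)
  have hsum : ∑ i, ∫ x, (fderiv ℝ (Φ i) x (EuclideanSpace.single i 1)) • u x
      = ∑ i, - ∫ x, Φ i x • G i x :=
    Finset.sum_congr rfl fun i _ => hu.isWeakGradient (Φ i) (hΦ i) (hΦc i) i
  rw [← integral_finsetSum _ fun i _ => hint1 i, Finset.sum_neg_distrib,
    ← integral_finsetSum _ fun i _ => hint2 i] at hsum
  convert hsum using 1
  · refine integral_congr_ae (ae_of_all _ fun x => ?_)
    simp only
    rw [← Finset.sum_smul]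
    congr 1
    simp only [hΦd, Finset.sum_add_distrib, Finset.sum_const, Finset.card_univ, Fintype.card_fin,
      nsmul_eq_mul]
    congr 1
    have : ∀ i, deriv χ ‖x‖ * (x i / ‖x‖) * x i = deriv χ ‖x‖ / ‖x‖ * (x i * x i) :=
      fun i => by ring
    simp only [this, ← Finset.mul_sum, sum_coord_mul_coord]
    -- The divergence of χ(|x|) x is |x| χ' + d χ; at the origin the default quotient 0 agrees with
    -- it.
    rcases eq_or_ne ‖x‖ 0 with h | h
    · simp [h]
    · field_simp
  · congr 1
    refine integral_congr_ae (ae_of_all _ fun x => ?_)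
    simp only [radialComponent, Finset.smul_sum, smul_smul]
    refine Finset.sum_congr rfl fun i _ => ?_
    congr 1
    rcases eq_or_ne x 0 with h | h
    · simp [Φ, h]
    · have : ‖x‖ ≠ 0 := norm_ne_zero_iff.2 h
      simp only [Φ]
      field_simp

theorem integrableOn_pow_mul_sq [NeZero d] {f : ℝ → 𝕜}
    (hf : MemLp (fun x : Space d => f ‖x‖) 2 volume) :
    IntegrableOn (fun r : ℝ => r ^ (d - 1) * ‖f r‖ ^ 2) (Ioi 0) := by
  have h : Integrable (fun x : Space d => ‖f ‖x‖‖ ^ 2) := hf.integrable_norm_pow two_ne_zero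
  have := (integrable_comp_norm_iff (d := d) (f := fun r => ‖f r‖ ^ 2)).1 h
  simpa only [smul_eq_mul] using this

/-- On a compact subset of (0, ∞) the weight is bounded below, and ‖f‖ ≤ 1 + ‖f‖². -/
theorem locallyIntegrableOn_of_pow_mul_sq {f : ℝ → 𝕜} (hf : StronglyMeasurable f) {m : ℕ}
    (h : IntegrableOn (fun r : ℝ => r ^ m * ‖f r‖ ^ 2) (Ioi 0)) :
    LocallyIntegrableOn f (Ioi 0) := by
  rw [locallyIntegrableOn_iff isOpen_Ioi.isLocallyClosed]
  intro k hk hkc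
  rcases k.eq_empty_or_nonempty with rfl | hne
  · simp
  obtain ⟨a, hak, hale⟩ := hkc.exists_isLeast hne
  have ha : 0 < a := hk hak
  have h1 : IntegrableOn (fun r : ℝ => 1 + (a ^ m)⁻¹ * (r ^ m * ‖f r‖ ^ 2)) k := by
    refine Integrable.add ?_ ((h.mono_set hk).const_mul _)
    exact integrableOn_const hkc.measure_lt_top.ne
  refine h1.mono' hf.aestronglyMeasurable ?_
  filter_upwards [ae_restrict_mem hkc.measurableSet] with r hr
  have har : a ≤ r := hale hr
  have h2 : ‖f r‖ ≤ 1 + ‖f r‖ ^ 2 := by nlinarith [sq_nonneg (‖f r‖ - 1)]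
  have h3 : ‖f r‖ ^ 2 ≤ (a ^ m)⁻¹ * (r ^ m * ‖f r‖ ^ 2) := by
    rw [← mul_assoc]
    refine le_mul_of_one_le_left (sq_nonneg _) ?_
    rw [inv_mul_eq_div, one_le_div (by positivity)]
    gcongr
  linarith

/-- A radial `H¹` function has a locally absolutely continuous profile `f` with derivative `h`,
where `h` represents the radial component of the gradient. -/
theorem exists_radial_profile [NeZero d] {u : Space d → 𝕜} {G : Fin d → Space d → 𝕜}
    (hu : MemH1WithGradient u G) (hsym : IsSphericallySymmetric u) :
    ∃ (f h : ℝ → 𝕜) (c : 𝕜), (u =ᵐ[volume] fun x => f ‖x‖) ∧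
      LocallyIntegrableOn h (Ioi 0) ∧
      (∀ r, f r = c + ∫ t in (1 : ℝ)..r, h t) ∧
      IntegrableOn (fun r : ℝ => r ^ (d - 1) * ‖f r‖ ^ 2) (Ioi 0) ∧
      IntegrableOn (fun r : ℝ => r ^ (d - 1) * ‖h r‖ ^ 2) (Ioi 0) ∧
      ∀ ψ, IsHalfLineTest ψ → ∫ x, ψ ‖x‖ • radialComponent G x
        = sphereArea d • ∫ r in Ioi (0 : ℝ), r ^ (d - 1) • ψ r • h r := by
  obtain ⟨f, hf, huf⟩ := exists_stronglyMeasurable_profile hu.memLp.aestronglyMeasurable hsym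
  obtain ⟨h, hh, hh2, hrep⟩ := exists_radial_part (memLp_radialComponent hu.memLp_gradient)
  have hf2 : MemLp (fun x : Space d => f ‖x‖) 2 volume := (memLp_congr_ae huf).1 hu.memLp
  have hfi := integrableOn_pow_mul_sq hf2
  have hhi := integrableOn_pow_mul_sq hh2
  have hfl := locallyIntegrableOn_of_pow_mul_sq hf hfi
  have hhl := locallyIntegrableOn_of_pow_mul_sq hh hhi
  have hrep' : ∀ ψ, IsHalfLineTest ψ → ∫ x, ψ ‖x‖ • radialComponent G x
        = sphereArea d • ∫ r in Ioi (0 : ℝ), r ^ (d - 1) • ψ r • h r := by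
    intro ψ hψ
    rw [hrep ψ hψ.contDiff.continuous.measurable
      (hψ.contDiff_comp_norm.continuous.memLp_of_hasCompactSupport hψ.hasCompactSupport_comp_norm),
      integral_comp_norm (fun r => ψ r • h r)]
  have hd0 : d - 1 + 1 = d := Nat.succ_pred_eq_of_ne_zero (NeZero.ne d)
  obtain ⟨c, hc⟩ := ae_eq_const_add_primitive hfl hhl (fun ψ hψ => by
    -- The test field is χ(|x|) x with χ = r^(−d) ψ. Its divergence r χ' + d χ equals r^(1−d) (r^d
    -- χ)' = r^(1−d) ψ', so the Jacobian r^(d−1) cancels and the weak derivative on the half-line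
    -- remains.
    have hinv : ContDiffOn ℝ ∞ (fun r : ℝ => (r ^ d)⁻¹) (Ioi 0) := fun r hr =>
      ((contDiffAt_id.pow d).inv (pow_ne_zero _ (ne_of_gt hr))).contDiffWithinAt
    have hχ := hψ.mul_contDiffOn hinv
    set χ : ℝ → ℝ := fun r => ψ r * (r ^ d)⁻¹ with hχdef
    have hid : IsHalfLineTest fun r => χ r * r := hχ.mul_contDiffOn contDiffOn_id
    have h1 := integral_radial_field hu hχ
    rw [hrep' _ hid] at h1
    have h2 : ∫ x : Space d, (deriv χ ‖x‖ * ‖x‖ + d * χ ‖x‖) • u x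
        = ∫ x : Space d, (deriv χ ‖x‖ * ‖x‖ + d * χ ‖x‖) • f ‖x‖ := by
      refine integral_congr_ae ?_
      filter_upwards [huf] with x hx
      rw [hx]
    rw [h2, integral_comp_norm (fun r => (deriv χ r * r + d * χ r) • f r), ← smul_neg] at h1
    have h3 := smul_right_injective 𝕜 (sphereArea_pos (d := d)).ne' h1
    have hψχ : ∀ r ∈ Ioi (0 : ℝ), ψ r = r ^ d * χ r := fun r hr => by
      have : r ^ d ≠ 0 := pow_ne_zero _ (ne_of_gt hr)
      simp only [hχdef]
      field_simp
    have h4 : ∫ r in Ioi (0 : ℝ), deriv ψ r • f r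
        = ∫ r in Ioi (0 : ℝ), r ^ (d - 1) • (deriv χ r * r + d * χ r) • f r := by
      refine setIntegral_congr_fun measurableSet_Ioi fun r hr => ?_
      have hev : ψ =ᶠ[𝓝 r] fun r => r ^ d * χ r := by
        filter_upwards [Ioi_mem_nhds hr] with y hy using hψχ y hy
      have hder : HasDerivAt (fun r : ℝ => r ^ d * χ r)
          (d * r ^ (d - 1) * χ r + r ^ d * deriv χ r) r :=
        (hasDerivAt_pow d r).mul ((hχ.contDiff.differentiable (by simp)) r).hasDerivAt
      rw [hev.deriv_eq, hder.deriv, smul_smul]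
      congr 1
      have : r ^ d = r ^ (d - 1) * r := by rw [← pow_succ, hd0]
      rw [this]
      ring
    rw [h4, h3]
    congr 1
    refine setIntegral_congr_fun measurableSet_Ioi fun r hr => ?_
    rw [hψχ r hr, smul_smul]
    congr 1
    have : r ^ d = r ^ (d - 1) * r := by rw [← pow_succ, hd0]
    rw [this]
    ring)
  refine ⟨fun r => c + ∫ t in (1 : ℝ)..r, h t, h, c, ?_, hhl, fun _ => rfl, ?_, hhi, hrep'⟩
  · filter_upwards [huf, ae_comp_norm hc] with x hx hx'
    rw [hx, hx']
  · refine hfi.congr_fun_ae ?_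
    filter_upwards [hc] with r hr
    rw [hr]

end

/-! ### Pointwise bounds and integrability of radial profiles -/

section Profile

variable {𝕜 : Type*} [RCLike 𝕜]

/-- Pointwise substitute for Cauchy–Schwarz; the free weight q lets the two resulting terms be
balanced. -/
theorem two_mul_le_mul_sq_add_inv {q x : ℝ} (hq : 0 < q) : 2 * x ≤ q * x ^ 2 + q⁻¹ := by
  have h : q * x ^ 2 + q⁻¹ - 2 * x = (q * x - 1) ^ 2 * q⁻¹ := by field_simp; ring
  have : 0 ≤ (q * x - 1) ^ 2 * q⁻¹ := by positivity
  linarith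

theorem setIntegral_rpow_le {r β : ℝ} (hr : 0 < r) (hr1 : r ≤ 1) (hβ : 0 < β) :
    ∫ s in Ioc r 1, s ^ (-β - 1) ≤ r ^ (-β) / β := by
  rw [← intervalIntegral.integral_of_le hr1, integral_rpow]
  · have : (0 : ℝ) < r ^ (-β) := Real.rpow_pos_of_pos hr _
    rw [Real.one_rpow, show -β - 1 + 1 = -β by ring, div_neg, neg_div', neg_sub]
    gcongr
    linarith
  · right
    refine ⟨by linarith, fun h => ?_⟩
    rw [uIcc_of_le hr1] at h
    exact not_lt.2 h.1 hr

variable {m : ℕ} {f h : ℝ → 𝕜} {c : 𝕜}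

/-- Radial `H¹` functions are `O(r^(-β))` at the origin for every `β > (d-2)/2`. -/
theorem exists_norm_profile_le_rpow (hh : LocallyIntegrableOn h (Ioi 0))
    (hf : ∀ r, f r = c + ∫ t in (1 : ℝ)..r, h t)
    (h2 : IntegrableOn (fun r : ℝ => r ^ m * ‖h r‖ ^ 2) (Ioi 0))
    {β : ℝ} (hβ : 0 < β) (hβm : (m : ℝ) ≤ 2 * β + 1) :
    ∃ C, 0 ≤ C ∧ ∀ r, 0 < r → r ≤ 1 → ‖f r‖ ≤ C * r ^ (-β) := by
  set A := ∫ r in Ioi (0 : ℝ), r ^ m * ‖h r‖ ^ 2 with hA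
  have hA0 : 0 ≤ A := setIntegral_nonneg measurableSet_Ioi fun r hr => by
    have : (0 : ℝ) < r := hr
    positivity
  refine ⟨‖c‖ + (A + (2 * β)⁻¹) / 2, by positivity, fun r hr hr1 => ?_⟩
  have hsub : Ioc r 1 ⊆ Ioi 0 := fun s hs => hr.trans hs.1
  have hκ : (0 : ℝ) < r ^ (-β) := Real.rpow_pos_of_pos hr _
  have hhi : IntegrableOn h (Ioc r 1) :=
    (integrableOn_of_locallyIntegrableOn_Ioi hh hr).mono_set Ioc_subset_Icc_self
  have hpi : IntegrableOn (fun s : ℝ => s ^ (-(2 * β) - 1)) (Ioc r 1) := by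
    refine (ContinuousOn.integrableOn_Icc fun s hs => ?_).mono_set Ioc_subset_Icc_self
    exact (Real.continuousAt_rpow_const _ _ (Or.inl (hr.trans_le hs.1).ne')).continuousWithinAt
  have hmain : ∫ s in Ioc r 1, ‖h s‖ ≤ (A + (2 * β)⁻¹) / 2 * r ^ (-β) := by
    calc ∫ s in Ioc r 1, ‖h s‖
        ≤ ∫ s in Ioc r 1, (r ^ (-β) / 2 * (s ^ m * ‖h s‖ ^ 2)
            + (r ^ (-β))⁻¹ / 2 * s ^ (-(2 * β) - 1)) := by
          refine setIntegral_mono_on hhi.norm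
            (((h2.mono_set hsub).const_mul _).add (hpi.const_mul _)) measurableSet_Ioc
            fun s hs => ?_
          have hs0 : 0 < s := hr.trans hs.1
          have hsm : 0 < s ^ m := by positivity
          -- The weight r^(−β) s^m makes both terms of order r^(−β): the first is r^(−β) times the
          -- energy, the second r^β times the integral of s^(−2β−1), which is at most a multiple of
          -- r^(−2β).
          have h3 := two_mul_le_mul_sq_add_inv (x := ‖h s‖) (mul_pos hκ hsm)
          have h4 : (s ^ m)⁻¹ ≤ s ^ (-(2 * β) - 1) := by
            rw [← Real.rpow_natCast, ← Real.rpow_neg hs0.le]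
            exact Real.rpow_le_rpow_of_exponent_ge hs0 hs.2 (by linarith)
          have h5 : (r ^ (-β) * s ^ m)⁻¹ ≤ (r ^ (-β))⁻¹ * s ^ (-(2 * β) - 1) := by
            rw [mul_inv]; gcongr
          linarith
      _ = r ^ (-β) / 2 * (∫ s in Ioc r 1, s ^ m * ‖h s‖ ^ 2)
            + (r ^ (-β))⁻¹ / 2 * ∫ s in Ioc r 1, s ^ (-(2 * β) - 1) := by
          rw [integral_add ((h2.mono_set hsub).const_mul _) (hpi.const_mul _),
            integral_const_mul, integral_const_mul]
      _ ≤ r ^ (-β) / 2 * A + (r ^ (-β))⁻¹ / 2 * (r ^ (-(2 * β)) / (2 * β)) := by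
          gcongr
          · refine setIntegral_mono_set h2 ?_ hsub.eventuallyLE
            filter_upwards [ae_restrict_mem measurableSet_Ioi] with s hs
            have : (0 : ℝ) < s := hs
            simp only [Pi.zero_apply]
            positivity
          · exact setIntegral_rpow_le hr hr1 (by positivity)
      _ = (A + (2 * β)⁻¹) / 2 * r ^ (-β) := by
          have : r ^ (-(2 * β)) = r ^ (-β) * r ^ (-β) := by
            rw [← Real.rpow_add hr]; ring_nf
          rw [this]
          field_simp
  have hint : ‖∫ t in (1 : ℝ)..r, h t‖ ≤ ∫ s in Ioc r 1, ‖h s‖ := by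
    rw [intervalIntegral.integral_symm, norm_neg, intervalIntegral.integral_of_le hr1]
    exact norm_integral_le_integral_norm _
  have hone : (1 : ℝ) ≤ r ^ (-β) := Real.one_le_rpow_of_pos_of_le_one_of_nonpos hr hr1 (by linarith)
  rw [hf r]
  calc ‖c + ∫ t in (1 : ℝ)..r, h t‖ ≤ ‖c‖ + ‖∫ t in (1 : ℝ)..r, h t‖ := norm_add_le _ _
    _ ≤ ‖c‖ * r ^ (-β) + (A + (2 * β)⁻¹) / 2 * r ^ (-β) :=
        add_le_add (le_mul_of_one_le_right (norm_nonneg _) hone) (hint.trans hmain)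
    _ = _ := by ring

theorem setIntegral_norm_le_of_weighted {k : ℝ → 𝕜} (hk : LocallyIntegrableOn k (Ioi 0))
    (h2 : IntegrableOn (fun r : ℝ => r ^ m * ‖k r‖ ^ 2) (Ioi 0)) {r : ℝ} (hr : 1 ≤ r) :
    ∫ s in Ioc r (r + 1), ‖k s‖ ≤ 1 + ∫ r in Ioi (0 : ℝ), r ^ m * ‖k r‖ ^ 2 := by
  have hr0 : 0 < r := by linarith
  have hsub : Ioc r (r + 1) ⊆ Ioi 0 := fun s hs => hr0.trans hs.1
  have hi1 : IntegrableOn (fun _ : ℝ => (1 : ℝ)) (Ioc r (r + 1)) :=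
    integrableOn_const (by simp)
  calc ∫ s in Ioc r (r + 1), ‖k s‖
      ≤ ∫ s in Ioc r (r + 1), (1 + s ^ m * ‖k s‖ ^ 2) := by
        refine setIntegral_mono_on ?_ (hi1.add (h2.mono_set hsub)) measurableSet_Ioc fun s hs => ?_
        · exact ((integrableOn_of_locallyIntegrableOn_Ioi hk hr0).mono_set
            Ioc_subset_Icc_self).norm
        · have h1 : 1 ≤ s ^ m := one_le_pow₀ (hr.trans hs.1.le)
          nlinarith [sq_nonneg (‖k s‖ - 1), mul_le_mul_of_nonneg_right h1 (sq_nonneg ‖k s‖)]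
    _ = 1 + ∫ s in Ioc r (r + 1), s ^ m * ‖k s‖ ^ 2 := by
        rw [integral_add hi1 (h2.mono_set hsub)]; simp
    _ ≤ _ := by
        refine add_le_add le_rfl (setIntegral_mono_set h2 ?_ hsub.eventuallyLE)
        filter_upwards [ae_restrict_mem measurableSet_Ioi] with s hs
        have : (0 : ℝ) < s := hs
        simp only [Pi.zero_apply]
        positivity

theorem continuousOn_profile (hh : LocallyIntegrableOn h (Ioi 0))
    (hf : ∀ r, f r = c + ∫ t in (1 : ℝ)..r, h t) : ContinuousOn f (Ioi 0) := by
  rw [show f = fun r => c + ∫ t in (1 : ℝ)..r, h t from funext hf]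
  exact continuousOn_const.add (continuousOn_primitive_Ioi hh)

/-- Radial `H¹` functions are bounded away from the origin. -/
theorem exists_norm_profile_le (hh : LocallyIntegrableOn h (Ioi 0))
    (hf : ∀ r, f r = c + ∫ t in (1 : ℝ)..r, h t)
    (hf2 : IntegrableOn (fun r : ℝ => r ^ m * ‖f r‖ ^ 2) (Ioi 0))
    (h2 : IntegrableOn (fun r : ℝ => r ^ m * ‖h r‖ ^ 2) (Ioi 0)) :
    ∃ C, 0 ≤ C ∧ ∀ r, 1 ≤ r → ‖f r‖ ≤ C := by
  have hfl : LocallyIntegrableOn f (Ioi 0) :=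
    (continuousOn_profile hh hf).locallyIntegrableOn measurableSet_Ioi
  set A := ∫ r in Ioi (0 : ℝ), r ^ m * ‖f r‖ ^ 2
  set B := ∫ r in Ioi (0 : ℝ), r ^ m * ‖h r‖ ^ 2
  have key : ∀ r, 1 ≤ r → ‖f r‖ ≤ (1 + A) + (1 + B) := by
    intro r hr
    have hr0 : 0 < r := by linarith
    have hfi : IntegrableOn (fun s => ‖f s‖) (Ioc r (r + 1)) :=
      ((integrableOn_of_locallyIntegrableOn_Ioi hfl hr0).mono_set Ioc_subset_Icc_self).norm
    have hhi : IntegrableOn (fun s => ‖h s‖) (Ioc r (r + 1)) :=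
      ((integrableOn_of_locallyIntegrableOn_Ioi hh hr0).mono_set Ioc_subset_Icc_self).norm
    have hi1 : ∀ k : ℝ, IntegrableOn (fun _ : ℝ => k) (Ioc r (r + 1)) := fun k =>
      integrableOn_const (by simp)
    -- Averaging this over s in a unit interval bounds f(r) by local integrals of ‖f‖ and ‖h‖, which
    -- the weighted L² norms control.
    have hpt : ∀ s ∈ Ioc r (r + 1), ‖f r‖ ≤ ‖f s‖ + ∫ t in Ioc r (r + 1), ‖h t‖ := by
      intro s hs
      have hs0 : 0 < s := hr0.trans hs.1
      have h3 : f s = f r + ∫ t in r..s, h t := by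
        rw [hf s, hf r, add_assoc, intervalIntegral.integral_add_adjacent_intervals
          (intervalIntegrable_of_locallyIntegrableOn_Ioi hh one_pos hr0)
          (intervalIntegrable_of_locallyIntegrableOn_Ioi hh hr0 hs0)]
      have h4 : ‖∫ t in r..s, h t‖ ≤ ∫ t in Ioc r (r + 1), ‖h t‖ := by
        rw [intervalIntegral.integral_of_le hs.1.le]
        refine (norm_integral_le_integral_norm _).trans ?_
        exact setIntegral_mono_set hhi (ae_of_all _ fun _ => norm_nonneg _)
          (Ioc_subset_Ioc_right hs.2).eventuallyLE
      have h5 : f r = f s - ∫ t in r..s, h t := by rw [h3]; ring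
      rw [h5]
      exact (norm_sub_le _ _).trans (by gcongr)
    calc ‖f r‖ = ∫ _ in Ioc r (r + 1), ‖f r‖ := by simp
      _ ≤ ∫ s in Ioc r (r + 1), (‖f s‖ + ∫ t in Ioc r (r + 1), ‖h t‖) :=
          setIntegral_mono_on (hi1 _) (hfi.add (hi1 _)) measurableSet_Ioc hpt
      _ = (∫ s in Ioc r (r + 1), ‖f s‖) + ∫ t in Ioc r (r + 1), ‖h t‖ := by
          rw [integral_add hfi (hi1 _)]; simp
      _ ≤ _ := add_le_add (setIntegral_norm_le_of_weighted hfl hf2 hr)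
          (setIntegral_norm_le_of_weighted hh h2 hr)
  exact ⟨_, (norm_nonneg _).trans (key 1 le_rfl), key⟩

/-- On (0, 1] the integrand is O(r^(m−(p+2)β)), whose exponent exceeds −1. On (1, ∞) the bound on f
reduces the power p + 2 to the square. -/
theorem integrableOn_pow_mul_rpow (hfc : ContinuousOn f (Ioi 0))
    (hf2 : IntegrableOn (fun r : ℝ => r ^ m * ‖f r‖ ^ 2) (Ioi 0))
    {β p C₁ C₂ : ℝ} (hp : 0 < p) (hβ : (p + 2) * β < m + 1) (hC₁ : 0 ≤ C₁)
    (h1 : ∀ r, 0 < r → r ≤ 1 → ‖f r‖ ≤ C₁ * r ^ (-β)) (h2 : ∀ r, 1 ≤ r → ‖f r‖ ≤ C₂) :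
    IntegrableOn (fun r : ℝ => r ^ m * ‖f r‖ ^ (p + 2)) (Ioi 0) := by
  have hcont : ContinuousOn (fun r : ℝ => r ^ m * ‖f r‖ ^ (p + 2)) (Ioi 0) :=
    (continuousOn_id.pow m).mul (hfc.norm.rpow_const fun _ _ => Or.inr (by linarith))
  rw [← Ioc_union_Ioi_eq_Ioi zero_le_one, integrableOn_union]
  constructor
  · have hi : IntegrableOn (fun r : ℝ => C₁ ^ (p + 2) * r ^ ((m : ℝ) - (p + 2) * β)) (Ioc 0 1) := by
      refine Integrable.const_mul ?_ _
      have := intervalIntegral.intervalIntegrable_rpow' (a := 0) (b := 1)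
        (r := (m : ℝ) - (p + 2) * β) (by linarith)
      rwa [intervalIntegrable_iff_integrableOn_Ioc_of_le zero_le_one] at this
    refine hi.mono' ((hcont.mono Ioc_subset_Ioi_self).aestronglyMeasurable measurableSet_Ioc) ?_
    filter_upwards [ae_restrict_mem measurableSet_Ioc] with r hr
    have hr0 : 0 < r := hr.1
    rw [Real.norm_of_nonneg (by positivity)]
    calc r ^ m * ‖f r‖ ^ (p + 2) ≤ r ^ m * (C₁ * r ^ (-β)) ^ (p + 2) := by
          gcongr
          exact h1 r hr.1 hr.2
      _ = C₁ ^ (p + 2) * (r ^ m * (r ^ (-β)) ^ (p + 2)) := by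
          rw [Real.mul_rpow hC₁ (by positivity)]; ring
      _ = _ := by
          rw [← Real.rpow_mul hr0.le, ← Real.rpow_natCast, ← Real.rpow_add hr0]
          ring_nf
  · have hi := (hf2.mono_set (Ioi_subset_Ioi zero_le_one)).const_mul (C₂ ^ p)
    refine hi.mono' ((hcont.mono (Ioi_subset_Ioi zero_le_one)).aestronglyMeasurable
      measurableSet_Ioi) ?_
    filter_upwards [ae_restrict_mem measurableSet_Ioi] with r hr
    have hr1 : (1 : ℝ) < r := hr
    have hr0 : 0 < r := by linarith
    rw [Real.norm_of_nonneg (by positivity), Real.rpow_add' (norm_nonneg _) (by linarith),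
      Real.rpow_two]
    have : ‖f r‖ ^ p ≤ C₂ ^ p := Real.rpow_le_rpow (norm_nonneg _) (h2 r hr1.le) hp.le
    calc r ^ m * (‖f r‖ ^ p * ‖f r‖ ^ 2) ≤ r ^ m * (C₂ ^ p * ‖f r‖ ^ 2) := by gcongr
      _ = _ := by ring

end Profile

/-- This is where subcriticality enters. The last inequality yields both (p+2)β < d, which puts u in
L^(p+2), and pβ < 2, which drives the bootstrap at the origin. -/
theorem exists_admissible_exponent {d : ℕ} (hd : 2 ≤ d) {p : ℝ} (hp : 0 < p)
    (hp_sub : 3 ≤ d → p < 4 / ((d : ℝ) - 2)) :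
    ∃ β η : ℝ, 0 < η ∧ 0 < β ∧ β = ((d : ℝ) - 2) / 2 + η ∧ p * β + 2 * η < 2 := by
  have hd' : (2 : ℝ) ≤ d := by exact_mod_cast hd
  have h4 : p * ((d : ℝ) - 2) < 4 := by
    rcases Nat.lt_or_ge 2 d with h | h
    · have h2 : (2 : ℝ) < d := by exact_mod_cast h
      exact (lt_div_iff₀ (by linarith)).1 (hp_sub h)
    · have h2 : (d : ℝ) = 2 := by exact_mod_cast le_antisymm h hd
      rw [h2]; norm_num
  -- Here pβ + 2η = p(d−2)/2 + (p+2)η, so η is chosen to use half of the gap between p(d−2)/2 and 2.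
  set η := (2 - p * ((d : ℝ) - 2) / 2) / (2 * (p + 2)) with hη
  have hη0 : 0 < η := div_pos (by linarith) (by positivity)
  have hη2 : (p + 2) * η = (2 - p * ((d : ℝ) - 2) / 2) / 2 := by
    rw [hη]; field_simp
  exact ⟨((d : ℝ) - 2) / 2 + η, η, hη0, by linarith, rfl, by nlinarith⟩

/-! ### The potential V and the weight K -/

section Coefficients

/-- `r / sinh r`, continuously extended to `r = 0`. -/
def sinhRatio (r : ℝ) : ℝ := if r = 0 then 1 else r / Real.sinh r

theorem sinhRatio_pos (r : ℝ) : 0 < sinhRatio r := by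
  unfold sinhRatio
  split_ifs with h
  · exact one_pos
  · rcases lt_or_gt_of_ne h with h | h
    · exact div_pos_of_neg_of_neg h (Real.sinh_neg_iff.2 h)
    · exact div_pos h (Real.sinh_pos_iff.2 h)

theorem sinhRatio_le_one {r : ℝ} (hr : 0 ≤ r) : sinhRatio r ≤ 1 := by
  unfold sinhRatio
  split_ifs with h
  · exact le_rfl
  · exact div_le_one_of_le₀ (Real.self_le_sinh_iff.2 hr) (Real.sinh_nonneg_iff.2 hr)

theorem tendsto_div_sinh : Tendsto (fun r : ℝ => r / Real.sinh r) (𝓝[≠] 0) (𝓝 1) := by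
  have h := (Real.hasDerivAt_sinh 0).tendsto_slope
  simp only [Real.cosh_zero] at h
  have h2 := h.inv₀ one_ne_zero
  simp only [inv_one] at h2
  refine h2.congr fun r => ?_
  simp [slope_def_field]

theorem continuous_sinhRatio : Continuous sinhRatio := by
  rw [continuous_iff_continuousAt]
  intro r
  rcases eq_or_ne r 0 with rfl | hr
  · rw [continuousAt_iff_punctured_nhds]
    rw [show sinhRatio 0 = 1 from if_pos rfl]
    refine tendsto_div_sinh.congr' ?_
    filter_upwards [self_mem_nhdsWithin] with r hr
    exact (if_neg hr).symm
  · have : sinhRatio =ᶠ[𝓝 r] fun r => r / Real.sinh r := by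
      filter_upwards [isOpen_ne.mem_nhds hr] with y hy
      exact if_neg hy
    refine ContinuousAt.congr ?_ this.symm
    exact continuousAt_id.div Real.continuous_sinh.continuousAt (Real.sinh_ne_zero.2 hr)

theorem weight_eq (d : ℕ) (p r : ℝ) :
    weight d p r = 1 / (p + 2) * sinhRatio r ^ (((d : ℝ) - 1) * p / 2) := rfl

theorem continuous_weight (d : ℕ) (p : ℝ) : Continuous (weight d p) := by
  have : Continuous fun r => sinhRatio r ^ (((d : ℝ) - 1) * p / 2) :=
    continuous_sinhRatio.rpow_const fun r => Or.inl (sinhRatio_pos r).ne'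
  exact continuous_const.mul this

theorem weight_pos (d : ℕ) {p : ℝ} (hp : 0 < p) (r : ℝ) : 0 < weight d p r := by
  rw [weight_eq]
  have := Real.rpow_pos_of_pos (sinhRatio_pos r) (((d : ℝ) - 1) * p / 2)
  positivity

theorem weight_le_one {d : ℕ} (hd : 2 ≤ d) {p : ℝ} (hp : 0 < p) {r : ℝ} (hr : 0 ≤ r) :
    weight d p r ≤ 1 := by
  have hd' : (2 : ℝ) ≤ d := by exact_mod_cast hd
  have h1 : sinhRatio r ^ (((d : ℝ) - 1) * p / 2) ≤ 1 :=
    Real.rpow_le_one (sinhRatio_pos r).le (sinhRatio_le_one hr)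
      (div_nonneg (mul_nonneg (by linarith) hp.le) (by norm_num))
  have h2 : 1 / (p + 2) ≤ 1 := by
    rw [div_le_one (by linarith)]; linarith
  rw [weight_eq]
  exact mul_le_one₀ h2 (Real.rpow_pos_of_pos (sinhRatio_pos r) _).le h1

/-- The cubic Taylor coefficient of sinh, by two applications of L'Hôpital's rule; it identifies the
value of the potential at r = 0. -/
theorem tendsto_sinh_sub_self_div_cube :
    Tendsto (fun r : ℝ => (Real.sinh r - r) / r ^ 3) (𝓝[≠] 0) (𝓝 (1 / 6)) := by
  have hs : Tendsto (fun r : ℝ => Real.sinh r / (6 * r)) (𝓝[≠] 0) (𝓝 (1 / 6)) := by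
    have := (tendsto_div_sinh.inv₀ one_ne_zero).const_mul (1 / 6)
    simp only [inv_one, mul_one] at this
    refine this.congr fun r => ?_
    rw [inv_div, div_mul_div_comm, one_mul]
  have hz : ∀ k : ℝ → ℝ, Continuous k → k 0 = 0 → Tendsto k (𝓝[≠] 0) (𝓝 0) := by
    intro k hk h0
    have := hk.tendsto 0
    rw [h0] at this
    exact this.mono_left nhdsWithin_le_nhds
  have hc : Tendsto (fun r : ℝ => (Real.cosh r - 1) / (3 * r ^ 2)) (𝓝[≠] 0) (𝓝 (1 / 6)) := by
    refine HasDerivAt.lhopital_zero_nhdsNE (f' := Real.sinh) (g' := fun r => 6 * r)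
      (Eventually.of_forall fun r => (Real.hasDerivAt_cosh r).sub_const 1)
      (Eventually.of_forall fun r => ?_) ?_ ?_ ?_ hs
    · exact ((hasDerivAt_pow 2 r).const_mul 3).congr_deriv (by norm_num; ring)
    · filter_upwards [self_mem_nhdsWithin] with r hr
      exact mul_ne_zero (by norm_num) hr
    · exact hz _ (Real.continuous_cosh.sub continuous_const) (by simp)
    · exact hz _ (by fun_prop) (by simp)
  refine HasDerivAt.lhopital_zero_nhdsNE (f' := fun r => Real.cosh r - 1)
      (g' := fun r => 3 * r ^ 2)
      (Eventually.of_forall fun r => (Real.hasDerivAt_sinh r).sub (hasDerivAt_id r))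
      (Eventually.of_forall fun r => ?_) ?_ ?_ ?_ hc
  · exact (hasDerivAt_pow 3 r).congr_deriv (by norm_num)
  · filter_upwards [self_mem_nhdsWithin] with r hr
    exact mul_ne_zero (by norm_num) (pow_ne_zero _ hr)
  · exact hz _ (Real.continuous_sinh.sub continuous_id) (by simp)
  · exact hz _ (by fun_prop) (by simp)

/-- The profile `(r² - sinh² r) / (r² sinh² r)` of the potential, continuously extended. -/
def potentialCore (r : ℝ) : ℝ :=
  if r = 0 then -(1 / 3) else (r ^ 2 - Real.sinh r ^ 2) / (r ^ 2 * Real.sinh r ^ 2)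

theorem continuous_potentialCore : Continuous potentialCore := by
  rw [continuous_iff_continuousAt]
  intro r
  rcases eq_or_ne r 0 with rfl | hr
  · rw [continuousAt_iff_punctured_nhds]
    rw [show potentialCore 0 = -(1 / 3) from if_pos rfl]
    -- Factor sinh² r − r² = (sinh r − r)(sinh r + r). The quotient is then (sinh r − r)/r³ · (sinh
    -- r/r + 1) · (r/sinh r)², with limit 1/6 · 2 · 1 = 1/3.
    have h1 := (tendsto_sinh_sub_self_div_cube.mul
      ((tendsto_div_sinh.inv₀ one_ne_zero).add_const 1)).mul (tendsto_div_sinh.pow 2)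
    have h2 := h1.neg
    rw [show -(1 / 6 * ((1 : ℝ)⁻¹ + 1) * 1 ^ 2) = -(1 / 3) by norm_num] at h2
    refine h2.congr' ?_
    filter_upwards [self_mem_nhdsWithin] with r hr
    have hr' : r ≠ 0 := hr
    have hs : Real.sinh r ≠ 0 := Real.sinh_ne_zero.2 hr'
    rw [potentialCore, if_neg hr']
    field_simp
    ring
  · have : potentialCore =ᶠ[𝓝 r]
        fun r => (r ^ 2 - Real.sinh r ^ 2) / (r ^ 2 * Real.sinh r ^ 2) := by
      filter_upwards [isOpen_ne.mem_nhds hr] with y hy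
      exact if_neg hy
    refine ContinuousAt.congr ?_ this.symm
    have hs : Real.sinh r ≠ 0 := Real.sinh_ne_zero.2 hr
    have hc := Real.continuous_sinh
    refine ContinuousAt.div (by fun_prop) (by fun_prop) (by positivity)

/-- The core is 1/sinh² r − 1/r², a difference of two numbers in [0, r^(−2)]. -/
theorem abs_potentialCore_le {r : ℝ} (hr : 0 < r) : |potentialCore r| ≤ (r ^ 2)⁻¹ := by
  have hs : r ≤ Real.sinh r := Real.self_le_sinh_iff.2 hr.le
  have hs0 : 0 < Real.sinh r := hr.trans_le hs
  have h1 : potentialCore r = (Real.sinh r ^ 2)⁻¹ - (r ^ 2)⁻¹ := by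
    rw [potentialCore, if_neg hr.ne']
    field_simp
  have h2 : (Real.sinh r ^ 2)⁻¹ ≤ (r ^ 2)⁻¹ := by gcongr
  have h3 : 0 ≤ (Real.sinh r ^ 2)⁻¹ := by positivity
  rw [h1, abs_le]
  constructor <;> linarith

theorem continuous_potential (d : ℕ) : Continuous (potential d) :=
  continuous_const.mul continuous_potentialCore

theorem tendsto_potential_atTop (d : ℕ) : Tendsto (potential d) atTop (𝓝 0) := by
  have h : Tendsto potentialCore atTop (𝓝 0) := by
    refine squeeze_zero_norm' (a := fun r : ℝ => (r ^ 2)⁻¹) ?_ ?_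
    · filter_upwards [eventually_gt_atTop 0] with r hr using abs_potentialCore_le hr
    · exact (tendsto_pow_atTop two_ne_zero).inv_tendsto_atTop
  have := h.const_mul (((d : ℝ) - 1) * ((d : ℝ) - 3) / 4)
  rwa [mul_zero] at this

/-- The sign of V changes with d. Only continuity, this bound and the decay at infinity are used. -/
theorem exists_abs_potential_le (d : ℕ) : ∃ C, 0 ≤ C ∧ ∀ r, 0 ≤ r → |potential d r| ≤ C := by
  obtain ⟨R, hR⟩ := eventually_atTop.1
    ((tendsto_potential_atTop d).norm.eventually_lt_const (show ‖(0 : ℝ)‖ < 1 by simp))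
  obtain ⟨C, hC⟩ := (isCompact_Icc (a := (0 : ℝ)) (b := R)).exists_bound_of_continuousOn
    (continuous_potential d).continuousOn
  refine ⟨max C 1, by positivity, fun r hr => ?_⟩
  rcases le_total r R with h | h
  · exact (hC r ⟨hr, h⟩).trans (le_max_left _ _)
  · exact (hR r h).le.trans (le_max_right _ _)

end Coefficients

/-! ### First variations and the Euler–Lagrange equations -/

section

variable {𝕜 : Type*} [RCLike 𝕜] {d : ℕ}

theorem MemH1WithGradient.add {u v : Space d → 𝕜} {G H : Fin d → Space d → 𝕜}
    (hu : MemH1WithGradient u G) (hv : MemH1WithGradient v H) :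
    MemH1WithGradient (fun x => u x + v x) (fun i x => G i x + H i x) := by
  refine ⟨hu.memLp.add hv.memLp, fun i => (hu.memLp_gradient i).add (hv.memLp_gradient i), ?_⟩
  intro φ hφ hc i
  have hdc : Continuous fun x => fderiv ℝ φ x (EuclideanSpace.single i (1 : ℝ)) :=
    (hφ.continuous_fderiv (by simp)).clm_apply continuous_const
  have hcs := hc.fderiv_apply (𝕜 := ℝ) (EuclideanSpace.single i (1 : ℝ))
  simp only [smul_add]
  rw [integral_add (integrable_smul_of_memLp_two hu.memLp hdc hcs)
      (integrable_smul_of_memLp_two hv.memLp hdc hcs),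
    integral_add (integrable_smul_of_memLp_two (hu.memLp_gradient i) hφ.continuous hc)
      (integrable_smul_of_memLp_two (hv.memLp_gradient i) hφ.continuous hc),
    hu.isWeakGradient φ hφ hc i, hv.isWeakGradient φ hφ hc i, neg_add]

theorem MemH1WithGradient.smul {u : Space d → 𝕜} {G : Fin d → Space d → 𝕜}
    (hu : MemH1WithGradient u G) (s : ℝ) :
    MemH1WithGradient (fun x => s • u x) (fun i x => s • G i x) := by
  refine ⟨hu.memLp.const_smul s, fun i => (hu.memLp_gradient i).const_smul s, ?_⟩
  intro φ hφ hc i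
  have h : ∀ (a : ℝ) (b : 𝕜), a • s • b = s • a • b := fun a b => smul_comm _ _ _
  simp only [h, integral_smul]
  rw [hu.isWeakGradient φ hφ hc i, smul_neg]

theorem nonlinearTerm_smul (p : ℝ) (u : Space d → 𝕜) {s : ℝ} (hs : 0 ≤ s) :
    nonlinearTerm d p (fun x => s • u x) = s ^ (p + 2) * nonlinearTerm d p u := by
  unfold nonlinearTerm
  rw [← integral_const_mul]
  congr 1
  ext x
  rw [norm_smul, Real.norm_of_nonneg hs, Real.mul_rpow hs (norm_nonneg _)]
  ring

theorem quadraticTerm_smul (c : ℝ → ℝ) (u : Space d → 𝕜) (G : Fin d → Space d → 𝕜) (s : ℝ) :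
    quadraticTerm d c (fun x => s • u x) (fun i x => s • G i x)
      = s ^ 2 * quadraticTerm d c u G := by
  unfold quadraticTerm
  rw [← integral_const_mul]
  congr 1
  ext x
  simp only [norm_smul, mul_pow, Real.norm_eq_abs, sq_abs, ← Finset.mul_sum]
  ring

theorem integral_norm_sq_smul (u : Space d → 𝕜) (s : ℝ) :
    ∫ x, ‖s • u x‖ ^ 2 = s ^ 2 * ∫ x, ‖u x‖ ^ 2 := by
  rw [← integral_const_mul]
  congr 1
  ext x
  rw [norm_smul, mul_pow, Real.norm_eq_abs, sq_abs]

theorem integrable_inner_of_memLp_two {u v : Space d → 𝕜} (hu : MemLp u 2 volume)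
    (hv : MemLp v 2 volume) : Integrable fun x => inner ℝ (u x) (v x) := by
  refine ((hu.integrable_norm_pow two_ne_zero).add (hv.integrable_norm_pow two_ne_zero)).mono'
    (hu.aestronglyMeasurable.inner hv.aestronglyMeasurable) (ae_of_all _ fun x => ?_)
  refine (norm_inner_le_norm _ _).trans ?_
  simp only [Pi.add_apply]
  nlinarith [sq_nonneg (‖u x‖ - ‖v x‖), sq_nonneg (‖u x‖ + ‖v x‖)]

/-- A continuous coefficient, bounded on `[0, ∞)`. -/
structure IsBoundedCoefficient (c : ℝ → ℝ) : Prop where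
  continuous : Continuous c
  exists_bound : ∃ C, ∀ r, 0 ≤ r → |c r| ≤ C

theorem isBoundedCoefficient_add_potential (d : ℕ) (a : ℝ) :
    IsBoundedCoefficient fun r => a + potential d r := by
  refine ⟨continuous_const.add (continuous_potential d), ?_⟩
  obtain ⟨C, -, hC⟩ := exists_abs_potential_le d
  exact ⟨|a| + C, fun r hr => (abs_add_le _ _).trans (by gcongr; exact hC r hr)⟩

theorem IsBoundedCoefficient.integrable_mul {c : ℝ → ℝ} (hc : IsBoundedCoefficient c)
    {F : Space d → ℝ} (hF : Integrable F) : Integrable fun x => c ‖x‖ * F x := by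
  obtain ⟨C, hC⟩ := hc.exists_bound
  exact hF.bdd_mul (hc.continuous.comp continuous_norm).aestronglyMeasurable
    (ae_of_all _ fun x => hC _ (norm_nonneg x))

theorem norm_add_smul_sq (a b : 𝕜) (t : ℝ) :
    ‖a + t • b‖ ^ 2 = ‖a‖ ^ 2 + t * (2 * inner ℝ a b) + t ^ 2 * ‖b‖ ^ 2 := by
  rw [norm_add_sq_real, inner_smul_right, norm_smul, mul_pow, Real.norm_eq_abs, sq_abs]
  ring

/-- The first variation of `quadraticTerm`. -/
def quadraticForm (c : ℝ → ℝ) (u v : Space d → 𝕜) (G H : Fin d → Space d → 𝕜) : ℝ :=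
  ∫ x, (∑ i, inner ℝ (G i x) (H i x) + c ‖x‖ * inner ℝ (u x) (v x))

theorem integrable_sum_inner {G H : Fin d → Space d → 𝕜} (hG : ∀ i, MemLp (G i) 2 volume)
    (hH : ∀ i, MemLp (H i) 2 volume) :
    Integrable fun x => ∑ i, inner ℝ (G i x) (H i x) :=
  integrable_finsetSum _ fun i _ => integrable_inner_of_memLp_two (hG i) (hH i)

theorem integrable_quadraticTerm {c : ℝ → ℝ} (hc : IsBoundedCoefficient c) {u : Space d → 𝕜}
    {G : Fin d → Space d → 𝕜} (hu : MemH1WithGradient u G) :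
    Integrable fun x => 1 / 2 * ∑ i, ‖G i x‖ ^ 2 + 1 / 2 * c ‖x‖ * ‖u x‖ ^ 2 := by
  have h1 : Integrable fun x => ∑ i, ‖G i x‖ ^ 2 :=
    integrable_finsetSum _ fun i _ => (hu.memLp_gradient i).integrable_norm_pow two_ne_zero
  have h2 := (hc.integrable_mul (hu.memLp.integrable_norm_pow two_ne_zero)).const_mul (1 / 2)
  refine ((h1.const_mul (1 / 2)).add h2).congr (ae_of_all _ fun x => ?_)
  simp only [Pi.add_apply]
  ring

theorem integral_norm_sq_add_smul {u v : Space d → 𝕜} (hu : MemLp u 2 volume)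
    (hv : MemLp v 2 volume) (t : ℝ) :
    ∫ x, ‖u x + t • v x‖ ^ 2
      = (∫ x, ‖u x‖ ^ 2) + t * (2 * ∫ x, inner ℝ (u x) (v x)) + t ^ 2 * ∫ x, ‖v x‖ ^ 2 := by
  simp only [norm_add_smul_sq]
  have h1 := hu.integrable_norm_pow two_ne_zero
  have h2 := ((integrable_inner_of_memLp_two hu hv).const_mul 2).const_mul t
  have h3 := (hv.integrable_norm_pow two_ne_zero).const_mul (t ^ 2)
  have h12 : Integrable fun x => ‖u x‖ ^ 2 + t * (2 * inner ℝ (u x) (v x)) := h1.add h2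
  rw [integral_add h12 h3, integral_add h1 h2]
  simp only [integral_const_mul]

theorem quadraticTerm_add_smul {c : ℝ → ℝ} (hc : IsBoundedCoefficient c) {u v : Space d → 𝕜}
    {G H : Fin d → Space d → 𝕜} (hu : MemH1WithGradient u G) (hv : MemH1WithGradient v H) (t : ℝ) :
    quadraticTerm d c (fun x => u x + t • v x) (fun i x => G i x + t • H i x)
      = quadraticTerm d c u G + t * quadraticForm c u v G H + t ^ 2 * quadraticTerm d c v H := by
  have h1 := integrable_quadraticTerm hc hu
  have h2 := ((integrable_sum_inner hu.memLp_gradient hv.memLp_gradient).add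
    (hc.integrable_mul (integrable_inner_of_memLp_two hu.memLp hv.memLp))).const_mul t
  have h3 := (integrable_quadraticTerm hc hv).const_mul (t ^ 2)
  unfold quadraticTerm quadraticForm
  rw [← integral_const_mul, ← integral_const_mul]
  simp only [Pi.add_apply] at h2
  have h12 := h1.add h2
  simp only [Pi.add_def] at h12
  rw [← integral_add h1 h2, ← integral_add h12 h3]
  congr 1
  ext x
  simp only [norm_add_smul_sq, Finset.sum_add_distrib, ← Finset.mul_sum]
  ring

theorem add_rpow_le_two_rpow_mul {a b q : ℝ} (ha : 0 ≤ a) (hb : 0 ≤ b) (hq : 0 ≤ q) :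
    (a + b) ^ q ≤ 2 ^ q * (a ^ q + b ^ q) := by
  have haq : 0 ≤ a ^ q := Real.rpow_nonneg ha _
  have hbq : 0 ≤ b ^ q := Real.rpow_nonneg hb _
  rcases le_total a b with h | h
  · calc (a + b) ^ q ≤ (2 * b) ^ q := Real.rpow_le_rpow (by positivity) (by linarith) hq
      _ = 2 ^ q * b ^ q := Real.mul_rpow (by norm_num) hb
      _ ≤ _ := by gcongr; linarith
  · calc (a + b) ^ q ≤ (2 * a) ^ q := Real.rpow_le_rpow (by positivity) (by linarith) hq
      _ = 2 ^ q * a ^ q := Real.mul_rpow (by norm_num) ha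
      _ ≤ _ := by gcongr; linarith

/-- The exponent exceeds 1, so the power of the norm is differentiable also where a + tb vanishes.
The inner product is the real one, for complex values too. -/
theorem hasDerivAt_norm_add_smul_rpow {p : ℝ} (hp : 0 < p) (a b : 𝕜) (t : ℝ) :
    HasDerivAt (fun t : ℝ => ‖a + t • b‖ ^ (p + 2))
      ((p + 2) * (‖a + t • b‖ ^ p * inner ℝ (a + t • b) b)) t := by
  have h1 : HasDerivAt (fun t : ℝ => a + t • b) b t := by
    simpa using ((hasDerivAt_id t).smul_const b).const_add a
  have h2 := (hasFDerivAt_norm_rpow (a + t • b) (p := p + 2) (by linarith)).comp_hasDerivAt t h1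
  refine h2.congr_deriv ?_
  simp only [add_sub_cancel_right, smul_apply, innerSL_apply_apply, smul_eq_mul]
  ring

/-- The first variation of `nonlinearTerm`. -/
def nonlinearForm (d : ℕ) (p : ℝ) (u v : Space d → 𝕜) : ℝ :=
  ∫ x, weight d p ‖x‖ * (‖u x‖ ^ p * inner ℝ (u x) (v x))

/-- A bound uniform in |t| ≤ 1, which serves as the dominating function for differentiation under
the integral. -/
theorem norm_rpow_mul_inner_le {p : ℝ} (hp : 0 < p) (a b : 𝕜) {t : ℝ} (ht : |t| ≤ 1) :
    |‖a + t • b‖ ^ p * inner ℝ (a + t • b) b| ≤ 2 ^ (p + 2) * (‖a‖ ^ (p + 2) + ‖b‖ ^ (p + 2)) := by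
  have h1 : ‖a + t • b‖ ≤ ‖a‖ + ‖b‖ := by
    refine (norm_add_le _ _).trans ?_
    rw [norm_smul, Real.norm_eq_abs]
    gcongr
    exact mul_le_of_le_one_left (norm_nonneg _) ht
  have h2 : |inner ℝ (a + t • b) b| ≤ (‖a‖ + ‖b‖) ^ 2 := by
    refine (abs_real_inner_le_norm _ _).trans ?_
    rw [sq]
    gcongr
    linarith [norm_nonneg a]
  have hnn : 0 ≤ ‖a‖ + ‖b‖ := by positivity
  rw [abs_mul, abs_of_nonneg (Real.rpow_nonneg (norm_nonneg _) _)]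
  calc ‖a + t • b‖ ^ p * |inner ℝ (a + t • b) b|
      ≤ (‖a‖ + ‖b‖) ^ p * (‖a‖ + ‖b‖) ^ 2 := by gcongr
    _ = (‖a‖ + ‖b‖) ^ (p + 2) := by
        rw [Real.rpow_add' hnn (by linarith), Real.rpow_two]
    _ ≤ _ := add_rpow_le_two_rpow_mul (norm_nonneg _) (norm_nonneg _) (by linarith)

theorem integrable_weight_mul (hd : 2 ≤ d) {p : ℝ} (hp : 0 < p) {F : Space d → ℝ}
    (hF : Integrable F) : Integrable fun x => weight d p ‖x‖ * F x :=
  IsBoundedCoefficient.integrable_mul ⟨continuous_weight d p, 1, fun r hr => by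
    rw [abs_of_pos (weight_pos d hp r)]; exact weight_le_one hd hp hr⟩ hF

theorem hasDerivAt_nonlinearTerm (hd : 2 ≤ d) {p : ℝ} (hp : 0 < p) {u v : Space d → 𝕜}
    (hum : AEStronglyMeasurable u volume) (hvm : AEStronglyMeasurable v volume)
    (hu : Integrable fun x => ‖u x‖ ^ (p + 2)) (hv : Integrable fun x => ‖v x‖ ^ (p + 2)) :
    HasDerivAt (fun t : ℝ => nonlinearTerm d p fun x => u x + t • v x)
      ((p + 2) * nonlinearForm d p u v) 0 := by
  have hw : AEStronglyMeasurable (fun x : Space d => weight d p ‖x‖) volume :=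
    ((continuous_weight d p).comp continuous_norm).aestronglyMeasurable
  have hbound : Integrable fun x => weight d p ‖x‖ *
      ((p + 2) * (2 ^ (p + 2) * (‖u x‖ ^ (p + 2) + ‖v x‖ ^ (p + 2)))) :=
    integrable_weight_mul hd hp (((hu.add hv).const_mul _).const_mul _)
  have hm : ∀ t : ℝ, AEStronglyMeasurable (fun x => u x + t • v x) volume := fun t =>
    hum.add (hvm.const_smul t)
  have hmr : ∀ (t q : ℝ), AEStronglyMeasurable (fun x => ‖u x + t • v x‖ ^ q) volume := fun t q =>
    ((hm t).norm.aemeasurable.pow_const q).aestronglyMeasurable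
  have key := hasDerivAt_integral_of_dominated_loc_of_deriv_le (μ := (volume : Measure (Space d)))
    (F := fun (t : ℝ) x => weight d p ‖x‖ * ‖u x + t • v x‖ ^ (p + 2))
    (F' := fun (t : ℝ) x => weight d p ‖x‖ *
      ((p + 2) * (‖u x + t • v x‖ ^ p * inner ℝ (u x + t • v x) (v x))))
    (x₀ := 0) (s := Metric.ball 0 1) (Metric.ball_mem_nhds _ one_pos)
    (Eventually.of_forall fun t => hw.mul (hmr t _)) ?_ ?_
    (bound := fun x => weight d p ‖x‖ *
      ((p + 2) * (2 ^ (p + 2) * (‖u x‖ ^ (p + 2) + ‖v x‖ ^ (p + 2)))))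
    (ae_of_all _ fun x t ht => ?_) hbound
    (ae_of_all _ fun x t _ => (hasDerivAt_norm_add_smul_rpow hp (u x) (v x) t).const_mul _)
  · refine key.2.congr_deriv ?_
    unfold nonlinearForm
    rw [← integral_const_mul]
    congr 1
    ext x
    simp only [zero_smul, add_zero]
    ring
  · simpa using integrable_weight_mul hd hp hu
  · exact hw.mul (((hmr 0 p).mul ((hm 0).inner hvm)).const_mul _)
  · have ht' : |t| ≤ 1 := by simpa using (mem_ball_zero_iff.1 ht).le
    have hwp := weight_pos d hp ‖x‖
    rw [Real.norm_eq_abs, abs_mul, abs_of_pos hwp, abs_mul, abs_of_pos (by linarith : 0 < p + 2)]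
    gcongr
    exact norm_rpow_mul_inner_le hp _ _ ht'

theorem nonlinearTerm_nonneg {p : ℝ} (hp : 0 < p) (u : Space d → 𝕜) : 0 ≤ nonlinearTerm d p u :=
  integral_nonneg fun _ => mul_nonneg (weight_pos d hp _).le (Real.rpow_nonneg (norm_nonneg _) _)

/-- Since K is positive everywhere, a vanishing integral would force u = 0 almost everywhere. The
strict sign makes the frequency of an I-minimizer positive. -/
theorem nonlinearTerm_pos (hd : 2 ≤ d) {p : ℝ} (hp : 0 < p) {u : Space d → 𝕜}
    (hu : Integrable fun x => ‖u x‖ ^ (p + 2)) (h : 0 < ∫ x, ‖u x‖ ^ 2) :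
    0 < nonlinearTerm d p u := by
  refine lt_of_le_of_ne (nonlinearTerm_nonneg hp u) fun h0 => ?_
  unfold nonlinearTerm at h0
  have h1 := (integral_eq_zero_iff_of_nonneg (fun _ => mul_nonneg (weight_pos d hp _).le
    (Real.rpow_nonneg (norm_nonneg _) _)) (integrable_weight_mul hd hp hu)).1 h0.symm
  have h2 : (fun x => ‖u x‖ ^ 2) =ᵐ[volume] fun _ => 0 := by
    filter_upwards [h1] with x hx
    have h3 : ‖u x‖ ^ (p + 2) = 0 := by
      simpa [(weight_pos d hp ‖x‖).ne'] using hx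
    rw [Real.rpow_eq_zero (norm_nonneg _) (by linarith)] at h3
    simp [h3]
  rw [integral_congr_ae h2] at h
  simp at h

theorem sqrt_rpow_eq {s q : ℝ} (hs : 0 ≤ s) : √s ^ q = s ^ (q / 2) := by
  rw [Real.sqrt_eq_rpow, ← Real.rpow_mul hs]
  ring_nf

theorem hasDerivAt_quadratic_zero (a b c : ℝ) :
    HasDerivAt (fun t : ℝ => a + t * b + t ^ 2 * c) b 0 := by
  have h1 : HasDerivAt (fun t : ℝ => a + t * b) b 0 := by
    simpa using ((hasDerivAt_id (0 : ℝ)).mul_const b).const_add a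
  have h2 : HasDerivAt (fun t : ℝ => t ^ 2 * c) 0 0 := by
    simpa using (hasDerivAt_pow (𝕜 := ℝ) 2 0).mul_const c
  simpa using h1.fun_add h2

/-- The Euler–Lagrange equation of `I_lam`. -/
theorem eulerLagrange_of_isMinimizerI (hd : 2 ≤ d) {p : ℝ} (hp : 0 < p) {lam : ℝ} (hlam : 0 < lam)
    {u : Space d → 𝕜} {G : Fin d → Space d → 𝕜} (hu : MemH1WithGradient u G)
    (hu2 : (∫ x, ‖u x‖ ^ 2) = lam)
    (hmin : ∀ (v : Space d → 𝕜) (H : Fin d → Space d → 𝕜), MemH1WithGradient v H →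
      (∫ x, ‖v x‖ ^ 2) = lam → energy₁ d p u G ≤ energy₁ d p v H)
    (hup : Integrable fun x => ‖u x‖ ^ (p + 2))
    {v : Space d → 𝕜} {H : Fin d → Space d → 𝕜} (hv : MemH1WithGradient v H)
    (hvp : Integrable fun x => ‖v x‖ ^ (p + 2)) :
    quadraticForm (potential d) u v G H
      + ((p + 2) * nonlinearTerm d p u - 2 * quadraticTerm d (potential d) u G) / lam
        * ∫ x, inner ℝ (u x) (v x) = (p + 2) * nonlinearForm d p u v := by
  have hcoef : IsBoundedCoefficient (potential d) := by
    simpa using isBoundedCoefficient_add_potential d 0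
  set m := ∫ x, inner ℝ (u x) (v x) with hm
  set Q := quadraticTerm d (potential d) u G with hQ
  set B := quadraticForm (potential d) u v G H with hB
  set N := nonlinearTerm d p u with hN
  set M : ℝ → ℝ := fun t => ∫ x, ‖u x + t • v x‖ ^ 2 with hM
  have hMeq : ∀ t, M t = lam + t * (2 * m) + t ^ 2 * ∫ x, ‖v x‖ ^ 2 := fun t => by
    rw [hM, ← hu2]; exact integral_norm_sq_add_smul hu.memLp hv.memLp t
  have hQd : HasDerivAt (fun t : ℝ => quadraticTerm d (potential d) (fun x => u x + t • v x)
      (fun i x => G i x + t • H i x)) B 0 := by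
    rw [funext fun t => quadraticTerm_add_smul hcoef hu hv t]
    exact hasDerivAt_quadratic_zero _ _ _
  have hMd : HasDerivAt M (2 * m) 0 := by
    rw [show M = fun t => lam + t * (2 * m) + t ^ 2 * ∫ x, ‖v x‖ ^ 2 from funext hMeq]
    exact hasDerivAt_quadratic_zero _ _ _
  have hM0 : M 0 = lam := by rw [hMeq]; ring
  have hNd := hasDerivAt_nonlinearTerm hd hp hu.memLp.aestronglyMeasurable
    hv.memLp.aestronglyMeasurable hup hvp
  -- The competitor is √ρ (u + tv) with ρ = lam / M(t), which has mass lam. By homogeneity its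
  -- energy is ρ Q(u + tv) − ρ^((p+2)/2) N(u + tv), minimal at t = 0; the derivative of ρ produces
  -- the Lagrange multiplier.
  have hρd : HasDerivAt (fun t => lam / M t) (-(2 * m) / lam) 0 := by
    have := (hasDerivAt_const (0 : ℝ) lam).div hMd (by rw [hM0]; exact hlam.ne')
    refine this.congr_deriv ?_
    rw [hM0]
    field_simp
    ring
  have hρ0 : lam / M 0 = 1 := by rw [hM0, div_self hlam.ne']
  have hρp : HasDerivAt (fun t => (lam / M t) ^ ((p + 2) / 2))
      (-(2 * m) / lam * ((p + 2) / 2)) 0 := by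
    have := hρd.rpow_const (p := (p + 2) / 2) (Or.inl (by rw [hρ0]; exact one_ne_zero))
    refine this.congr_deriv ?_
    rw [hρ0, Real.one_rpow, mul_one]
  have hE : HasDerivAt (fun t => lam / M t * quadraticTerm d (potential d) (fun x => u x + t • v x)
      (fun i x => G i x + t • H i x)
      - (lam / M t) ^ ((p + 2) / 2) * nonlinearTerm d p fun x => u x + t • v x)
      (-(2 * m) / lam * Q + B - (-(2 * m) / lam * ((p + 2) / 2) * N
        + (p + 2) * nonlinearForm d p u v)) 0 := by
    refine ((hρd.mul hQd).sub (hρp.mul hNd)).congr_deriv ?_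
    simp only [hρ0, Real.one_rpow, zero_smul, add_zero, one_mul, hQ, hN]
  have hloc : IsLocalMin (fun t => lam / M t * quadraticTerm d (potential d)
      (fun x => u x + t • v x) (fun i x => G i x + t • H i x)
      - (lam / M t) ^ ((p + 2) / 2) * nonlinearTerm d p fun x => u x + t • v x) 0 := by
    have hpos : ∀ᶠ t in 𝓝 0, 0 < M t :=
      hMd.continuousAt.eventually (lt_mem_nhds (by rw [hM0]; exact hlam))
    filter_upwards [hpos] with t ht
    simp only [hρ0, Real.one_rpow, zero_smul, add_zero, one_mul]
    have hρ : 0 ≤ lam / M t := by positivity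
    have h1 := hmin _ _ ((hu.add (hv.smul t)).smul √(lam / M t)) (by
      rw [integral_norm_sq_smul (fun x => u x + t • v x), Real.sq_sqrt hρ]
      exact div_mul_cancel₀ _ ht.ne')
    unfold energy₁ at h1
    rwa [quadraticTerm_smul _ (fun x => u x + t • v x) (fun i x => G i x + t • H i x),
      nonlinearTerm_smul p (fun x => u x + t • v x) (Real.sqrt_nonneg _), Real.sq_sqrt hρ,
      sqrt_rpow_eq hρ] at h1
  have h0 := hloc.hasDerivAt_eq_zero hE
  field_simp at h0 ⊢
  linarith

/-- The Euler–Lagrange equation of `J_lam`. -/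
theorem eulerLagrange_of_isMinimizerJ (hd : 2 ≤ d) {p : ℝ} (hp : 0 < p) {Λ lam : ℝ}
    (hlam : 0 < lam) {u : Space d → 𝕜} {G : Fin d → Space d → 𝕜} (hu : MemH1WithGradient u G)
    (huN : nonlinearTerm d p u = lam)
    (hmin : ∀ (v : Space d → 𝕜) (H : Fin d → Space d → 𝕜), MemH1WithGradient v H →
      nonlinearTerm d p v = lam → energy₂ d Λ u G ≤ energy₂ d Λ v H)
    (hup : Integrable fun x => ‖u x‖ ^ (p + 2))
    {v : Space d → 𝕜} {H : Fin d → Space d → 𝕜} (hv : MemH1WithGradient v H)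
    (hvp : Integrable fun x => ‖v x‖ ^ (p + 2)) :
    quadraticForm (fun r => Λ + (((d : ℝ) - 1) / 2) ^ 2 + potential d r) u v G H
      = 2 * energy₂ d Λ u G / lam * nonlinearForm d p u v := by
  set c : ℝ → ℝ := fun r => Λ + (((d : ℝ) - 1) / 2) ^ 2 + potential d r with hc
  have hcoef : IsBoundedCoefficient c := isBoundedCoefficient_add_potential d _
  have hen : ∀ (v : Space d → 𝕜) (H : Fin d → Space d → 𝕜),
    energy₂ d Λ v H = quadraticTerm d c v H := fun _ _ => rfl
  set Q := quadraticTerm d c u G with hQ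
  set B := quadraticForm c u v G H with hB
  set N : ℝ → ℝ := fun t => nonlinearTerm d p fun x => u x + t • v x with hN
  have hQd : HasDerivAt (fun t : ℝ => quadraticTerm d c (fun x => u x + t • v x)
      (fun i x => G i x + t • H i x)) B 0 := by
    rw [funext fun t => quadraticTerm_add_smul hcoef hu hv t]
    exact hasDerivAt_quadratic_zero _ _ _
  have hNd : HasDerivAt N ((p + 2) * nonlinearForm d p u v) 0 :=
    hasDerivAt_nonlinearTerm hd hp hu.memLp.aestronglyMeasurable
    hv.memLp.aestronglyMeasurable hup hvp
  have hN0 : N 0 = lam := by simp only [hN, zero_smul, add_zero, huN]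
  have hp2 : 0 < p + 2 := by linarith
  have hρd : HasDerivAt (fun t => lam / N t) (-((p + 2) * nonlinearForm d p u v) / lam) 0 := by
    have := (hasDerivAt_const (0 : ℝ) lam).div hNd (by rw [hN0]; exact hlam.ne')
    refine this.congr_deriv ?_
    rw [hN0]
    field_simp
    ring
  have hρ0 : lam / N 0 = 1 := by rw [hN0, div_self hlam.ne']
  -- The constraint is homogeneous of degree p + 2, so u + tv is rescaled by (lam / N(t))^(1/(p+2));
  -- the quadratic energy picks up the square of this factor.
  have hσd : HasDerivAt (fun t => (lam / N t) ^ (2 / (p + 2)))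
      (-(2 * nonlinearForm d p u v) / lam) 0 := by
    have := hρd.rpow_const (p := 2 / (p + 2)) (Or.inl (by rw [hρ0]; exact one_ne_zero))
    refine this.congr_deriv ?_
    rw [hρ0, Real.one_rpow, mul_one]
    field_simp
  have hE : HasDerivAt (fun t => (lam / N t) ^ (2 / (p + 2)) * quadraticTerm d c
      (fun x => u x + t • v x) (fun i x => G i x + t • H i x))
      (-(2 * nonlinearForm d p u v) / lam * Q + B) 0 := by
    refine (hσd.mul hQd).congr_deriv ?_
    simp only [hρ0, Real.one_rpow, zero_smul, add_zero, one_mul, hQ]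
  have hloc : IsLocalMin (fun t => (lam / N t) ^ (2 / (p + 2)) * quadraticTerm d c
      (fun x => u x + t • v x) (fun i x => G i x + t • H i x)) 0 := by
    have hpos : ∀ᶠ t in 𝓝 0, 0 < N t :=
      hNd.continuousAt.eventually (lt_mem_nhds (by rw [hN0]; exact hlam))
    filter_upwards [hpos] with t ht
    simp only [hρ0, Real.one_rpow, zero_smul, add_zero, one_mul]
    have hρ : 0 ≤ lam / N t := by positivity
    have hσ : 0 ≤ (lam / N t) ^ (2 / (p + 2)) := by positivity
    have h1 := hmin _ _ ((hu.add (hv.smul t)).smul √((lam / N t) ^ (2 / (p + 2)))) (by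
      rw [nonlinearTerm_smul p (fun x => u x + t • v x) (Real.sqrt_nonneg _), sqrt_rpow_eq hσ,
        ← Real.rpow_mul hρ, show 2 / (p + 2) * ((p + 2) / 2) = 1 by field_simp, Real.rpow_one]
      exact div_mul_cancel₀ _ ht.ne')
    rwa [hen, hen, quadraticTerm_smul _ (fun x => u x + t • v x) (fun i x => G i x + t • H i x),
      Real.sq_sqrt hσ] at h1
  have h0 := hloc.hasDerivAt_eq_zero hE
  rw [hen, ← hQ]
  field_simp at h0 ⊢
  linarith

end

/-! ### The infimum of the mass-constrained energy is nonpositive -/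

section Infimum

variable {d : ℕ}

theorem integral_comp_inv_smul_space (F : Space d → ℝ) {R : ℝ} (hR : 0 < R) :
    ∫ x, F (R⁻¹ • x) = R ^ d * ∫ y, F y := by
  have := Measure.integral_comp_inv_smul_of_nonneg (volume : Measure (Space d)) F hR.le
  rwa [finrank_euclideanSpace_fin, smul_eq_mul] at this

theorem fderiv_comp_inv_smul (φ : Space d → ℝ) {R : ℝ} (x v : Space d) :
    fderiv ℝ (fun y => φ (R⁻¹ • y)) x v = R⁻¹ * fderiv ℝ φ (R⁻¹ • x) v := by
  rw [fderiv_comp_smul]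
  simp

/-- Spreading out a bump function shows that the infimum `I_lam` is at most zero. -/
theorem exists_energy₁_le [NeZero d] {𝕜 : Type*} [RCLike 𝕜] {p : ℝ} (hp : 0 < p) {lam : ℝ} (hlam : 0 < lam)
    {ε : ℝ} (hε : 0 < ε) : ∃ (v : Space d → 𝕜) (H : Fin d → Space d → 𝕜),
      MemH1WithGradient v H ∧ (∫ x, ‖v x‖ ^ 2) = lam ∧ energy₁ d p v H ≤ ε := by
  let b : ContDiffBump (0 : Space d) := ⟨1, 2, one_pos, one_lt_two⟩
  let φ : Space d → ℝ := fun x => b x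
  have hφs : ContDiff ℝ ∞ φ := b.contDiff
  have hφc : HasCompactSupport φ := b.hasCompactSupport
  have hφ2c : HasCompactSupport fun x => φ x ^ 2 := by
    simpa only [sq, Pi.mul_def] using hφc.mul_right (f' := φ)
  have hdc : ∀ i : Fin d, Continuous fun x => fderiv ℝ φ x (EuclideanSpace.single i (1 : ℝ)) :=
    fun i => (hφs.continuous_fderiv (by simp)).clm_apply continuous_const
  have hφ2i : Integrable fun x => φ x ^ 2 :=
    (hφs.continuous.pow 2).integrable_of_hasCompactSupport hφ2c
  have hDi : Integrable fun x => ∑ i, (fderiv ℝ φ x (EuclideanSpace.single i (1 : ℝ))) ^ 2 := by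
    refine integrable_finsetSum _ fun i _ => ((hdc i).pow 2).integrable_of_hasCompactSupport ?_
    have := (hφc.fderiv_apply (𝕜 := ℝ) (EuclideanSpace.single i (1 : ℝ)))
    simpa only [sq, Pi.mul_def] using this.mul_right
      (f' := fun x => fderiv ℝ φ x (EuclideanSpace.single i (1 : ℝ)))
  set A := ∫ x, φ x ^ 2 with hA
  set D := ∫ x, ∑ i, (fderiv ℝ φ x (EuclideanSpace.single i (1 : ℝ))) ^ 2 with hD
  have hApos : 0 < A := by
    refine (integral_pos_iff_support_of_nonneg (fun x => sq_nonneg _) hφ2i).2 ?_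
    refine (Metric.measure_ball_pos volume (0 : Space d) one_pos).trans_le (measure_mono ?_)
    intro x hx
    have : φ x = 1 := b.one_of_mem_closedBall (Metric.ball_subset_closedBall hx)
    simp [this]
  obtain ⟨C, hC0, hC⟩ := exists_abs_potential_le d
  have hVlim : Tendsto (fun R : ℝ => ∫ y : Space d, potential d (R * ‖y‖) * φ y ^ 2) atTop
      (𝓝 0) := by
    have := tendsto_integral_filter_of_dominated_convergence (μ := (volume : Measure (Space d)))
      (l := (atTop : Filter ℝ))
      (F := fun R y => potential d (R * ‖y‖) * φ y ^ 2)
      -- At y = 0 the argument R‖y‖ does not go to infinity. The limit function records that value,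
      -- and the single point is null.
      (f := fun y => if y = 0 then potential d 0 * φ y ^ 2 else 0 * φ y ^ 2)
      (fun y => C * φ y ^ 2) ?_ ?_ (hφ2i.const_mul C) ?_
    · convert this using 2
      symm
      rw [integral_eq_zero_of_ae]
      filter_upwards [compl_mem_ae_iff.2 (measure_singleton (0 : Space d))] with y hy
      have hy0 : y ≠ 0 := hy
      simp [hy0]
    · exact Eventually.of_forall fun R => (((continuous_potential d).comp
        (continuous_const.mul continuous_norm)).mul (hφs.continuous.pow 2)).aestronglyMeasurable
    · filter_upwards [eventually_ge_atTop 0] with R hR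
      refine ae_of_all _ fun y => ?_
      rw [norm_mul, Real.norm_eq_abs, Real.norm_of_nonneg (sq_nonneg _)]
      exact mul_le_mul_of_nonneg_right (hC _ (by positivity)) (sq_nonneg _)
    · refine ae_of_all _ fun y => ?_
      split_ifs with h
      · simp [h]
      · refine Tendsto.mul_const _ ((tendsto_potential_atTop d).comp ?_)
        exact tendsto_id.atTop_mul_const (norm_pos_iff.2 h)
  have hDlim : Tendsto (fun R : ℝ => (R⁻¹) ^ 2 * D) atTop (𝓝 0) := by
    have := (tendsto_inv_atTop_zero (𝕜 := ℝ)).pow 2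
    simpa using this.mul_const D
  have hlim : Tendsto (fun R : ℝ => lam / (2 * A) *
      ((R⁻¹) ^ 2 * D + ∫ y : Space d, potential d (R * ‖y‖) * φ y ^ 2)) atTop (𝓝 0) := by
    simpa using (hDlim.add hVlim).const_mul (lam / (2 * A))
  obtain ⟨R, hRε, hR⟩ := ((hlim.eventually_lt_const hε).and (eventually_gt_atTop 0)).exists
  have hRd : 0 < R ^ d := by positivity
  -- The amplitude giving the bump of width R the mass s² R^d A = lam. The gradient term then scales
  -- like R^(−2), the potential term tends to 0 by dominated convergence, and the nonlinear term
  -- only lowers the energy.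
  set s := √(lam / (R ^ d * A)) with hs
  have hs2 : s ^ 2 = lam / (R ^ d * A) := Real.sq_sqrt (by positivity)
  have hψs : ContDiff ℝ ∞ fun y : Space d => φ (R⁻¹ • y) := hφs.comp (contDiff_const_smul _)
  have hψc : HasCompactSupport fun y : Space d => φ (R⁻¹ • y) :=
    hφc.comp_smul (inv_ne_zero hR.ne')
  refine ⟨_, _, memH1WithGradient_smul_const hψs hψc ((s : ℝ) : 𝕜), ?_, ?_⟩
  · have h1 : ∀ x : Space d, ‖φ (R⁻¹ • x) • ((s : ℝ) : 𝕜)‖ ^ 2 = s ^ 2 * φ (R⁻¹ • x) ^ 2 := by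
      intro x
      rw [norm_smul, mul_pow, Real.norm_eq_abs, sq_abs, RCLike.norm_ofReal, sq_abs, mul_comm]
    simp only [h1]
    rw [integral_const_mul, integral_comp_inv_smul_space (fun y => φ y ^ 2) hR, hs2, ← hA]
    field_simp
  · unfold energy₁
    have hN := nonlinearTerm_nonneg (d := d) hp fun x => φ (R⁻¹ • x) • ((s : ℝ) : 𝕜)
    have hVi : Integrable fun y : Space d => potential d (R * ‖y‖) * φ y ^ 2 := by
      refine hφ2i.bdd_mul (c := C) ((continuous_potential d).comp
        (continuous_const.mul continuous_norm)).aestronglyMeasurable (ae_of_all _ fun y => ?_)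
      exact hC _ (by positivity)
    have hQ : quadraticTerm d (potential d) (fun x => φ (R⁻¹ • x) • ((s : ℝ) : 𝕜))
        (fun i x => fderiv ℝ (fun y => φ (R⁻¹ • y)) x (EuclideanSpace.single i 1) •
          ((s : ℝ) : 𝕜)) = lam / (2 * A) *
      ((R⁻¹) ^ 2 * D + ∫ y : Space d, potential d (R * ‖y‖) * φ y ^ 2) := by
      unfold quadraticTerm
      have h1 : ∀ x : Space d, 1 / 2 * ∑ i, ‖fderiv ℝ (fun y => φ (R⁻¹ • y)) x
          (EuclideanSpace.single i 1) • ((s : ℝ) : 𝕜)‖ ^ 2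
          + 1 / 2 * potential d ‖x‖ * ‖φ (R⁻¹ • x) • ((s : ℝ) : 𝕜)‖ ^ 2
          = (fun y : Space d => s ^ 2 / 2 * ((R⁻¹) ^ 2 *
            (∑ i, (fderiv ℝ φ y (EuclideanSpace.single i (1 : ℝ))) ^ 2)
              + potential d (R * ‖y‖) * φ y ^ 2)) (R⁻¹ • x) := by
        intro x
        have h2 : R * ‖R⁻¹ • x‖ = ‖x‖ := by
          rw [norm_smul, norm_inv, Real.norm_of_nonneg hR.le, mul_inv_cancel_left₀ hR.ne']
        simp only [norm_smul, mul_pow, Real.norm_eq_abs, sq_abs, RCLike.norm_ofReal,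
          fderiv_comp_inv_smul] at h2 ⊢
        rw [h2, ← Finset.sum_mul, ← Finset.mul_sum]
        ring
      refine (integral_congr_ae (ae_of_all _ h1)).trans
        ((integral_comp_inv_smul_space (fun y : Space d => s ^ 2 / 2 * ((R⁻¹) ^ 2 *
            (∑ i, (fderiv ℝ φ y (EuclideanSpace.single i (1 : ℝ))) ^ 2)
              + potential d (R * ‖y‖) * φ y ^ 2)) hR).trans ?_)
      rw [integral_const_mul,
        integral_add (hDi.const_mul _) hVi, integral_const_mul, ← hD, hs2]
      field_simp
    linarith

end Infimum

/-! ### Positive frequency and the radial form of the equation -/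

section Variational

variable {𝕜 : Type*} [RCLike 𝕜] {d : ℕ}

/-- The Euler–Lagrange equation of a minimizer, with a positive frequency. -/
theorem exists_eulerLagrange (hd : 2 ≤ d) {p : ℝ} (hp : 0 < p) {Λ : ℝ}
    (hΛ : -(((d : ℝ) - 1) / 2) ^ 2 < Λ) {lam : ℝ} (hlam : 0 < lam) {u : Space d → 𝕜}
    (hmin : IsMinimizerI d p lam u ∨ IsMinimizerJ d p Λ lam u)
    (hup : ∀ G, MemH1WithGradient u G → Integrable fun x => ‖u x‖ ^ (p + 2)) :
    ∃ (G : Fin d → Space d → 𝕜) (w a : ℝ), MemH1WithGradient u G ∧ 0 < w ∧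
      ∀ (v : Space d → 𝕜) (H : Fin d → Space d → 𝕜), MemH1WithGradient v H →
        (Integrable fun x => ‖v x‖ ^ (p + 2)) →
        quadraticForm (fun r => w + potential d r) u v G H = a * nonlinearForm d p u v := by
  rcases hmin with ⟨G, hu, hu2, hm⟩ | ⟨G, hu, huN, hm⟩
  · have : NeZero d := ⟨by omega⟩
    have hE0 : energy₁ d p u G ≤ 0 := by
      refine le_of_forall_pos_le_add fun ε hε => ?_
      obtain ⟨v, H, hv, hv2, hle⟩ := exists_energy₁_le (d := d) (𝕜 := 𝕜) hp hlam hε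
      rw [zero_add]
      exact (hm v H hv hv2).trans hle
    have hN := nonlinearTerm_pos hd hp (hup G hu) (by rw [hu2]; exact hlam)
    refine ⟨G, ((p + 2) * nonlinearTerm d p u - 2 * quadraticTerm d (potential d) u G) / lam,
      p + 2, hu, ?_, fun v H hv hvp => ?_⟩
    -- With Q − N = 𝓔₁(u) ≤ 0, the numerator (p+2)N − 2Q equals pN − 2𝓔₁(u) ≥ pN > 0.
    · refine div_pos ?_ hlam
      unfold energy₁ at hE0
      nlinarith [mul_pos hp hN]
    · rw [← eulerLagrange_of_isMinimizerI hd hp hlam hu hu2 hm (hup G hu) hv hvp]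
      set w := ((p + 2) * nonlinearTerm d p u - 2 * quadraticTerm d (potential d) u G) / lam
      have hcoef : IsBoundedCoefficient (potential d) := by
        simpa using isBoundedCoefficient_add_potential d 0
      have hi := integrable_inner_of_memLp_two hu.memLp hv.memLp
      have h1 := (integrable_sum_inner hu.memLp_gradient hv.memLp_gradient).add
        (hcoef.integrable_mul hi)
      simp only [Pi.add_def] at h1
      unfold quadraticForm
      rw [← integral_const_mul, ← integral_add h1 (hi.const_mul w)]
      congr 1
      ext x
      ring
  -- Here the frequency is μ_d itself, positive by the assumption on Λ; no sign of the coefficient a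
  -- is needed later.
  · exact ⟨G, Λ + (((d : ℝ) - 1) / 2) ^ 2, 2 * energy₂ d Λ u G / lam, hu, by linarith,
      fun v H hv hvp => eulerLagrange_of_isMinimizerJ hd hp hlam hu huN hm (hup G hu) hv hvp⟩

theorem locallyIntegrable_rpow_smul {p : ℝ} (hp : 0 < p) {u : Space d → 𝕜}
    (hum : AEStronglyMeasurable u volume) (hup : Integrable fun x => ‖u x‖ ^ (p + 2)) :
    LocallyIntegrable fun x => ‖u x‖ ^ p • u x := by
  have h1 : LocallyIntegrable fun x : Space d => 1 + ‖u x‖ ^ (p + 2) :=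
    (locallyIntegrable_const 1).add hup.locallyIntegrable
  refine h1.mono ((hum.norm.aemeasurable.pow_const p).aestronglyMeasurable.smul hum)
    (ae_of_all _ fun x => ?_)
  have h0 := norm_nonneg (u x)
  rw [norm_smul, Real.norm_of_nonneg (by positivity), Real.norm_of_nonneg (by positivity)]
  have h2 : ‖u x‖ ^ p * ‖u x‖ = ‖u x‖ ^ (p + 1) := by
    rw [Real.rpow_add' h0 (by linarith), Real.rpow_one]
  rw [h2]
  rcases le_total ‖u x‖ 1 with h | h
  · have := Real.rpow_le_one h0 h (by linarith : 0 ≤ p + 1)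
    have h3 : 0 ≤ ‖u x‖ ^ (p + 2) := by positivity
    linarith
  · have := Real.rpow_le_rpow_of_exponent_le h (by linarith : p + 1 ≤ p + 2)
    linarith

/-- The right-hand side `(w + V) f - a K |f|^p f` of the profile equation. -/
def profileRHS (d : ℕ) (p w a : ℝ) (f : ℝ → 𝕜) (r : ℝ) : 𝕜 :=
  (w + potential d r - a * (weight d p r * ‖f r‖ ^ p)) • f r

/-- The weak radial form of the Euler–Lagrange equation. -/
theorem integral_profile_eq [NeZero d] {p : ℝ} (hp : 0 < p) {u : Space d → 𝕜}
    {G : Fin d → Space d → 𝕜} {w a : ℝ} (hu : MemH1WithGradient u G)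
    (hup : Integrable fun x => ‖u x‖ ^ (p + 2))
    (hEL : ∀ (v : Space d → 𝕜) (H : Fin d → Space d → 𝕜), MemH1WithGradient v H →
        (Integrable fun x => ‖v x‖ ^ (p + 2)) →
        quadraticForm (fun r => w + potential d r) u v G H = a * nonlinearForm d p u v)
    {f h : ℝ → 𝕜} (huf : u =ᵐ[volume] fun x => f ‖x‖)
    (hrep : ∀ ψ, IsHalfLineTest ψ → ∫ x, ψ ‖x‖ • radialComponent G x
        = sphereArea d • ∫ r in Ioi (0 : ℝ), r ^ (d - 1) • ψ r • h r)
    {ψ : ℝ → ℝ} (hψ : IsHalfLineTest ψ) :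
    ∫ r in Ioi (0 : ℝ), deriv ψ r • r ^ (d - 1) • h r
      = - ∫ r in Ioi (0 : ℝ), ψ r • r ^ (d - 1) • profileRHS d p w a f r := by
  have hcoef := isBoundedCoefficient_add_potential d w
  have hψc : Continuous fun x : Space d => ψ ‖x‖ := hψ.contDiff_comp_norm.continuous
  have hψs : HasCompactSupport fun x : Space d => ψ ‖x‖ := hψ.hasCompactSupport_comp_norm
  let W₁ : Space d → 𝕜 := fun x => deriv ψ ‖x‖ • radialComponent G x
  let W₂ : Space d → 𝕜 := fun x => ((w + potential d ‖x‖) * ψ ‖x‖) • u x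
  let W₃ : Space d → 𝕜 := fun x => (weight d p ‖x‖ * ψ ‖x‖) • (‖u x‖ ^ p • u x)
  have hW₁ : Integrable W₁ := integrable_smul_of_memLp_two (memLp_radialComponent hu.memLp_gradient)
    hψ.deriv.contDiff_comp_norm.continuous hψ.deriv.hasCompactSupport_comp_norm
  have hW₂ : Integrable W₂ := integrable_smul_of_memLp_two hu.memLp
    ((hcoef.continuous.comp continuous_norm).mul hψc) hψs.mul_left
  have hW₃ : Integrable W₃ :=
    (locallyIntegrable_rpow_smul hp hu.memLp.aestronglyMeasurable hup
      ).integrable_smul_left_of_hasCompactSupport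
      (((continuous_weight d p).comp continuous_norm).mul hψc) hψs.mul_left
  -- The Euler–Lagrange identity is real-valued. Testing with ψ(|x|) z, where z is the 𝕜-valued
  -- residual itself, turns it into ⟪z, z⟫ = 0. The gradient of ψ(|x|) is radial, so only the radial
  -- component of G appears.
  have hzero : (∫ x, W₁ x) + ((∫ x, W₂ x) - a • ∫ x, W₃ x) = 0 := by
    rw [← inner_self_eq_zero (𝕜 := ℝ)]
    set z := (∫ x, W₁ x) + ((∫ x, W₂ x) - a • ∫ x, W₃ x) with hz
    have hφp : Integrable fun x : Space d => ‖ψ ‖x‖ • z‖ ^ (p + 2) := by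
      refine Continuous.integrable_of_hasCompactSupport ?_ ?_
      · exact (hψc.smul continuous_const).norm.rpow_const fun _ => Or.inr (by linarith)
      · exact (hψs.smul_right (f' := fun _ => z)).norm.comp_left
          (g := fun t : ℝ => t ^ (p + 2)) (Real.zero_rpow (by linarith))
    have h1 := hEL _ _ (memH1WithGradient_smul_const hψ.contDiff_comp_norm hψs z) hφp
    have h2 : quadraticForm (fun r => w + potential d r) u (fun x => ψ ‖x‖ • z) G
        (fun i x => fderiv ℝ (fun x : Space d => ψ ‖x‖) x (EuclideanSpace.single i 1) • z)
        = inner ℝ z (∫ x, W₁ x) + inner ℝ z (∫ x, W₂ x) := by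
      rw [← integral_inner hW₁, ← integral_inner hW₂,
        ← integral_add (hW₁.const_inner z) (hW₂.const_inner z)]
      unfold quadraticForm
      congr 1
      ext x
      simp only [W₁, W₂, radialComponent, hψ.fderiv_comp_norm_single, inner_smul_right, inner_sum,
        real_inner_comm z, Finset.mul_sum]
      congr 1
      · exact Finset.sum_congr rfl fun i _ => by ring
      · ring
    have h3 : nonlinearForm d p u (fun x => ψ ‖x‖ • z) = inner ℝ z (∫ x, W₃ x) := by
      rw [← integral_inner hW₃]
      unfold nonlinearForm
      congr 1
      ext x
      simp only [W₃, inner_smul_right, real_inner_comm z]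
      ring
    rw [h2, h3] at h1
    conv_lhs => rw [hz]
    rw [real_inner_comm, inner_add_right, inner_sub_right, inner_smul_right]
    linarith
  have hW₃a : Integrable fun x => a • W₃ x := hW₃.smul a
  have hW23 : (∫ x, W₂ x) - a • ∫ x, W₃ x
      = sphereArea d • ∫ r in Ioi (0 : ℝ), r ^ (d - 1) • ψ r • profileRHS d p w a f r := by
    rw [← integral_comp_norm (fun r => ψ r • profileRHS d p w a f r), ← integral_smul,
      ← integral_sub hW₂ hW₃a]
    refine integral_congr_ae ?_
    filter_upwards [huf] with x hx
    simp only [W₂, W₃, profileRHS, hx, smul_smul, ← sub_smul]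
    congr 1
    ring
  have hW₁' : ∫ x, W₁ x = _ := hrep _ hψ.deriv
  rw [hW23, hW₁', ← smul_add] at hzero
  have h4 := (smul_eq_zero.1 hzero).resolve_left sphereArea_pos.ne'
  simp only [smul_comm (_ : ℝ) (_ : ℝ) (_ : 𝕜)] at h4 ⊢
  exact eq_neg_of_add_eq_zero_left h4

end Variational

/-! ### Flux estimates near the origin -/

section Flux

variable {E : Type*} [NormedAddCommGroup E]

/-- If ‖P‖ ≥ η near 0, then 1/r ≤ r^(−m) would be integrable there. Applied to P = r^m f', this
rules out a singular solution whose flux stays away from zero at the origin. -/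
theorem exists_norm_lt_of_integrable {P : ℝ → E} {m : ℕ} (hm : 1 ≤ m)
    (hi : IntegrableOn (fun r : ℝ => (r ^ m)⁻¹ * ‖P r‖ ^ 2) (Ioi 0)) {η r : ℝ} (hη : 0 < η)
    (hr : 0 < r) : ∃ a, 0 < a ∧ a < r ∧ ‖P a‖ < η := by
  by_contra! hcon
  set ρ := min r 1 with hρ
  have hρ0 : 0 < ρ := lt_min hr one_pos
  have h1 : IntegrableOn (fun r : ℝ => r⁻¹) (Ioo 0 ρ) := by
    refine ((hi.mono_set fun x (hx : x ∈ Ioo 0 ρ) => hx.1).const_mul ((η ^ 2)⁻¹)).mono'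
      measurable_inv.aestronglyMeasurable ?_
    filter_upwards [ae_restrict_mem measurableSet_Ioo] with s hs
    have hs0 : 0 < s := hs.1
    have hs1 : s ≤ 1 := hs.2.le.trans (min_le_right _ _)
    rw [Real.norm_of_nonneg (by positivity)]
    have h2 : s⁻¹ ≤ (s ^ m)⁻¹ := by
      gcongr
      exact pow_le_of_le_one hs0.le hs1 (by omega)
    have h3 : η ^ 2 ≤ ‖P s‖ ^ 2 := by
      gcongr
      exact hcon s hs0 (hs.2.trans_le (min_le_left _ _))
    rw [inv_mul_eq_div, le_div_iff₀ (by positivity)]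
    gcongr
  have h2 : IntervalIntegrable (fun r : ℝ => r⁻¹) volume 0 ρ := by
    rwa [intervalIntegrable_iff_integrableOn_Ioo_of_le hρ0.le]
  rw [intervalIntegrable_inv_iff] at h2
  rcases h2 with h2 | h2
  · exact hρ0.ne h2
  · exact h2 left_mem_uIcc

variable [NormedSpace ℝ E]

/-- Mean value inequality against the majorant (C/q) s^q. Negative q is allowed, which the bootstrap
needs while the profile bound is still singular. -/
theorem norm_sub_le_of_norm_deriv_le_rpow {P P' : ℝ → E} {a r C q : ℝ} (ha : 0 < a) (har : a ≤ r)
    (hq : q ≠ 0) (hP : ∀ s, a ≤ s → s ≤ r → HasDerivAt P (P' s) s)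
    (hb : ∀ s, a ≤ s → s ≤ r → ‖P' s‖ ≤ C * s ^ (q - 1)) :
    ‖P r - P a‖ ≤ C / q * (r ^ q - a ^ q) := by
  have hB : ∀ s, 0 < s → HasDerivAt (fun s : ℝ => C / q * (s ^ q - a ^ q)) (C * s ^ (q - 1)) s := by
    intro s hs
    refine (((Real.hasDerivAt_rpow_const (Or.inl hs.ne')).sub_const _).const_mul _).congr_deriv ?_
    field_simp
  exact image_norm_le_of_norm_deriv_right_le_deriv_boundary' (f := fun s => P s - P a) (f' := P')
    (B := fun s => C / q * (s ^ q - a ^ q)) (B' := fun s => C * s ^ (q - 1))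
    (fun s hs => ((hP s hs.1 hs.2).continuousAt.sub continuousAt_const).continuousWithinAt)
    (fun s hs => ((hP s hs.1 hs.2.le).sub_const _).hasDerivWithinAt) (by simp)
    (fun s hs => (hB s (ha.trans_le hs.1)).continuousAt.continuousWithinAt)
    (fun s hs => (hB s (ha.trans_le hs.1)).hasDerivWithinAt) (fun s hs => hb s hs.1 hs.2.le)
    (right_mem_Icc.2 har)

/-- Integrate from a radius where P is small; such radii exist arbitrarily close to 0, so no
boundary term survives. -/
theorem norm_le_of_norm_deriv_le_rpow {P P' : ℝ → E} {ρ C q : ℝ} (hq : 0 < q) (hC : 0 ≤ C)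
    (hP : ∀ s, 0 < s → s ≤ ρ → HasDerivAt P (P' s) s)
    (hb : ∀ s, 0 < s → s ≤ ρ → ‖P' s‖ ≤ C * s ^ (q - 1))
    (hsmall : ∀ η > 0, ∀ r > 0, ∃ a, 0 < a ∧ a < r ∧ ‖P a‖ < η) {r : ℝ} (hr : 0 < r)
    (hrρ : r ≤ ρ) : ‖P r‖ ≤ C / q * r ^ q := by
  refine le_of_forall_pos_le_add fun η hη => ?_
  obtain ⟨a, ha, har, hPa⟩ := hsmall η hη r hr
  have h1 := norm_sub_le_of_norm_deriv_le_rpow ha har.le hq.ne'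
    (fun s hs hs' => hP s (ha.trans_le hs) (hs'.trans hrρ))
    (fun s hs hs' => hb s (ha.trans_le hs) (hs'.trans hrρ))
  have h2 : ‖P r‖ ≤ ‖P r - P a‖ + ‖P a‖ := by simpa using norm_add_le (P r - P a) (P a)
  have h3 : C / q * (r ^ q - a ^ q) ≤ C / q * r ^ q := by
    have : 0 ≤ a ^ q := by positivity
    gcongr
    linarith
  linarith

end Flux

/-! ### Interior regularity and boundedness at the origin -/

section Regularity

variable {𝕜 : Type*} [RCLike 𝕜] {d : ℕ}

theorem continuousOn_profileRHS (d : ℕ) {p : ℝ} (hp : 0 < p) (w a : ℝ) {f : ℝ → 𝕜} {s : Set ℝ}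
    (hf : ContinuousOn f s) : ContinuousOn (profileRHS d p w a f) s := by
  have h1 : ContinuousOn (fun r => ‖f r‖ ^ p) s := hf.norm.rpow_const fun _ _ => Or.inr hp.le
  exact (((continuous_const.add (continuous_potential d)).continuousOn).sub
    (continuousOn_const.mul ((continuous_weight d p).continuousOn.mul h1))).smul hf

/-- Interior regularity: the profile is `C²` on `(0, ∞)` and solves the profile equation. -/
theorem exists_profile_deriv [NeZero d] {p : ℝ} (hp : 0 < p) {w a : ℝ} {f h : ℝ → 𝕜} {c : 𝕜}
    (hh : LocallyIntegrableOn h (Ioi 0)) (hf : ∀ r, f r = c + ∫ t in (1 : ℝ)..r, h t)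
    (h2 : IntegrableOn (fun r : ℝ => r ^ (d - 1) * ‖h r‖ ^ 2) (Ioi 0))
    (hweak : ∀ ψ, IsHalfLineTest ψ → ∫ r in Ioi (0 : ℝ), deriv ψ r • r ^ (d - 1) • h r
      = - ∫ r in Ioi (0 : ℝ), ψ r • r ^ (d - 1) • profileRHS d p w a f r) :
    ∃ k : ℝ → 𝕜, (∀ r, 0 < r → HasDerivAt f (k r) r) ∧
      (∀ r, 0 < r → HasDerivAt (fun r => r ^ (d - 1) • k r)
        (r ^ (d - 1) • profileRHS d p w a f r) r) ∧
      IntegrableOn (fun r : ℝ => r ^ (d - 1) * ‖k r‖ ^ 2) (Ioi 0) := by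
  have hpow : ContinuousOn (fun r : ℝ => r ^ (d - 1)) (Ioi 0) := by fun_prop
  have hfc := continuousOn_profile hh hf
  have hgc : ContinuousOn (fun r : ℝ => r ^ (d - 1) • profileRHS d p w a f r) (Ioi 0) :=
    hpow.smul (continuousOn_profileRHS d hp w a hfc)
  have hgl := hgc.locallyIntegrableOn (μ := volume) measurableSet_Ioi
  have hhl : LocallyIntegrableOn (fun r : ℝ => r ^ (d - 1) • h r) (Ioi 0) :=
    hh.continuousOn_smul isOpen_Ioi.isLocallyClosed hpow
  -- The flux r^(d−1) h has a continuous weak derivative, so it agrees almost everywhere with a C¹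
  -- function P. Then k = r^(1−d) P is a continuous version of h, and f, a primitive of h, is
  -- differentiable with derivative k.
  obtain ⟨c', hc'⟩ := ae_eq_const_add_primitive hhl hgl hweak
  set P : ℝ → 𝕜 := fun r => c' + ∫ t in (1 : ℝ)..r, t ^ (d - 1) • profileRHS d p w a f t with hP
  have hprim : ∀ {F : ℝ → 𝕜}, ContinuousOn F (Ioi 0) → ∀ r, 0 < r →
      HasDerivAt (fun r => ∫ t in (1 : ℝ)..r, F t) (F r) r := by
    intro F hF r hr
    have hFl := hF.locallyIntegrableOn (μ := volume) measurableSet_Ioi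
    exact intervalIntegral.integral_hasDerivAt_right
      (intervalIntegrable_of_locallyIntegrableOn_Ioi hFl one_pos hr)
      (hF.stronglyMeasurableAtFilter isOpen_Ioi r hr) (hF.continuousAt (Ioi_mem_nhds hr))
  have hPd : ∀ r, 0 < r → HasDerivAt P (r ^ (d - 1) • profileRHS d p w a f r) r := fun r hr =>
    (hprim hgc r hr).const_add c'
  have hPc : ContinuousOn P (Ioi 0) := fun r hr => (hPd r hr).continuousAt.continuousWithinAt
  set k : ℝ → 𝕜 := fun r => (r ^ (d - 1))⁻¹ • P r with hk
  have hkc : ContinuousOn k (Ioi 0) :=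
    (hpow.inv₀ fun r hr => pow_ne_zero _ (ne_of_gt hr)).smul hPc
  have hkP : ∀ r, 0 < r → r ^ (d - 1) • k r = P r := fun r hr => by
    rw [hk]
    exact smul_inv_smul₀ (pow_ne_zero _ hr.ne') _
  have hkh : ∀ᵐ r ∂volume.restrict (Ioi (0 : ℝ)), h r = k r := by
    filter_upwards [hc', ae_restrict_mem measurableSet_Ioi] with r hr hr0
    have : r ^ (d - 1) ≠ 0 := pow_ne_zero _ (ne_of_gt hr0)
    rw [hk]
    change h r = (r ^ (d - 1))⁻¹ • P r
    rw [hP]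
    simp only
    rw [← hr, inv_smul_smul₀ this]
  refine ⟨k, fun r hr => ?_, fun r hr => ?_, ?_⟩
  · have hev : f =ᶠ[𝓝 r] fun r => c + ∫ t in (1 : ℝ)..r, k t := by
      filter_upwards [Ioi_mem_nhds hr] with y hy
      rw [hf y]
      congr 1
      refine intervalIntegral.integral_congr_ae ?_
      have h3 := (ae_restrict_iff' measurableSet_Ioi).1 hkh
      filter_upwards [h3] with t ht ht'
      exact ht (lt_of_le_of_lt (le_min zero_le_one (le_of_lt hy)) ht'.1)
    exact ((hprim hkc r hr).const_add c).congr_of_eventuallyEq hev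
  · refine (hPd r hr).congr_of_eventuallyEq ?_
    filter_upwards [Ioi_mem_nhds hr] with y hy using hkP y hy
  · refine h2.congr_fun_ae ?_
    filter_upwards [hkh] with r hr
    rw [hr]

/-- One step of the bootstrap at the origin. -/
theorem profile_bootstrap_step {m : ℕ} (hm : 1 ≤ m) {f k g : ℝ → 𝕜} {A s κ β C : ℝ}
    (hfd : ∀ r, 0 < r → HasDerivAt f (k r) r)
    (hkd : ∀ r, 0 < r → HasDerivAt (fun r => r ^ m • k r) (r ^ m • g r) r)
    (hk2 : IntegrableOn (fun r : ℝ => r ^ m * ‖k r‖ ^ 2) (Ioi 0))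
    (hA : 0 ≤ A) (hC : 0 ≤ C) (hg : ∀ r, 0 < r → r ≤ 1 → ‖g r‖ ≤ A * r ^ (-s) * ‖f r‖)
    (hκ : κ ≤ 2 - s) (hq : 0 < m + 1 - s - β) (hκβ : κ - β ≠ 0)
    (hf : ∀ r, 0 < r → r ≤ 1 → ‖f r‖ ≤ C * r ^ (-β)) :
    ∃ C', 0 ≤ C' ∧ ∀ r, 0 < r → r ≤ 1 → ‖f r‖ ≤ C' * r ^ min (κ - β) 0 := by
  have hsmall : ∀ η > 0, ∀ r > 0, ∃ a, 0 < a ∧ a < r ∧ ‖a ^ m • k a‖ < η := by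
    intro η hη r hr
    refine exists_norm_lt_of_integrable (P := fun r => r ^ m • k r) hm ?_ hη hr
    refine hk2.congr_fun (fun r hr => ?_) measurableSet_Ioi
    have hr0 : (0 : ℝ) < r := hr
    simp only [norm_smul, norm_pow, Real.norm_of_nonneg hr0.le]
    field_simp
  -- From g = O(r^(−s−β)) the flux is O(r^q), so k = O(r^(1−s−β)), and integrating from 1 inward
  -- gains 2 − s ≥ κ in the exponent of f. The case κ = β, where a logarithm would appear, is
  -- excluded; the minimum with 0 records that the gain stops at boundedness.
  set q : ℝ := m + 1 - s - β with hqdef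
  have hflux : ∀ r, 0 < r → r ≤ 1 → ‖r ^ m • k r‖ ≤ A * C / q * r ^ q := fun r hr hr1 =>
    norm_le_of_norm_deriv_le_rpow (ρ := 1) hq (by positivity) (fun t ht _ => hkd t ht)
      (fun t ht ht1 => by
        rw [norm_smul, norm_pow, Real.norm_of_nonneg ht.le]
        calc t ^ m * ‖g t‖ ≤ t ^ m * (A * t ^ (-s) * (C * t ^ (-β))) := by
              gcongr
              exact (hg t ht ht1).trans (by gcongr; exact hf t ht ht1)
          _ = A * C * (t ^ m * t ^ (-s) * t ^ (-β)) := by ring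
          _ = A * C * t ^ (q - 1) := by
              rw [← Real.rpow_natCast, ← Real.rpow_add ht, ← Real.rpow_add ht, hqdef]
              ring_nf) hsmall hr hr1
  set B := A * C / q with hB
  have hB0 : 0 ≤ B := by positivity
  have hk : ∀ r, 0 < r → r ≤ 1 → ‖k r‖ ≤ B * r ^ (κ - β - 1) := by
    intro r hr hr1
    have h1 := hflux r hr hr1
    rw [norm_smul, norm_pow, Real.norm_of_nonneg hr.le] at h1
    have h2 : ‖k r‖ ≤ (r ^ m)⁻¹ * (B * r ^ q) := by
      rw [inv_mul_eq_div, le_div_iff₀ (by positivity)]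
      linarith
    refine h2.trans ?_
    have h3 : (r ^ m)⁻¹ * (B * r ^ q) = B * r ^ (1 - s - β) := by
      rw [← Real.rpow_natCast, ← Real.rpow_neg hr.le, mul_left_comm, ← Real.rpow_add hr, hqdef]
      ring_nf
    rw [h3]
    gcongr B * ?_
    exact Real.rpow_le_rpow_of_exponent_ge hr hr1 (by linarith)
  refine ⟨‖f 1‖ + B / |κ - β|, by positivity, fun r hr hr1 => ?_⟩
  have h1 := norm_sub_le_of_norm_deriv_le_rpow hr hr1 hκβ (fun t ht _ => hfd t (hr.trans_le ht))
    (fun t ht ht1 => hk t (hr.trans_le ht) ht1)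
  have h2 : ‖f r‖ ≤ ‖f 1‖ + ‖f 1 - f r‖ := by
    have := norm_sub_le (f 1) (f 1 - f r)
    rwa [sub_sub_cancel] at this
  have h3 : 1 ≤ r ^ min (κ - β) 0 :=
    Real.one_le_rpow_of_pos_of_le_one_of_nonpos hr hr1 (min_le_right _ _)
  have h4 : B / (κ - β) * (1 ^ (κ - β) - r ^ (κ - β)) ≤ B / |κ - β| * r ^ min (κ - β) 0 := by
    rw [Real.one_rpow]
    rcases lt_or_gt_of_ne hκβ with hneg | hpos
    · rw [abs_of_neg hneg, min_eq_left hneg.le, div_neg, neg_mul, ← mul_neg]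
      have : B / (κ - β) ≤ 0 := div_nonpos_of_nonneg_of_nonpos hB0 hneg.le
      nlinarith
    · rw [abs_of_pos hpos, min_eq_right hpos.le, Real.rpow_zero]
      have : 0 ≤ r ^ (κ - β) := by positivity
      gcongr
      linarith
  calc ‖f r‖ ≤ ‖f 1‖ + B / |κ - β| * r ^ min (κ - β) 0 := by linarith
    _ ≤ ‖f 1‖ * r ^ min (κ - β) 0 + B / |κ - β| * r ^ min (κ - β) 0 := by
        gcongr
        exact le_mul_of_one_le_right (norm_nonneg _) h3
    _ = _ := by ring

/-- The profile is bounded at the origin. -/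
theorem profile_bounded_near_zero {m : ℕ} (hm : 1 ≤ m) {f k g : ℝ → 𝕜} {A s β C : ℝ}
    (hfd : ∀ r, 0 < r → HasDerivAt f (k r) r)
    (hkd : ∀ r, 0 < r → HasDerivAt (fun r => r ^ m • k r) (r ^ m • g r) r)
    (hk2 : IntegrableOn (fun r : ℝ => r ^ m * ‖k r‖ ^ 2) (Ioi 0))
    (hA : 0 ≤ A) (hC : 0 ≤ C) (hg : ∀ r, 0 < r → r ≤ 1 → ‖g r‖ ≤ A * r ^ (-s) * ‖f r‖)
    (hs : s < 2) (hβ : 0 < β) (hq : 0 < m + 1 - s - β)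
    (hf : ∀ r, 0 < r → r ≤ 1 → ‖f r‖ ≤ C * r ^ (-β)) :
    ∃ C', 0 ≤ C' ∧ ∀ r, 0 < r → r ≤ 1 → ‖f r‖ ≤ C' := by
  obtain ⟨n, hn⟩ := exists_nat_gt (β / (2 - s))
  rw [div_lt_iff₀ (by linarith)] at hn
  -- With κ = β/(n + 1/2) the exponents β − jκ are half-integer multiples of κ, so none equals κ.
  -- After n steps κ/2 is left, and one more step reaches boundedness.
  set N : ℝ := n + 1 / 2 with hN
  have hN0 : 0 < N := by positivity
  set κ := β / N with hκ
  have hκN : κ * N = β := div_mul_cancel₀ _ hN0.ne'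
  have hκ0 : 0 < κ := by positivity
  have hκs : κ ≤ 2 - s := by
    rw [hκ, div_le_iff₀ hN0]
    nlinarith
  have hind : ∀ j : ℕ, j ≤ n → ∃ C', 0 ≤ C' ∧ ∀ r, 0 < r → r ≤ 1 →
      ‖f r‖ ≤ C' * r ^ (-(β - j * κ)) := by
    intro j
    induction j with
    | zero => exact fun _ => ⟨C, hC, by simpa using hf⟩
    | succ j ih =>
      intro hj
      obtain ⟨C₁, hC₁, hf₁⟩ := ih (by omega)
      have hj' : (j : ℝ) + 1 ≤ n := by exact_mod_cast hj
      have hlt : κ - (β - j * κ) < 0 := by rw [← hκN, hN]; nlinarith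
      obtain ⟨C₂, hC₂, hf₂⟩ := profile_bootstrap_step hm hfd hkd hk2 hA hC₁ hg hκs
        (β := β - j * κ) (by nlinarith [mul_nonneg (Nat.cast_nonneg (α := ℝ) j) hκ0.le]) hlt.ne hf₁
      refine ⟨C₂, hC₂, fun r hr hr1 => ?_⟩
      have h5 := hf₂ r hr hr1
      rw [min_eq_left hlt.le] at h5
      convert h5 using 3
      push_cast
      ring
  obtain ⟨C₁, hC₁, hf₁⟩ := hind n le_rfl
  have hgt : 0 < κ - (β - n * κ) := by rw [← hκN, hN]; nlinarith
  obtain ⟨C₂, hC₂, hf₂⟩ := profile_bootstrap_step hm hfd hkd hk2 hA hC₁ hg hκs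
    (β := β - n * κ) (by nlinarith [mul_nonneg (Nat.cast_nonneg (α := ℝ) n) hκ0.le]) hgt.ne' hf₁
  refine ⟨C₂, hC₂, fun r hr hr1 => ?_⟩
  simpa [min_eq_right hgt.le] using hf₂ r hr hr1

end Regularity

/-! ### Second-order behaviour of the profile at the origin -/

section Origin

variable {𝕜 : Type*} [RCLike 𝕜] {d : ℕ}

theorem exists_norm_lt_of_tendsto {E : Type*} [NormedAddCommGroup E] {P : ℝ → E}
    (hP : Tendsto P (𝓝[>] 0) (𝓝 0)) {η r : ℝ} (hη : 0 < η) (hr : 0 < r) :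
    ∃ a, 0 < a ∧ a < r ∧ ‖P a‖ < η := by
  have h1 := hP.norm.eventually_lt_const (by simpa using hη : ‖(0 : E)‖ < η)
  obtain ⟨a, ha, ha2⟩ := (h1.and (Ioo_mem_nhdsGT hr)).exists
  exact ⟨a, ha2.1, ha2.2, ha⟩

/-- `k' = g - (m / r) k` when `(r^m k)' = r^m g`. -/
theorem hasDerivAt_of_hasDerivAt_flux {m : ℕ} {k : ℝ → 𝕜} {g : 𝕜} {r : ℝ} (hr : 0 < r)
    (h : HasDerivAt (fun r => r ^ m • k r) (r ^ m • g) r) :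
    HasDerivAt k (g - (m / r) • k r) r := by
  have h1 : HasDerivAt (fun r : ℝ => (r ^ m)⁻¹) (-(m * r ^ (m - 1)) / (r ^ m) ^ 2) r :=
    (hasDerivAt_pow m r).inv (pow_ne_zero _ hr.ne')
  have h2 := h1.smul h
  have hev : k =ᶠ[𝓝 r] fun r => (r ^ m)⁻¹ • r ^ m • k r := by
    filter_upwards [Ioi_mem_nhds hr] with y hy
    exact (inv_smul_smul₀ (pow_ne_zero _ (ne_of_gt hy)) _).symm
  refine (h2.congr_of_eventuallyEq hev).congr_deriv ?_
  have hm : (m : ℝ) * r ^ (m - 1) * r = m * r ^ m := by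
    rcases Nat.eq_zero_or_pos m with rfl | hm
    · simp
    · rw [mul_assoc, ← pow_succ, Nat.sub_add_cancel hm]
  have hrm : r ^ m ≠ 0 := pow_ne_zero _ hr.ne'
  rw [inv_smul_smul₀ hrm, smul_smul, sub_eq_add_neg, ← neg_smul]
  congr 2
  rw [div_mul_eq_mul_div, div_eq_iff (pow_ne_zero _ hrm), neg_mul, neg_mul, neg_inj,
    div_mul_eq_mul_div, eq_div_iff hr.ne']
  linear_combination (r ^ m) * hm

theorem exists_tendsto_of_bounded_deriv {f k : ℝ → 𝕜} {B : ℝ} (hB : 0 ≤ B)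
    (hfd : ∀ r, 0 < r → HasDerivAt f (k r) r) (hk : ∀ r, 0 < r → r ≤ 1 → ‖k r‖ ≤ B) :
    ∃ f₀, Tendsto f (𝓝[>] 0) (𝓝 f₀) := by
  have hlip : LipschitzOnWith ⟨B, hB⟩ f (Ioc 0 1) :=
    (convex_Ioc (0 : ℝ) 1).lipschitzOnWith_of_nnnorm_hasDerivWithin_le
      (fun r hr => (hfd r hr.1).hasDerivWithinAt) (fun r hr => hk r hr.1 hr.2)
  have hc : Cauchy (𝓝[>] (0 : ℝ)) := cauchy_nhds.mono nhdsWithin_le_nhds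
  have := hc.map_of_le hlip.uniformContinuousOn (le_principal_iff.2 (Ioc_mem_nhdsGT one_pos))
  exact CompleteSpace.complete this

theorem continuous_ite_le_zero {E : Type*} [TopologicalSpace E] {f : ℝ → E} {f₀ : E}
    (hf : ContinuousOn f (Ioi 0)) (h0 : Tendsto f (𝓝[>] 0) (𝓝 f₀)) :
    Continuous fun r => if r ≤ 0 then f₀ else f r := by
  rw [continuous_iff_continuousAt]
  intro r
  rcases lt_trichotomy r 0 with hr | rfl | hr
  · refine continuousAt_const.congr (f := fun _ => f₀) ?_
    filter_upwards [Iio_mem_nhds hr] with y hy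
    rw [if_pos (le_of_lt hy)]
  · rw [continuousAt_iff_continuous_left'_right']
    constructor
    · refine (continuousWithinAt_const (b := f₀)).congr (fun y hy => ?_) ?_
      · rw [if_pos (le_of_lt hy)]
      · rw [if_pos le_rfl]
    · have : Tendsto (fun r => if r ≤ 0 then f₀ else f r) (𝓝[>] 0) (𝓝 f₀) := by
        refine h0.congr' ?_
        filter_upwards [self_mem_nhdsWithin] with y hy
        rw [if_neg (not_le.2 hy)]
      simpa [ContinuousWithinAt] using this
  · refine ContinuousAt.congr (hf.continuousAt (Ioi_mem_nhds hr)) ?_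
    filter_upwards [Ioi_mem_nhds hr] with y hy
    rw [if_neg (not_le.2 hy)]

/-- The nonlinearity is treated as a linear term whose potential contains |f|^p: singular at the
origin before the bootstrap, small at infinity. -/
theorem norm_profileRHS_le (hd : 2 ≤ d) {p : ℝ} (hp : 0 < p) (w a : ℝ) :
    ∃ A, 0 ≤ A ∧ ∀ (f : ℝ → 𝕜) (r : ℝ), 0 ≤ r →
      ‖profileRHS d p w a f r‖ ≤ (A + |a| * ‖f r‖ ^ p) * ‖f r‖ := by
  obtain ⟨C, hC0, hC⟩ := exists_abs_potential_le d
  refine ⟨|w| + C, by positivity, fun f r hr => ?_⟩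
  rw [profileRHS, norm_smul]
  gcongr
  have hw0 := weight_pos d hp r
  calc ‖w + potential d r - a * (weight d p r * ‖f r‖ ^ p)‖
      ≤ |w| + |potential d r| + |a * (weight d p r * ‖f r‖ ^ p)| :=
        (norm_sub_le _ _).trans (add_le_add (abs_add_le _ _) le_rfl)
    _ ≤ |w| + C + |a| * ‖f r‖ ^ p := by
        gcongr
        · exact hC r hr
        · rw [abs_mul, abs_of_nonneg (by positivity : 0 ≤ weight d p r * ‖f r‖ ^ p)]
          gcongr
          exact mul_le_of_le_one_left (by positivity) (weight_le_one hd hp hr)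

/-- Regularity at the origin of a bounded solution of the profile equation: `f` extends
continuously, `ℓ = f' / r` extends continuously, and `r ℓ'` tends to zero. -/
theorem exists_extension_of_bounded (hd : 2 ≤ d) {p : ℝ} (hp : 0 < p) {w a : ℝ} {f k : ℝ → 𝕜}
    {C : ℝ} (hC : 0 ≤ C)
    (hfd : ∀ r, 0 < r → HasDerivAt f (k r) r)
    (hkd : ∀ r, 0 < r → HasDerivAt (fun r => r ^ (d - 1) • k r)
        (r ^ (d - 1) • profileRHS d p w a f r) r)
    (hk2 : IntegrableOn (fun r : ℝ => r ^ (d - 1) * ‖k r‖ ^ 2) (Ioi 0))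
    (hf : ∀ r, 0 < r → r ≤ 1 → ‖f r‖ ≤ C) :
    ∃ F ℓ M : ℝ → 𝕜, Continuous F ∧ Continuous ℓ ∧ Continuous M ∧ M 0 = 0 ∧
      (∀ r, 0 < r → F r = f r) ∧ (∀ r, 0 < r → HasDerivAt F (r • ℓ r) r) ∧
      (∀ r, 0 < r → HasDerivAt ℓ (r⁻¹ • M r) r) ∧ (∀ r, 0 < r → r • ℓ r = k r) ∧
      ∀ r, 0 < r → M r = profileRHS d p w a f r - (d : ℝ) • ℓ r := by
  obtain ⟨A, hA, hgA⟩ := norm_profileRHS_le (𝕜 := 𝕜) hd hp w a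
  have hd0 : d - 1 + 1 = d := by omega
  have hdR : (0 : ℝ) < d := by exact_mod_cast (by omega : 0 < d)
  have hpowR : ∀ {t : ℝ}, 0 < t → t ^ ((d : ℝ) - 1) = t ^ (d - 1) := fun {t} ht => by
    rw [← Real.rpow_natCast, Nat.cast_sub (by omega), Nat.cast_one]
  set B := (A + |a| * C ^ p) * C with hB
  have hB0 : 0 ≤ B := by positivity
  have hgB : ∀ r, 0 < r → r ≤ 1 → ‖profileRHS d p w a f r‖ ≤ B := fun r hr hr1 => by
    refine (hgA f r hr.le).trans ?_
    rw [hB]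
    gcongr <;> exact hf r hr hr1
  have hsmall : ∀ η > 0, ∀ r > 0, ∃ a, 0 < a ∧ a < r ∧ ‖a ^ (d - 1) • k a‖ < η := by
    intro η hη r hr
    refine exists_norm_lt_of_integrable (P := fun r => r ^ (d - 1) • k r) (m := d - 1)
      (by omega) ?_ hη hr
    refine hk2.congr_fun (fun r hr => ?_) measurableSet_Ioi
    have hr0 : (0 : ℝ) < r := hr
    simp only [norm_smul, norm_pow, Real.norm_of_nonneg hr0.le]
    field_simp
  have hflux : ∀ r, 0 < r → r ≤ 1 → ‖r ^ (d - 1) • k r‖ ≤ B / d * r ^ d := fun r hr hr1 => by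
    have := norm_le_of_norm_deriv_le_rpow (ρ := 1) hdR hB0 (fun t ht _ => hkd t ht)
      (fun t ht ht1 => by
        rw [norm_smul, norm_pow, Real.norm_of_nonneg ht.le, hpowR ht, mul_comm]
        gcongr
        exact hgB t ht ht1) hsmall hr hr1
    rwa [Real.rpow_natCast] at this
  have hkB : ∀ r, 0 < r → r ≤ 1 → ‖k r‖ ≤ B / d := fun r hr hr1 => by
    have h1 := hflux r hr hr1
    rw [norm_smul, norm_pow, Real.norm_of_nonneg hr.le] at h1
    have h2 : r ^ d = r ^ (d - 1) * r := by rw [← pow_succ, hd0]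
    rw [h2, mul_left_comm] at h1
    refine (le_of_mul_le_mul_left h1 (by positivity)).trans ?_
    exact mul_le_of_le_one_right (by positivity) hr1
  obtain ⟨f₀, hf₀⟩ := exists_tendsto_of_bounded_deriv (by positivity) hfd hkB
  have hfc : ContinuousOn f (Ioi 0) := fun r hr => (hfd r hr).continuousAt.continuousWithinAt
  have hkc : ContinuousOn k (Ioi 0) := fun r hr =>
    (hasDerivAt_of_hasDerivAt_flux hr (hkd r hr)).continuousAt.continuousWithinAt
  set F : ℝ → 𝕜 := fun r => if r ≤ 0 then f₀ else f r with hF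
  have hFc : Continuous F := continuous_ite_le_zero hfc hf₀
  have hFf : ∀ r, 0 < r → F r = f r := fun r hr => if_neg (not_le.2 hr)
  have hGc : Continuous (profileRHS d p w a F) := by
    rw [← continuousOn_univ] at hFc ⊢
    exact continuousOn_profileRHS d hp w a hFc
  have hGg : ∀ r, 0 < r → profileRHS d p w a F r = profileRHS d p w a f r := fun r hr => by
    simp only [profileRHS, hFf r hr]
  set g₀ := profileRHS d p w a F 0 with hg₀
  -- The flux is the integral of t^(d−1) g(t) from 0, hence g₀ r^d / d up to o(r^d); dividing by r^d
  -- gives the limit. The error is controlled by applying the flux estimate to the difference.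
  have hlim : Tendsto (fun r => r⁻¹ • k r) (𝓝[>] 0) (𝓝 ((d : ℝ)⁻¹ • g₀)) := by
    rw [Metric.tendsto_nhdsWithin_nhds]
    intro ε hε
    obtain ⟨ρ₀, hρ₀, hρ⟩ := Metric.continuous_iff.1 hGc 0 (ε / 2) (by positivity)
    refine ⟨min ρ₀ 1, by positivity, fun {r} hr0 hr => ?_⟩
    have hr0 : 0 < r := hr0
    rw [Real.dist_eq, sub_zero, abs_of_pos hr0] at hr
    have hrρ : r < ρ₀ := hr.trans_le (min_le_left _ _)
    have hderiv : ∀ t, 0 < t → t ≤ r → HasDerivAt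
        (fun t => t ^ (d - 1) • k t - (t ^ d * (d : ℝ)⁻¹) • g₀)
        (t ^ (d - 1) • (profileRHS d p w a f t - g₀)) t := by
      intro t ht _
      have h1 : HasDerivAt (fun t : ℝ => t ^ d * (d : ℝ)⁻¹) (t ^ (d - 1)) t := by
        refine ((hasDerivAt_pow d t).mul_const _).congr_deriv ?_
        field_simp
      rw [smul_sub]
      exact (hkd t ht).sub (h1.smul_const g₀)
    have hzero : Tendsto (fun t => t ^ (d - 1) • k t - (t ^ d * (d : ℝ)⁻¹) • g₀) (𝓝[>] 0)
        (𝓝 0) := by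
      have h0 : Tendsto (fun t : ℝ => t ^ d) (𝓝[>] 0) (𝓝 0) := by
        have := ((continuous_pow d).tendsto (0 : ℝ)).mono_left
          (nhdsWithin_le_nhds (s := Ioi (0 : ℝ)))
        rwa [zero_pow (by omega)] at this
      have h1 : Tendsto (fun t => t ^ (d - 1) • k t) (𝓝[>] 0) (𝓝 0) := by
        refine squeeze_zero_norm' (a := fun t => B / d * t ^ d) ?_ ?_
        · filter_upwards [Ioc_mem_nhdsGT one_pos] with t ht using hflux t ht.1 ht.2
        · simpa using h0.const_mul (B / d)
      have h2 : Tendsto (fun t : ℝ => (t ^ d * (d : ℝ)⁻¹) • g₀) (𝓝[>] 0) (𝓝 0) := by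
        simpa using (h0.mul_const ((d : ℝ)⁻¹)).smul_const g₀
      simpa using h1.sub h2
    have hbd := norm_le_of_norm_deriv_le_rpow (ρ := r) (C := ε / 2) hdR (by positivity) hderiv
      (fun t ht htr => by
        rw [norm_smul, norm_pow, Real.norm_of_nonneg ht.le, hpowR ht, mul_comm]
        gcongr
        rw [← hGg t ht, ← dist_eq_norm]
        refine (hρ t ?_).le
        rw [Real.dist_eq, sub_zero, abs_of_pos ht]
        exact htr.trans_lt hrρ) (fun η hη s hs => exists_norm_lt_of_tendsto hzero hη hs) hr0 le_rfl
    rw [Real.rpow_natCast] at hbd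
    have heq : r⁻¹ • k r - (d : ℝ)⁻¹ • g₀
        = (r ^ d)⁻¹ • (r ^ (d - 1) • k r - (r ^ d * (d : ℝ)⁻¹) • g₀) := by
      have h2 : r ^ d = r ^ (d - 1) * r := by rw [← pow_succ, hd0]
      have h3 : r ^ (d - 1) ≠ 0 := by positivity
      rw [smul_sub, smul_smul, smul_smul]
      congr 2
      · rw [h2]; field_simp
      · rw [inv_mul_cancel_left₀ (by positivity)]
    rw [dist_eq_norm, heq, norm_smul, norm_inv, norm_pow, Real.norm_of_nonneg hr0.le]
    calc (r ^ d)⁻¹ * _ ≤ (r ^ d)⁻¹ * (ε / 2 / d * r ^ d) := by gcongr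
      _ = ε / 2 / d := by field_simp
      _ ≤ ε / 2 := div_le_self (by positivity) (by exact_mod_cast (by omega : 1 ≤ d))
      _ < ε := by linarith
  have hℓc : ContinuousOn (fun r => r⁻¹ • k r) (Ioi 0) :=
    (continuousOn_inv₀.mono fun r hr => ne_of_gt hr).smul hkc
  set ℓ : ℝ → 𝕜 := fun r => if r ≤ 0 then (d : ℝ)⁻¹ • g₀ else r⁻¹ • k r with hℓ
  have hℓcont : Continuous ℓ := continuous_ite_le_zero hℓc hlim
  have hℓk : ∀ r, 0 < r → ℓ r = r⁻¹ • k r := fun r hr => if_neg (not_le.2 hr)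
  -- M is r ℓ': from ℓ = k/r and k' = g − ((d−1)/r) k one gets r ℓ' = g − d ℓ. It vanishes at 0
  -- because ℓ(0) = g₀/d.
  refine ⟨F, ℓ, fun r => profileRHS d p w a F r - (d : ℝ) • ℓ r, hFc, hℓcont,
    hGc.sub (hℓcont.const_smul _), ?_, hFf, fun r hr => ?_, fun r hr => ?_, fun r hr => ?_,
    fun r hr => ?_⟩
  · have : ℓ 0 = (d : ℝ)⁻¹ • g₀ := if_pos le_rfl
    simp only [this, ← hg₀]
    rw [smul_inv_smul₀ hdR.ne', sub_self]
  · rw [hℓk r hr, smul_inv_smul₀ hr.ne']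
    refine (hfd r hr).congr_of_eventuallyEq ?_
    filter_upwards [Ioi_mem_nhds hr] with y hy using hFf y hy
  · have h1 := (hasDerivAt_inv hr.ne').smul (hasDerivAt_of_hasDerivAt_flux hr (hkd r hr))
    have hev : ℓ =ᶠ[𝓝 r] fun r => r⁻¹ • k r := by
      filter_upwards [Ioi_mem_nhds hr] with y hy using hℓk y hy
    refine (h1.congr_of_eventuallyEq hev).congr_deriv ?_
    simp only
    rw [hGg r hr, hℓk r hr, Nat.cast_sub (by omega), Nat.cast_one]
    match_scalars
    · field_simp
    · field_simp
      ring
  · rw [hℓk r hr, smul_inv_smul₀ hr.ne']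
  · simp only [hGg r hr]

end Origin

/-! ### Derivatives of radial functions -/

section RadialSmooth

variable {𝕜 : Type*} [RCLike 𝕜] {X : Type*} [NormedAddCommGroup X] [InnerProductSpace ℝ X]

/-- The bilinear map `(x, z) ↦ ⟪x, ·⟫ z`. -/
def innerSmulRight (X 𝕜 : Type*) [RCLike 𝕜] [NormedAddCommGroup X] [InnerProductSpace ℝ X] :
    X →L[ℝ] 𝕜 →L[ℝ] X →L[ℝ] 𝕜 :=
  (ContinuousLinearMap.smulRightL ℝ X 𝕜).comp (innerSL ℝ)

theorem innerSmulRight_apply (x y : X) (z : 𝕜) :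
    innerSmulRight X 𝕜 x z y = (inner ℝ x y : ℝ) • z := rfl

theorem norm_innerSmulRight_apply (x : X) (z : 𝕜) :
    ‖innerSmulRight X 𝕜 x z‖ = ‖x‖ * ‖z‖ := by
  have : innerSmulRight X 𝕜 x z = (innerSL ℝ x).smulRight z := rfl
  rw [this, ContinuousLinearMap.norm_smulRight_apply, innerSL_apply_norm]

variable {F ℓ M : ℝ → 𝕜}

/-- Writing F' = r ℓ cancels the 1/|x| in the derivative of the norm, so the gradient is ℓ(|x|) x.
At the origin the one-sided derivative of F is 0, being the limit of r ℓ(r). -/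
theorem hasFDerivAt_radial (hF : Continuous F) (hℓ : Continuous ℓ)
    (hFd : ∀ r, 0 < r → HasDerivAt F (r • ℓ r) r) (x : X) :
    HasFDerivAt (fun x : X => F ‖x‖) (innerSmulRight X 𝕜 x (ℓ ‖x‖)) x := by
  rcases eq_or_ne x 0 with rfl | hx
  · have h1 : HasDerivWithinAt F 0 (Ici 0) 0 := by
      refine hasDerivWithinAt_Ici_of_tendsto_deriv (s := Ioi 0)
        (fun r hr => (hFd r hr).differentiableAt.differentiableWithinAt)
        hF.continuousAt.continuousWithinAt self_mem_nhdsWithin ?_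
      have h2 : Tendsto (fun r : ℝ => r • ℓ r) (𝓝[>] 0) (𝓝 0) := by
        have hc : Continuous fun r : ℝ => r • ℓ r := continuous_id.smul hℓ
        have := (hc.tendsto (0 : ℝ)).mono_left (nhdsWithin_le_nhds (s := Ioi (0 : ℝ)))
        simpa using this
      refine h2.congr' ?_
      filter_upwards [self_mem_nhdsWithin] with r hr using (hFd r hr).deriv.symm
    have h3 : Tendsto (fun x : X => ‖x‖) (𝓝 0) (𝓝[≥] 0) := by
      refine tendsto_nhdsWithin_iff.2 ⟨?_, Eventually.of_forall fun x => norm_nonneg x⟩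
      simpa using (continuous_norm (E := X)).tendsto 0
    have h4 := (hasDerivWithinAt_iff_isLittleO.1 h1).comp_tendsto h3
    simp only [map_zero, norm_zero, zero_apply]
    refine HasFDerivAt.of_isLittleO ?_
    have h5 : (fun x : X => F ‖x‖ - F 0) =o[𝓝 0] fun x : X => ‖x‖ := by
      simpa [Function.comp_def] using h4
    simpa using h5.of_norm_right
  · have h1 := (hFd ‖x‖ (norm_pos_iff.2 hx)).hasFDerivAt.comp x (hasFDerivAt_norm_of_ne_zero hx)
    refine h1.congr_fderiv ?_
    ext y
    have : ‖x‖ ≠ 0 := norm_ne_zero_iff.2 hx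
    simp only [innerSmulRight_apply, ContinuousLinearMap.comp_apply, smul_apply,
      innerSL_apply_apply, smul_eq_mul, ContinuousLinearMap.toSpanSingleton_apply, smul_smul]
    congr 1
    field_simp

/-- The second derivative of `x ↦ F |x|`, where `F' = r ℓ` and `ℓ' = M / r`. -/
def radialHessian (X : Type*) [NormedAddCommGroup X] [InnerProductSpace ℝ X] (ℓ M : ℝ → 𝕜) (x : X) :
    X →L[ℝ] X →L[ℝ] 𝕜 :=
  (innerSmulRight X 𝕜).flip (ℓ ‖x‖) +
    (innerSL ℝ x).smulRight (innerSmulRight X 𝕜 x ((‖x‖ ^ 2)⁻¹ • M ‖x‖))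

theorem norm_radialHessian_remainder_le (M : ℝ → 𝕜) (x : X) :
    ‖(innerSL ℝ x).smulRight (innerSmulRight X 𝕜 x ((‖x‖ ^ 2)⁻¹ • M ‖x‖))‖ ≤ ‖M ‖x‖‖ := by
  rw [ContinuousLinearMap.norm_smulRight_apply, innerSL_apply_norm, norm_innerSmulRight_apply,
    norm_smul, norm_inv, norm_pow, norm_norm]
  rcases eq_or_ne ‖x‖ 0 with h | h
  · rw [h]; simp
  · refine le_of_eq ?_
    field_simp

theorem norm_radialHessian_le (ℓ M : ℝ → 𝕜) (x : X) :
    ‖radialHessian X ℓ M x‖ ≤ ‖ℓ ‖x‖‖ + ‖M ‖x‖‖ := by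
  have h := norm_add_le ((innerSmulRight X 𝕜).flip (ℓ ‖x‖))
    ((innerSL ℝ x).smulRight (innerSmulRight X 𝕜 x ((‖x‖ ^ 2)⁻¹ • M ‖x‖)))
  refine h.trans (add_le_add ?_ (norm_radialHessian_remainder_le M x))
  refine ContinuousLinearMap.opNorm_le_bound _ (norm_nonneg _) fun y => ?_
  rw [ContinuousLinearMap.flip_apply, norm_innerSmulRight_apply, mul_comm]

/-- Away from 0 this is the product rule with ℓ' = M/r. At the origin the increment is ℓ(|y|) y, so
continuity of ℓ suffices. -/
theorem hasFDerivAt_radial_gradient (hℓ : Continuous ℓ)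
    (hℓd : ∀ r, 0 < r → HasDerivAt ℓ (r⁻¹ • M r) r) (x : X) :
    HasFDerivAt (fun x : X => innerSmulRight X 𝕜 x (ℓ ‖x‖)) (radialHessian X ℓ M x) x := by
  rcases eq_or_ne x 0 with rfl | hx
  · refine HasFDerivAt.of_isLittleO ?_
    rw [Asymptotics.isLittleO_iff]
    intro ε hε
    have h1 : Tendsto (fun y : X => ‖ℓ ‖y‖ - ℓ 0‖) (𝓝 0) (𝓝 0) := by
      have := ((hℓ.comp (continuous_norm (E := X))).sub (continuous_const (y := ℓ 0))).norm.tendsto 0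
      simpa using this
    filter_upwards [h1.eventually_lt_const hε] with y hy
    have h2 : innerSmulRight X 𝕜 y (ℓ ‖y‖) - innerSmulRight X 𝕜 (0 : X) (ℓ ‖(0 : X)‖)
        - radialHessian X ℓ M 0 (y - 0) = innerSmulRight X 𝕜 y (ℓ ‖y‖ - ℓ 0) := by
      simp [radialHessian]
    rw [h2, norm_innerSmulRight_apply, sub_zero, mul_comm]
    gcongr
  · have h1 := (hℓd ‖x‖ (norm_pos_iff.2 hx)).hasFDerivAt.comp x (hasFDerivAt_norm_of_ne_zero hx)
    have h2 := (innerSmulRight X 𝕜).hasFDerivAt_of_bilinear (hasFDerivAt_id x) h1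
    refine h2.congr_fderiv ?_
    ext y z
    have : ‖x‖ ≠ 0 := norm_ne_zero_iff.2 hx
    simp [radialHessian, innerSmulRight_apply, smul_smul]
    rw [add_comm]
    congr 2
    field_simp

/-- The rank-one part depends on the direction x/|x|, but its norm is at most ‖M(|x|)‖; M(0) = 0
therefore makes it continuous at the origin. -/
theorem continuous_radialHessian (hℓ : Continuous ℓ) (hM : Continuous M) (hM0 : M 0 = 0) :
    Continuous (radialHessian X ℓ M) := by
  refine ((innerSmulRight X 𝕜).flip.continuous.comp (hℓ.comp continuous_norm)).add ?_
  rw [continuous_iff_continuousAt]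
  intro x
  rcases eq_or_ne x 0 with rfl | hx
  · have h0 : Tendsto (fun x : X => ‖M ‖x‖‖) (𝓝 0) (𝓝 0) := by
      have := ((hM.comp (continuous_norm (E := X))).norm).tendsto 0
      simpa [hM0] using this
    have h1 := squeeze_zero_norm (f := fun x : X =>
      (innerSL ℝ x).smulRight (innerSmulRight X 𝕜 x ((‖x‖ ^ 2)⁻¹ • M ‖x‖))) (fun x : X => norm_radialHessian_remainder_le M x) h0
    unfold ContinuousAt
    simpa using h1
  · have hn : ‖x‖ ^ 2 ≠ 0 := pow_ne_zero _ (norm_ne_zero_iff.2 hx)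
    have h1 : ContinuousAt (fun x : X => (‖x‖ ^ 2)⁻¹ • M ‖x‖) x :=
      ((continuous_norm.pow 2).continuousAt.inv₀ hn).smul
        (hM.comp continuous_norm).continuousAt
    have h2 : ContinuousAt (fun x : X => innerSmulRight X 𝕜 x ((‖x‖ ^ 2)⁻¹ • M ‖x‖)) x :=
      ((innerSmulRight X 𝕜).continuous.continuousAt).clm_apply h1
    exact ((ContinuousLinearMap.smulRightL ℝ X (X →L[ℝ] 𝕜)).continuous.continuousAt.comp
      (innerSL ℝ).continuous.continuousAt).clm_apply h2

theorem contDiff_two_radial (hF : Continuous F) (hℓ : Continuous ℓ) (hM : Continuous M)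
    (hM0 : M 0 = 0) (hFd : ∀ r, 0 < r → HasDerivAt F (r • ℓ r) r)
    (hℓd : ∀ r, 0 < r → HasDerivAt ℓ (r⁻¹ • M r) r) :
    ContDiff ℝ 2 (fun x : X => F ‖x‖) := by
  have h1 : fderiv ℝ (fun x : X => F ‖x‖) = fun x => innerSmulRight X 𝕜 x (ℓ ‖x‖) :=
    funext fun x => (hasFDerivAt_radial hF hℓ hFd x).fderiv
  have h2 : fderiv ℝ (fun x : X => innerSmulRight X 𝕜 x (ℓ ‖x‖)) = radialHessian X ℓ M :=
    funext fun x => (hasFDerivAt_radial_gradient hℓ hℓd x).fderiv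
  rw [show (2 : WithTop ℕ∞) = 1 + 1 from rfl, contDiff_succ_iff_fderiv]
  refine ⟨fun x => (hasFDerivAt_radial hF hℓ hFd x).differentiableAt, by simp, ?_⟩
  rw [h1, contDiff_one_iff_fderiv, h2]
  exact ⟨fun x => (hasFDerivAt_radial_gradient hℓ hℓd x).differentiableAt,
    continuous_radialHessian hℓ hM hM0⟩

theorem norm_iteratedFDeriv_radial_le (hF : Continuous F) (hℓ : Continuous ℓ)
    (hFd : ∀ r, 0 < r → HasDerivAt F (r • ℓ r) r)
    (hℓd : ∀ r, 0 < r → HasDerivAt ℓ (r⁻¹ • M r) r) {j : ℕ} (hj : j ≤ 2) (x : X) :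
    ‖iteratedFDeriv ℝ j (fun x : X => F ‖x‖) x‖
      ≤ ‖F ‖x‖‖ + ‖x‖ * ‖ℓ ‖x‖‖ + (‖ℓ ‖x‖‖ + ‖M ‖x‖‖) := by
  have h1 : fderiv ℝ (fun x : X => F ‖x‖) = fun x => innerSmulRight X 𝕜 x (ℓ ‖x‖) :=
    funext fun x => (hasFDerivAt_radial hF hℓ hFd x).fderiv
  have h2 : fderiv ℝ (fun x : X => innerSmulRight X 𝕜 x (ℓ ‖x‖)) = radialHessian X ℓ M :=
    funext fun x => (hasFDerivAt_radial_gradient hℓ hℓd x).fderiv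
  have e0 := norm_nonneg (F ‖x‖)
  have e1 : 0 ≤ ‖x‖ * ‖ℓ ‖x‖‖ := by positivity
  have e2 : 0 ≤ ‖ℓ ‖x‖‖ + ‖M ‖x‖‖ := by positivity
  interval_cases j
  · rw [norm_iteratedFDeriv_zero]
    linarith
  · rw [← zero_add 1, ← norm_iteratedFDeriv_fderiv, norm_iteratedFDeriv_zero, h1,
      norm_innerSmulRight_apply]
    linarith
  · rw [← one_add_one_eq_two, ← norm_iteratedFDeriv_fderiv, ← zero_add 1,
      ← norm_iteratedFDeriv_fderiv, norm_iteratedFDeriv_zero, h1, h2]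
    have := norm_radialHessian_le ℓ M x
    linarith

end RadialSmooth

/-! ### Maximum principle and comparison with an exponential -/

section MaximumPrinciple

/-- A maximum principle on `[R, ∞)` for `D'' + (m / r) D' ≥ w D`. -/
theorem nonpos_of_deriv2_ge {D D₁ D₂ : ℝ → ℝ} {R w m : ℝ} (hw : 0 < w)
    (hD : ∀ r, R ≤ r → HasDerivAt D (D₁ r) r) (hD₁ : ∀ r, R ≤ r → HasDerivAt D₁ (D₂ r) r)
    (hge : ∀ r, R ≤ r → w * D r - m / r * D₁ r ≤ D₂ r) (hR : D R ≤ 0)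
    (hlim : Tendsto D atTop (𝓝 0)) {r : ℝ} (hr : R ≤ r) : D r ≤ 0 := by
  by_contra! hpos
  -- D is nonpositive at R and below D(r) at T, so its maximum over [R, T] is positive and interior.
  -- There D' = 0 and D'' > 0, so the point is also a local minimum; D is then locally constant,
  -- contradicting D'' > 0.
  obtain ⟨T, hT, hrT⟩ := ((hlim.eventually_lt_const hpos).and (eventually_gt_atTop r)).exists
  have hcont : ContinuousOn D (Icc R T) := fun x hx => (hD x hx.1).continuousAt.continuousWithinAt
  obtain ⟨x, hx, hmax⟩ := isCompact_Icc.exists_isMaxOn ⟨r, hr, hrT.le⟩ hcont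
  have hxr : D r ≤ D x := hmax ⟨hr, hrT.le⟩
  have hRx : R < x := lt_of_le_of_ne hx.1 fun h => by rw [← h] at hxr; linarith
  have hxT : x < T := lt_of_le_of_ne hx.2 fun h => by rw [h] at hxr; linarith
  have hlmax : IsLocalMax D x := by
    filter_upwards [Icc_mem_nhds hRx hxT] with y hy using hmax hy
  have h1 : D₁ x = 0 := hlmax.hasDerivAt_eq_zero (hD x hx.1)
  have h2 : 0 < D₂ x := by
    have := hge x hx.1
    rw [h1] at this
    have : 0 < w * D x := mul_pos hw (hpos.trans_le hxr)
    linarith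
  have hev : deriv D =ᶠ[𝓝 x] D₁ := by
    filter_upwards [Ioi_mem_nhds hRx] with y hy using (hD y (le_of_lt hy)).deriv
  have h3 : deriv (deriv D) x = D₂ x := by rw [hev.deriv_eq, (hD₁ x hx.1).deriv]
  have hlmin : IsLocalMin D x := isLocalMin_of_deriv_deriv_pos (by rw [h3]; exact h2)
    (by rw [(hD x hx.1).deriv, h1]) (hD x hx.1).continuousAt
  have hconst : D =ᶠ[𝓝 x] fun _ => D x := by
    filter_upwards [hlmax, hlmin] with y hy hy' using le_antisymm hy hy'
  have h4 : deriv D =ᶠ[𝓝 x] fun _ => 0 := by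
    have := hconst.deriv
    simpa using this
  have h5 : D₂ x = 0 := by rw [← h3, h4.deriv_eq]; simp
  exact h2.ne' h5

/-- The exponential z satisfies z'' = w z and z' ≤ 0, so z'' + (m/r) z' ≤ w z: it is a
supersolution, and the maximum principle applies to y − z. -/
theorem le_exp_of_deriv2_ge {y y₁ y₂ : ℝ → ℝ} {R w m : ℝ} (hR0 : 0 < R) (hw : 0 < w) (hm : 0 ≤ m)
    (hy : ∀ r, R ≤ r → HasDerivAt y (y₁ r) r) (hy₁ : ∀ r, R ≤ r → HasDerivAt y₁ (y₂ r) r)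
    (hge : ∀ r, R ≤ r → w * y r - m / r * y₁ r ≤ y₂ r)
    (hlim : Tendsto y atTop (𝓝 0)) {r : ℝ} (hr : R ≤ r) :
    y r ≤ |y R| * Real.exp (-√w * (r - R)) := by
  set z : ℝ → ℝ := fun r => |y R| * Real.exp (-√w * (r - R)) with hz
  have hz0 : ∀ r, 0 ≤ z r := fun r => by positivity
  have hzd : ∀ r, HasDerivAt z (-√w * z r) r := fun r => by
    have h1 : HasDerivAt (fun r : ℝ => -√w * (r - R)) (-√w) r := by
      simpa using ((hasDerivAt_id r).sub_const R).const_mul (-√w)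
    refine (h1.exp.const_mul |y R|).congr_deriv ?_
    simp only [hz]
    ring
  have hww : √w * √w = w := Real.mul_self_sqrt hw.le
  have key := nonpos_of_deriv2_ge (D := fun r => y r - z r) (D₁ := fun r => y₁ r - -√w * z r)
    (D₂ := fun r => y₂ r - -√w * (-√w * z r)) (m := m) hw
    (fun r hr => (hy r hr).sub (hzd r)) (fun r hr => (hy₁ r hr).sub ((hzd r).const_mul _))
    (fun r hr => ?_) ?_ ?_ hr
  · exact sub_nonpos.1 key
  · have h1 := hge r hr
    have h2 : 0 ≤ m / r * (√w * z r) := by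
      have := hz0 r
      have : 0 < r := hR0.trans_le hr
      positivity
    have h3 : -√w * (-√w * z r) = w * z r := by
      linear_combination (z r) * hww
    rw [h3]
    linarith
  · simp only [hz, sub_self, mul_zero, Real.exp_zero, mul_one]
    linarith [le_abs_self (y R)]
  · have h1 : Tendsto z atTop (𝓝 0) := by
      have h2 : Tendsto (fun r : ℝ => √w * (r - R)) atTop atTop :=
        (tendsto_atTop_add_const_right _ (-R) tendsto_id).const_mul_atTop (Real.sqrt_pos.2 hw)
      have h3 := (Real.tendsto_exp_neg_atTop_nhds_zero.comp h2).const_mul |y R|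
      simpa [hz, Function.comp_def, neg_mul] using h3
    simpa using hlim.sub h1

end MaximumPrinciple

/-! ### Exponential decay at infinity -/

section Decay

variable {𝕜 : Type*} [RCLike 𝕜] {d : ℕ}

theorem integrableOn_norm_sq_Ioi_one {m : ℕ} {f : ℝ → 𝕜} (hfc : ContinuousOn f (Ioi 0))
    (h2 : IntegrableOn (fun r : ℝ => r ^ m * ‖f r‖ ^ 2) (Ioi 0)) :
    IntegrableOn (fun r => ‖f r‖ ^ 2) (Ioi 1) := by
  refine (h2.mono_set (Ioi_subset_Ioi zero_le_one)).mono'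
    (((hfc.norm.pow 2).mono (Ioi_subset_Ioi zero_le_one)).aestronglyMeasurable
      measurableSet_Ioi) ?_
  filter_upwards [ae_restrict_mem measurableSet_Ioi] with r hr
  rw [Real.norm_of_nonneg (by positivity)]
  exact le_mul_of_one_le_left (by positivity) (one_le_pow₀ (le_of_lt hr))

/-- An `H¹` profile vanishes at infinity. -/
theorem tendsto_norm_sq_profile {m : ℕ} {f k : ℝ → 𝕜} (hfd : ∀ r, 0 < r → HasDerivAt f (k r) r)
    (hkc : ContinuousOn k (Ioi 0))
    (hf2 : IntegrableOn (fun r : ℝ => r ^ m * ‖f r‖ ^ 2) (Ioi 0))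
    (hk2 : IntegrableOn (fun r : ℝ => r ^ m * ‖k r‖ ^ 2) (Ioi 0)) :
    Tendsto (fun r => ‖f r‖ ^ 2) atTop (𝓝 0) := by
  have hfc : ContinuousOn f (Ioi 0) := fun r hr => (hfd r hr).continuousAt.continuousWithinAt
  have hf1 := integrableOn_norm_sq_Ioi_one hfc hf2
  have hk1 := integrableOn_norm_sq_Ioi_one hkc hk2
  -- Both ‖f‖² and its derivative 2⟪f, k⟫ are integrable near infinity.
  refine tendsto_zero_of_hasDerivAt_of_integrableOn_Ioi (a := 1)
    (f' := fun r => 2 * inner ℝ (f r) (k r))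
    (fun r hr => (hfd r (one_pos.trans hr)).norm_sq) ?_ hf1
  refine (hf1.add hk1).mono' ((continuousOn_const.mul (hfc.inner hkc)).mono
    (Ioi_subset_Ioi zero_le_one) |>.aestronglyMeasurable measurableSet_Ioi) (ae_of_all _ fun r => ?_)
  rw [norm_mul, Real.norm_of_nonneg zero_le_two, Real.norm_eq_abs]
  have := abs_real_inner_le_norm (f r) (k r)
  simp only [Pi.add_apply]
  nlinarith [sq_nonneg (‖f r‖ - ‖k r‖)]

/-- Exponential decay passes from a solution of `(r^m k)' = r^m g`, `f' = k` to `k`. -/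
theorem norm_deriv_le_exp {m : ℕ} {f k g : ℝ → 𝕜} {A C δ R : ℝ} (hR : 1 ≤ R) (hδ : 0 ≤ δ)
    (hA : 0 ≤ A) (hC : 0 ≤ C) (hfd : ∀ r, 0 < r → HasDerivAt f (k r) r)
    (hkd : ∀ r, 0 < r → HasDerivAt (fun r => r ^ m • k r) (r ^ m • g r) r)
    (hf : ∀ r, R ≤ r → ‖f r‖ ≤ C * Real.exp (-δ * r)) (hg : ∀ r, R ≤ r → ‖g r‖ ≤ A * ‖f r‖)
    {r : ℝ} (hr : R ≤ r) :
    ‖k r‖ ≤ 2 ^ m * (2 + m + A) * C * Real.exp (-δ * r) := by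
  have hr1 : 1 ≤ r := hR.trans hr
  have hr0 : 0 < r := by linarith
  set e := C * Real.exp (-δ * r) with he
  have he0 : 0 ≤ e := by positivity
  set q := (r + 1) ^ m with hq
  have hq0 : 0 ≤ q := by positivity
  have hfe : ∀ t ∈ Icc r (r + 1), ‖f t‖ ≤ e := fun t ht => by
    refine (hf t (hr.trans ht.1)).trans ?_
    rw [he]
    gcongr ?_ * Real.exp ?_
    nlinarith [ht.1]
  have hpow : ∀ t ∈ Icc r (r + 1), t ^ m ≤ q := fun t ht =>
    pow_le_pow_left₀ (hr0.le.trans ht.1) ht.2 _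
  have hP : ∀ t ∈ Icc r (r + 1), ‖t ^ m • k t - r ^ m • k r‖ ≤ q * (A * e) := by
    intro t ht
    have h1 := (convex_Icc r (r + 1)).norm_image_sub_le_of_norm_hasDerivWithin_le
      (f := fun r => r ^ m • k r) (f' := fun r => r ^ m • g r) (C := q * (A * e))
      (fun s hs => (hkd s (hr0.trans_le hs.1)).hasDerivWithinAt) (fun s hs => by
        have hs0 : 0 < s := hr0.trans_le hs.1
        rw [norm_smul, norm_pow, Real.norm_of_nonneg hs0.le]
        gcongr
        · exact hpow s hs
        · exact (hg s (hr.trans hs.1)).trans (by gcongr; exact hfe s hs))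
      (left_mem_Icc.2 (by linarith)) ht
    refine h1.trans (mul_le_of_le_one_right (by positivity) ?_)
    rw [Real.norm_of_nonneg (by linarith [ht.1])]
    linarith [ht.2]
  -- Subtracting (s − r) times the flux at r leaves a function with small derivative, because the
  -- flux varies little over [r, r + 1]. Its increment over this interval expresses the flux at r
  -- through two values of f and errors of size e.
  have hφ := (convex_Icc r (r + 1)).norm_image_sub_le_of_norm_hasDerivWithin_le
    (f := fun s => s ^ m • f s - (s - r) • r ^ m • k r)
    (f' := fun s => (s ^ m • k s + (m * s ^ (m - 1) : ℝ) • f s) - (1 : ℝ) • r ^ m • k r)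
    (C := q * (A * e) + m * q * e)
    (fun s hs => (((hasDerivAt_pow m s).smul (hfd s (hr0.trans_le hs.1))).sub
      (((hasDerivAt_id s).sub_const r).smul_const _)).hasDerivWithinAt) (fun s hs => by
      have hs1 : 1 ≤ s := hr1.trans hs.1
      have h1 : (s ^ m • k s + (m * s ^ (m - 1) : ℝ) • f s) - (1 : ℝ) • r ^ m • k r
        = (s ^ m • k s - r ^ m • k r) + (m * s ^ (m - 1) : ℝ) • f s := by
        rw [one_smul]; abel
      rw [h1]
      refine (norm_add_le _ _).trans (add_le_add (hP s hs) ?_)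
      rw [norm_smul, Real.norm_of_nonneg (by positivity)]
      gcongr
      · exact (pow_le_pow_right₀ hs1 (Nat.sub_le _ _)).trans (hpow s hs)
      · exact hfe s hs)
    (left_mem_Icc.2 (by linarith)) (right_mem_Icc.2 (by linarith : r ≤ r + 1))
  have hφ' : ‖((r + 1) ^ m • f (r + 1) - r ^ m • k r) - r ^ m • f r‖
      ≤ q * (A * e) + m * q * e := by
    simpa using hφ
  have hb1 : ‖(r + 1) ^ m • f (r + 1)‖ ≤ q * e := by
    rw [norm_smul, norm_pow, Real.norm_of_nonneg (by linarith)]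
    gcongr
    exact hfe _ (right_mem_Icc.2 (by linarith))
  have hb2 : ‖r ^ m • f r‖ ≤ q * e := by
    rw [norm_smul, norm_pow, Real.norm_of_nonneg hr0.le]
    gcongr
    · exact hpow r (left_mem_Icc.2 (by linarith))
    · exact hfe _ (left_mem_Icc.2 (by linarith))
  have hPr : ‖r ^ m • k r‖ ≤ q * ((2 + m + A) * e) := by
    have h1 : r ^ m • k r = (r + 1) ^ m • f (r + 1) - r ^ m • f r
        - (((r + 1) ^ m • f (r + 1) - r ^ m • k r) - r ^ m • f r) := by abel
    calc ‖r ^ m • k r‖ ≤ ‖(r + 1) ^ m • f (r + 1)‖ + ‖r ^ m • f r‖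
          + ‖((r + 1) ^ m • f (r + 1) - r ^ m • k r) - r ^ m • f r‖ := by
          conv_lhs => rw [h1]
          exact (norm_sub_le _ _).trans (add_le_add (norm_sub_le _ _) le_rfl)
      _ ≤ q * e + q * e + (q * (A * e) + m * q * e) := by gcongr
      _ = _ := by ring
  -- Since r ≥ 1, (r + 1)^m ≤ (2r)^m, so the polynomial weight cancels.
  have hq2 : q ≤ r ^ m * 2 ^ m := by
    rw [← mul_pow]
    exact pow_le_pow_left₀ (by linarith) (by linarith) _
  rw [norm_smul, norm_pow, Real.norm_of_nonneg hr0.le] at hPr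
  have h2 : r ^ m * ‖k r‖ ≤ r ^ m * (2 ^ m * ((2 + m + A) * e)) := by
    refine hPr.trans ?_
    rw [← mul_assoc (r ^ m)]
    exact mul_le_mul_of_nonneg_right hq2 (by positivity)
  refine (le_of_mul_le_mul_left h2 (by positivity)).trans (le_of_eq ?_)
  rw [he]
  ring

/-- Exponential decay of a decaying solution of the profile equation. -/
theorem exists_profile_decay (hd : 2 ≤ d) {p : ℝ} (hp : 0 < p) {w a : ℝ} (hw : 0 < w)
    {f k : ℝ → 𝕜} (hfd : ∀ r, 0 < r → HasDerivAt f (k r) r)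
    (hkd : ∀ r, 0 < r → HasDerivAt (fun r => r ^ (d - 1) • k r)
        (r ^ (d - 1) • profileRHS d p w a f r) r)
    (hf2 : IntegrableOn (fun r : ℝ => r ^ (d - 1) * ‖f r‖ ^ 2) (Ioi 0))
    (hk2 : IntegrableOn (fun r : ℝ => r ^ (d - 1) * ‖k r‖ ^ 2) (Ioi 0)) :
    ∃ C δ R, 0 ≤ C ∧ 0 < δ ∧ 1 ≤ R ∧ ∀ r, R ≤ r → ‖f r‖ ≤ C * Real.exp (-δ * r) ∧
      ‖k r‖ ≤ C * Real.exp (-δ * r) ∧ ‖profileRHS d p w a f r‖ ≤ C * Real.exp (-δ * r) := by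
  have hk' : ∀ r, 0 < r → HasDerivAt k
      (profileRHS d p w a f r - (((d - 1 : ℕ) : ℝ) / r) • k r) r := fun r hr =>
    hasDerivAt_of_hasDerivAt_flux hr (hkd r hr)
  have hkc : ContinuousOn k (Ioi 0) := fun r hr => (hk' r hr).continuousAt.continuousWithinAt
  have hy0 := tendsto_norm_sq_profile hfd hkc hf2 hk2
  have hn0 : Tendsto (fun r => ‖f r‖) atTop (𝓝 0) := by
    have := hy0.sqrt
    simpa using this
  have hnp : Tendsto (fun r => |a| * ‖f r‖ ^ p) atTop (𝓝 0) := by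
    have := (hn0.rpow_const (Or.inr hp.le)).const_mul |a|
    rwa [Real.zero_rpow hp.ne', mul_zero] at this
  obtain ⟨A, hA, hgA⟩ := norm_profileRHS_le (𝕜 := 𝕜) hd hp w a
  -- The two quarters leave w + V − aK|f|^p ≥ w/2, whatever the signs of V and a.
  have hev : ∀ᶠ r in atTop, |potential d r| < w / 4 ∧ |a| * ‖f r‖ ^ p < w / 4 ∧ 1 ≤ r := by
    have hV := (tendsto_potential_atTop d).norm.eventually_lt_const
      (show ‖(0 : ℝ)‖ < w / 4 by rw [norm_zero]; positivity)
    exact hV.and ((hnp.eventually_lt_const (by positivity)).and (eventually_ge_atTop 1))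
  obtain ⟨R, hR⟩ := eventually_atTop.1 hev
  set R' := max R 1 with hR'
  have hRR : ∀ r, R' ≤ r → R ≤ r := fun r hr => (le_max_left _ _).trans hr
  have hR1 : 1 ≤ R' := le_max_right _ _
  have hpos : ∀ r, R' ≤ r → 0 < r := fun r hr => by linarith
  set Y := |‖f R'‖ ^ 2| with hY
  -- Passing to y = |f|² makes a scalar maximum principle applicable to complex f: y'' + ((d−1)/r)
  -- y' = 2⟪f, g⟫ + 2|f'|² ≥ w y. The square root then gives the rate √w / 2.
  have hydecay : ∀ r, R' ≤ r → ‖f r‖ ^ 2 ≤ Y * Real.exp (-√w * (r - R')) := by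
    intro r hr
    refine le_exp_of_deriv2_ge (y := fun r => ‖f r‖ ^ 2) (y₁ := fun r => 2 * inner ℝ (f r) (k r))
      (y₂ := fun r => 2 * (inner ℝ (f r) (profileRHS d p w a f r - (((d - 1 : ℕ) : ℝ) / r) • k r)
        + inner ℝ (k r) (k r))) (m := ((d - 1 : ℕ) : ℝ)) (by linarith) hw (Nat.cast_nonneg _)
      (fun r hr => (hfd r (hpos r hr)).norm_sq)
      (fun r hr => ((hfd r (hpos r hr)).inner ℝ (hk' r (hpos r hr))).const_mul 2)
      (fun r hr => ?_) hy0 hr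
    obtain ⟨h1, h2, -⟩ := hR r (hRR r hr)
    rw [inner_sub_right, inner_smul_right, profileRHS, inner_smul_right,
      real_inner_self_eq_norm_sq, real_inner_self_eq_norm_sq]
    have h3 : |a * (weight d p r * ‖f r‖ ^ p)| ≤ |a| * ‖f r‖ ^ p := by
      have hw0 := weight_pos d hp r
      rw [abs_mul, abs_of_nonneg (by positivity : 0 ≤ weight d p r * ‖f r‖ ^ p)]
      gcongr
      exact mul_le_of_le_one_left (by positivity) (weight_le_one hd hp (hpos r hr).le)
    have h4 := neg_abs_le (potential d r)
    have h5 := le_abs_self (a * (weight d p r * ‖f r‖ ^ p))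
    have h6 : w / 2 ≤ w + potential d r - a * (weight d p r * ‖f r‖ ^ p) := by linarith
    nlinarith [mul_le_mul_of_nonneg_right h6 (sq_nonneg ‖f r‖), sq_nonneg ‖k r‖]
  set δ := √w / 2 with hδ
  have hδ0 : 0 < δ := by have := Real.sqrt_pos.2 hw; positivity
  set C := ‖f R'‖ * Real.exp (δ * R') with hC
  have hC0 : 0 ≤ C := by positivity
  have hfdecay : ∀ r, R' ≤ r → ‖f r‖ ≤ C * Real.exp (-δ * r) := by
    intro r hr
    have h1 := hydecay r hr
    refine (pow_le_pow_iff_left₀ (norm_nonneg _) (by positivity) two_ne_zero).1 ?_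
    refine h1.trans (le_of_eq ?_)
    rw [hY, abs_of_nonneg (by positivity), hC, mul_pow, mul_pow, ← Real.exp_nat_mul,
      ← Real.exp_nat_mul, mul_assoc, ← Real.exp_add, hδ]
    congr 2
    push_cast
    ring
  set A' := A + w / 4 with hA'
  have hA'0 : 0 ≤ A' := by positivity
  have hgdecay : ∀ r, R' ≤ r → ‖profileRHS d p w a f r‖ ≤ A' * ‖f r‖ := by
    intro r hr
    refine (hgA f r (hpos r hr).le).trans ?_
    gcongr
    linarith [(hR r (hRR r hr)).2.1]
  set C' := C + 2 ^ (d - 1) * (2 + ((d - 1 : ℕ) : ℝ) + A') * C + A' * C with hC'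
  have hc1 : 0 ≤ 2 ^ (d - 1) * (2 + ((d - 1 : ℕ) : ℝ) + A') * C := by positivity
  have hc2 : 0 ≤ A' * C := by positivity
  refine ⟨C', δ, R', by positivity, hδ0, hR1, fun r hr => ⟨?_, ?_, ?_⟩⟩
  · refine (hfdecay r hr).trans ?_
    gcongr
    linarith
  · refine (norm_deriv_le_exp hR1 hδ0.le hA'0 hC0 hfd hkd hfdecay hgdecay hr).trans ?_
    gcongr
    linarith
  · refine (hgdecay r hr).trans ?_
    calc A' * ‖f r‖ ≤ A' * (C * Real.exp (-δ * r)) := by gcongr; exact hfdecay r hr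
      _ = A' * C * Real.exp (-δ * r) := by ring
      _ ≤ _ := by gcongr; linarith

end Decay

/-! ### Integrability of u, and assembly of the result -/

section Regularity

variable {𝕜 : Type*} [RCLike 𝕜] {d : ℕ}

/-- Radial `H¹` functions lie in `L^{p+2}` for energy-subcritical `p`. -/
theorem integrable_rpow_of_radial (hd : 2 ≤ d) {p : ℝ} (hp : 0 < p)
    (hp_sub : 3 ≤ d → p < 4 / ((d : ℝ) - 2)) {u : Space d → 𝕜}
    (hsym : IsSphericallySymmetric u) {G : Fin d → Space d → 𝕜} (hu : MemH1WithGradient u G) :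
    Integrable fun x => ‖u x‖ ^ (p + 2) := by
  have : NeZero d := ⟨by omega⟩
  have hm : ((d - 1 : ℕ) : ℝ) = d - 1 := by push_cast [Nat.cast_sub (by omega : 1 ≤ d)]; ring
  obtain ⟨f, h, c, huf, hh, hf, hf2, hh2, -⟩ := exists_radial_profile hu hsym
  obtain ⟨β, η, hη, hβ0, hβ, hpβ⟩ := exists_admissible_exponent hd hp hp_sub
  obtain ⟨C₁, hC₁, h1⟩ := exists_norm_profile_le_rpow hh hf hh2 hβ0 (by rw [hm]; linarith)
  obtain ⟨C₂, -, h2⟩ := exists_norm_profile_le hh hf hf2 hh2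
  have hi := integrableOn_pow_mul_rpow (continuousOn_profile hh hf) hf2 hp
    (by rw [hm]; linarith : (p + 2) * β < ((d - 1 : ℕ) : ℝ) + 1) hC₁ h1 h2
  have hi' : Integrable fun x : Space d => ‖f ‖x‖‖ ^ (p + 2) :=
    (integrable_comp_norm_iff (f := fun r => ‖f r‖ ^ (p + 2))).2 hi
  refine hi'.congr ?_
  filter_upwards [huf] with x hx
  rw [hx]

/-- A continuous function with exponential decay on a neighbourhood of infinity is dominated by a
decaying exponential on the half-line. -/
theorem exists_le_mul_exp {φ : ℝ → ℝ} (hφ : Continuous φ) {C δ R : ℝ} (hC : 0 ≤ C)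
    (hδ : 0 < δ) (h : ∀ r, R ≤ r → φ r ≤ C * Real.exp (-δ * r)) :
    ∃ C' > 0, ∀ r, 0 ≤ r → φ r ≤ C' * Real.exp (-δ * r) := by
  obtain ⟨B, hB⟩ := (isCompact_Icc (a := (0 : ℝ)) (b := R)).exists_bound_of_continuousOn
    hφ.continuousOn
  refine ⟨C + |B| * Real.exp (δ * R) + 1, by positivity, fun r hr => ?_⟩
  have e := Real.exp_pos (-δ * r)
  rcases le_total R r with hRr | hRr
  · refine (h r hRr).trans ?_
    gcongr
    have : 0 ≤ |B| * Real.exp (δ * R) := by positivity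
    linarith
  · calc φ r ≤ |B| := (le_abs_self _).trans ((hB r ⟨hr, hRr⟩).trans (le_abs_self _))
      _ ≤ |B| * Real.exp (δ * R) * Real.exp (-δ * r) := by
        rw [mul_assoc, ← Real.exp_add]
        exact le_mul_of_one_le_right (abs_nonneg _) (Real.one_le_exp (by nlinarith))
      _ ≤ _ := by gcongr; linarith

/-- A radial solution of the profile equation in `H¹` is bounded near the origin. -/
theorem profile_bounded_of_subcritical (hd : 2 ≤ d) {p : ℝ} (hp : 0 < p)
    (hp_sub : 3 ≤ d → p < 4 / ((d : ℝ) - 2)) {w a : ℝ} {f h k : ℝ → 𝕜} {c : 𝕜}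
    (hh : LocallyIntegrableOn h (Ioi 0)) (hf : ∀ r, f r = c + ∫ t in (1 : ℝ)..r, h t)
    (hh2 : IntegrableOn (fun r : ℝ => r ^ (d - 1) * ‖h r‖ ^ 2) (Ioi 0))
    (hfd : ∀ r, 0 < r → HasDerivAt f (k r) r)
    (hkd : ∀ r, 0 < r → HasDerivAt (fun r => r ^ (d - 1) • k r)
        (r ^ (d - 1) • profileRHS d p w a f r) r)
    (hk2 : IntegrableOn (fun r : ℝ => r ^ (d - 1) * ‖k r‖ ^ 2) (Ioi 0)) :
    ∃ C, 0 ≤ C ∧ ∀ r, 0 < r → r ≤ 1 → ‖f r‖ ≤ C := by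
  have hd' : (2 : ℝ) ≤ d := by exact_mod_cast hd
  have hm : ((d - 1 : ℕ) : ℝ) = d - 1 := by push_cast [Nat.cast_sub (by omega : 1 ≤ d)]; ring
  obtain ⟨β, η, hη, hβ0, hβ, hpβ⟩ := exists_admissible_exponent hd hp hp_sub
  obtain ⟨C₁, hC₁, h1⟩ := exists_norm_profile_le_rpow hh hf hh2 hβ0 (by rw [hm]; linarith)
  obtain ⟨A, hA, hgA⟩ := norm_profileRHS_le (𝕜 := 𝕜) hd hp w a
  -- By the a priori bound |f|^p = O(r^(−pβ)), so g is f times a potential of order r^(−s) with s =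
  -- pβ < 2.
  refine profile_bounded_near_zero (A := A + |a| * C₁ ^ p) (s := p * β) (by omega) hfd hkd hk2
    (by positivity) hC₁ (fun r hr hr1 => ?_) (by linarith) hβ0 ?_ h1
  · refine (hgA f r hr.le).trans ?_
    gcongr
    have h2 : ‖f r‖ ^ p ≤ C₁ ^ p * r ^ (-(p * β)) := by
      refine (Real.rpow_le_rpow (norm_nonneg _) (h1 r hr hr1) hp.le).trans (le_of_eq ?_)
      rw [Real.mul_rpow hC₁ (by positivity), ← Real.rpow_mul hr.le]
      ring_nf
    have h3 : 1 ≤ r ^ (-(p * β)) :=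
      Real.one_le_rpow_of_pos_of_le_one_of_nonpos hr hr1 (by nlinarith)
    calc A + |a| * ‖f r‖ ^ p ≤ A * r ^ (-(p * β)) + |a| * (C₁ ^ p * r ^ (-(p * β))) := by
          gcongr
          exact le_mul_of_one_le_right hA h3
      _ = _ := by ring
  · rw [hm]
    nlinarith

/-- Regularity and exponential decay of spherically symmetric minimizers. -/
theorem exists_contDiff_two_exp_decay (hd : 2 ≤ d) {p : ℝ} (hp : 0 < p)
    (hp_sub : 3 ≤ d → p < 4 / ((d : ℝ) - 2)) {Λ : ℝ} (hΛ : -(((d : ℝ) - 1) / 2) ^ 2 < Λ)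
    {lam : ℝ} (hlam : 0 < lam) {u : Space d → 𝕜} (hsym : IsSphericallySymmetric u)
    (hmin : IsMinimizerI d p lam u ∨ IsMinimizerJ d p Λ lam u) :
    ∃ v : Space d → 𝕜, u =ᵐ[volume] v ∧ ContDiff ℝ 2 v ∧
      ∃ C > 0, ∃ δ > 0, ∀ j : ℕ, j ≤ 2 → ∀ x : Space d,
        ‖iteratedFDeriv ℝ j v x‖ ≤ C * Real.exp (-δ * ‖x‖) := by
  have : NeZero d := ⟨by omega⟩
  have hup := fun G hu => integrable_rpow_of_radial hd hp hp_sub hsym (G := G) hu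
  obtain ⟨G, w, a, hu, hw, hEL⟩ := exists_eulerLagrange hd hp hΛ hlam hmin hup
  obtain ⟨f, h, c, huf, hh, hf, hf2, hh2, hrep⟩ := exists_radial_profile hu hsym
  obtain ⟨k, hfd, hkd, hk2⟩ := exists_profile_deriv hp hh hf hh2
    fun ψ hψ => integral_profile_eq hp hu (hup G hu) hEL huf hrep hψ
  obtain ⟨C₀, hC₀, hf0⟩ := profile_bounded_of_subcritical hd hp hp_sub hh hf hh2 hfd hkd hk2
  obtain ⟨F, ℓ, M, hF, hℓ, hM, hM0, hFf, hFd, hℓd, hℓk, hMg⟩ :=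
    exists_extension_of_bounded hd hp hC₀ hfd hkd hk2 hf0
  obtain ⟨C, δ, R, hC, hδ, hR, hdec⟩ := exists_profile_decay hd hp hw hfd hkd hf2 hk2
  have hφ : Continuous fun r : ℝ => ‖F r‖ + r * ‖ℓ r‖ + (‖ℓ r‖ + ‖M r‖) := by fun_prop
  -- Count of the constant: ‖F‖, r‖ℓ‖ = ‖k‖ and ‖ℓ‖ ≤ ‖k‖ contribute one C each, and M = g − dℓ
  -- contributes 1 + d.
  obtain ⟨C', hC', hle⟩ := exists_le_mul_exp hφ (C := (4 + d) * C) (R := R) (by positivity) hδ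
    fun r hr => by
      have hr1 : 1 ≤ r := hR.trans hr
      have hr0 : 0 < r := by linarith
      obtain ⟨h1, h2, h3⟩ := hdec r hr
      have h4 : r * ‖ℓ r‖ = ‖k r‖ := by
        rw [← hℓk r hr0, norm_smul, Real.norm_of_nonneg hr0.le]
      have h5 : ‖ℓ r‖ ≤ ‖k r‖ := h4 ▸ le_mul_of_one_le_left (norm_nonneg _) hr1
      have h6 : ‖M r‖ ≤ ‖profileRHS d p w a f r‖ + d * ‖ℓ r‖ := by
        rw [hMg r hr0]
        refine (norm_sub_le _ _).trans (le_of_eq ?_)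
        rw [norm_smul, Real.norm_of_nonneg (Nat.cast_nonneg _)]
      have h7 : (d : ℝ) * ‖ℓ r‖ ≤ d * (C * Real.exp (-δ * r)) := by
        gcongr
        exact h5.trans h2
      rw [h4, hFf r hr0]
      linarith
  refine ⟨fun x => F ‖x‖, ?_, contDiff_two_radial hF hℓ hM hM0 hFd hℓd, C', hC', δ, hδ,
    fun j hj x => (norm_iteratedFDeriv_radial_le hF hℓ hFd hℓd hj x).trans
      (hle ‖x‖ (norm_nonneg x))⟩
  filter_upwards [huf, compl_mem_ae_iff.2 (measure_singleton (0 : Space d))] with x hx hx0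
  rw [hx, hFf _ (norm_pos_iff.2 hx0)]

end Regularity

end HypSoliton

end

theorem mainTheorem6 {𝕜 : Type*} [RCLike 𝕜] (d : ℕ) (hd : 2 ≤ d)
    (p : ℝ) (hp : 0 < p) (hp_sub : 3 ≤ d → p < 4 / ((d : ℝ) - 2))
    (Λ : ℝ) (hΛ : -(((d : ℝ) - 1) / 2) ^ 2 < Λ) (lam : ℝ) (hlam : 0 < lam)
    (u : HypSoliton.Space d → 𝕜) (hsym : HypSoliton.IsSphericallySymmetric u)
    (hmin : HypSoliton.IsMinimizerI d p lam u ∨ HypSoliton.IsMinimizerJ d p Λ lam u) :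
    ∃ v : HypSoliton.Space d → 𝕜, u =ᵐ[volume] v ∧ ContDiff ℝ 2 v ∧
      ∃ C > 0, ∃ δ > 0, ∀ k : ℕ, k ≤ 2 → ∀ x : HypSoliton.Space d,
        ‖iteratedFDeriv ℝ k v x‖ ≤ C * Real.exp (-δ * ‖x‖) :=
  HypSoliton.exists_contDiff_two_exp_decay hd hp hp_sub hΛ hlam hsym hmin
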